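/- Let $\mathcal X,\mathcal Y$ be finite alphabets and let $\mathcal W,\mathcal V$ be non-empty classes of discrete memoryless channels from $\mathcal X$ to $\mathcal Y$. Fix a distribution $P_X$ on $\mathcal X$, a rate $R\ge 0$ and $\alpha\in\mathbb R$. All logarithms are natural, $[t]_+=\max\{t,0\}$, and an infimum over the empty set is $+\infty$. All joint distributions $Q$ on $\mathcal X\times\mathcal Y$ below have $\mathcal X$-marginal $P_X$; $Q_Y$, $Q_{Y|X}$ and $I(Q)$ denote the $\mathcal Y$-marginal, the conditional distribution and the mutual information. Put $$f_W(Q)=\sum_{x,y}Q(x,y)\log W(y|x),\qquad f_{\mathcal W}(Q)=\sup_{W\in\mathcal W}f_W(Q),\qquad f_{\mathcal V}(Q)=\sup_{V\in\mathcal V}f_V(Q),$$ where $f_W(Q)=-\infty$ if $Q(x,y)>0=W(y|x)$ for some $(x,y)$, and assume that $f_{\mathcal W}$ and $f_{\mathcal V}$ are continuous functions of $Q$ with values in $[-\infty,\infty)$. Put $$\mathbf s(Q_Y,\gamma)=\min_{Q'\colon Q'_Y=Q_Y,\ f_{\mathcal W}(Q')>-\infty}\ I(Q')+[-\alpha-f_{\mathcal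 W}(Q')+\gamma]_+ ,$$ $$E_A(W)=\min\Big\{D(\tilde Q_{Y|X}\|W|P_X):\ f_{\mathcal W}(\tilde Q)\le-\alpha+f_{\mathcal V}(\tilde Q),\ \mathbf s(\tilde Q_Y,f_{\mathcal V}(\tilde Q))\ge R\Big\},$$ $$E_B(W)=\min_{(\tilde Q,\bar Q)}\Big\{D(\tilde Q_{Y|X}\|W|P_X)+[I(\bar Q)-R]_+\Big\},$$ the last minimum being over the pairs $(\tilde Q,\bar Q)$ with $\bar Q_Y=\tilde Q_Y$, $f_{\mathcal W}(\bar Q)\le-\alpha+f_{\mathcal V}(\bar Q)$, $f_{\mathcal V}(\bar Q)\ge\alpha+f_{\mathcal W}(\tilde Q)-[R-I(\bar Q)]_+$ and $\mathbf s\big(\tilde Q_Y,f_{\mathcal V}(\bar Q)+[R-I(\bar Q)]_+\big)\ge R$. Let $E_{\mathrm{TE,U}}^{\mathrm{RC}}(W)=\min\{E_A(W),E_B(W)\}$ for $W\in\mathcal W$, and $$E_{\mathrm{TE,U}}^{\mathrm{RC}}=E_{\mathrm{TE,U}}^{\mathrm{RC}}(R,\alpha,P_X,\mathcal W,\mathcal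 V)=\inf_{W\in\mathcal W}E_{\mathrm{TE,U}}^{\mathrm{RC}}(W).$$ For a codebook $\mathcal C_n=\{\mathbf x_1,\dots,\mathbf x_M\}\subset\mathcal X^n$ with $M=\lceil e^{nR}\rceil$, let the universal detector $\phi^{\mathrm U}$ have the rejection region $$\mathcal R_0^{\mathrm U}=\Big\{\mathbf y:\ e^{n\alpha}\sum_{m=1}^M\sup_{W\in\mathcal W}W(\mathbf y|\mathbf x_m)\le\sum_{m=1}^M\sup_{V\in\mathcal V}V(\mathbf y|\mathbf x_m)\Big\}.$$ Let $P_{\mathrm{FA}}^{W}=\frac1M\sum_m W(\mathcal R_0^{\mathrm U}|\mathbf x_m)$, $P_{\mathrm{FA}}=\sup_{W\in\mathcal W}P_{\mathrm{FA}}^{W}$ and $P_{\mathrm{MD}}=\sup_{V\in\mathcal V}\frac1M\sum_m V(\overline{\mathcal R_0^{\mathrm U}}|\mathbf x_m)$, and let $E_{\mathrm{FA}}^{W}$, $E_{\mathrm{FA}}$, $E_{\mathrm{MD}}$ be the corresponding exponents $\liminf_{n\to\infty}-\frac1n\log P$ of a sequence of codebooks. Then there is a sequence of codebooks $\mathcal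 C=\{\mathcal C_n\}_{n\ge1}$ of rate $R$, whose codewords are distinct if $R$ is less than the entropy $H(P_X)$ and may repeat otherwise, such that for every $\delta>0$ $$E_{\mathrm{FA}}^{W}(\mathcal C,\phi^{\mathrm U})\ge E_{\mathrm{TE,U}}^{\mathrm{RC}}(W)-\delta\ \text{ for all }W\in\mathcal W,\qquad E_{\mathrm{FA}}(\mathcal C,\phi^{\mathrm U})\ge E_{\mathrm{TE,U}}^{\mathrm{RC}}-\delta,$$ and, provided that the misdetection exponent is not trivial, in the sense that $E_{\mathrm{TE,U}}^{\mathrm{RC}}(R,-\alpha,P_X,\mathcal V,\mathcal W)>0$ (the same expression with the two classes exchanged and $\alpha$ replaced by $-\alpha$), $$E_{\mathrm{MD}}(\mathcal C,\phi^{\mathrm U})\ge E_{\mathrm{TE,U}}^{\mathrm{RC}}-\alpha-\delta .$$ -/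

import Mathlib

open Filter
open scoped BigOperators

noncomputable section

/-- A discrete memoryless channel with input alphabet `X` and output alphabet `Y`;
`W.prob x y` is the transition probability `W(y|x)`. -/
structure DMC (X Y : Type*) [Fintype Y] where
  prob : X → Y → ℝ
  nonneg : ∀ x y, 0 ≤ prob x y
  sum_eq_one : ∀ x, ∑ y, prob x y = 1

section Detector

variable {X Y : Type*} [Fintype X] [Fintype Y]

/-- `W(𝐲|𝐱) = ∏ᵢ W(yᵢ|xᵢ)`. -/
def DMC.lik (W : DMC X Y) {n : ℕ} (x : Fin n → X) (y : Fin n → Y) : ℝ :=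
  ∏ i, W.prob (x i) (y i)

/-- The number of codewords `M = ⌈e^{nR}⌉`. -/
def numCodewords (R : ℝ) (n : ℕ) : ℕ := ⌈Real.exp (n * R)⌉₊

/-- A sequence of codebooks of rate `R`: for every blocklength `n`, codewords `𝐱₁, …, 𝐱_M`. -/
abbrev CodeSeq (X : Type*) (R : ℝ) : Type _ :=
  (n : ℕ) → Fin (numCodewords R n) → Fin n → X

/-- The largest likelihood `max_{W ∈ 𝒲} W(𝐲|𝐱)` over a class of channels. -/
def maxLik (𝒲 : Set (DMC X Y)) {n : ℕ} (x : Fin n → X) (y : Fin n → Y) : ℝ :=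
  ⨆ W : 𝒲, (W : DMC X Y).lik x y

/-- The rejection region of the universal detector, for the codebook `c`. The false-alarm and the
misdetection probability of a detector/decoder depend only on its rejection region. -/
def rejU (α : ℝ) (𝒲 𝒱 : Set (DMC X Y)) {n M : ℕ} (c : Fin M → Fin n → X) : Set (Fin n → Y) :=
  {y | Real.exp (n * α) * ∑ m, maxLik 𝒲 (c m) y ≤ ∑ m, maxLik 𝒱 (c m) y}

/-- `(1/M) ∑ₘ W(A|𝐱ₘ)`: the probability that the output lies in `A` when a uniformly chosen
codeword is sent over `W`. -/
def outProb (W : DMC X Y) {n M : ℕ} (c : Fin M → Fin n → X) (A : Set (Fin n → Y)) : ℝ :=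
  (1 / (M : ℝ)) * ∑ m, ∑ y, A.indicator (fun y => W.lik (c m) y) y

/-- False-alarm probability of the universal detector when the channel is `W`. -/
def faProb (α : ℝ) (W : DMC X Y) (𝒲 𝒱 : Set (DMC X Y)) {n M : ℕ} (c : Fin M → Fin n → X) : ℝ :=
  outProb W c (rejU α 𝒲 𝒱 c)

/-- Worst-case false-alarm probability, over `W ∈ 𝒲`. -/
def faProbWorst (α : ℝ) (𝒲 𝒱 : Set (DMC X Y)) {n M : ℕ} (c : Fin M → Fin n → X) : ℝ :=
  ⨆ W : 𝒲, faProb α (W : DMC X Y) 𝒲 𝒱 c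

/-- Worst-case misdetection probability, over `V ∈ 𝒱`. -/
def mdProbWorst (α : ℝ) (𝒲 𝒱 : Set (DMC X Y)) {n M : ℕ} (c : Fin M → Fin n → X) : ℝ :=
  ⨆ V : 𝒱, outProb (V : DMC X Y) c (rejU α 𝒲 𝒱 c)ᶜ

end Detector

/-- The exponent `liminf -(1/n) log pₙ`, with `-log 0 = +∞`. -/
def errExponent (p : ℕ → ℝ) : EReal :=
  liminf (fun n : ℕ => -(ENNReal.log (ENNReal.ofReal (p n))) / (n : EReal)) atTop

section Exponents

variable {X Y : Type*} [Fintype X] [Fintype Y]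

/-- Entropy (in nats) of a distribution. -/
def entropy (P : X → ℝ) : ℝ := ∑ x, Real.negMulLog (P x)

/-- Joint distributions `Q` on `X × Y` whose `X`-marginal is `P`. -/
def jointLaws (Y : Type*) [Fintype Y] (P : X → ℝ) : Set (X × Y → ℝ) :=
  {Q | (∀ p, 0 ≤ Q p) ∧ ∀ x, ∑ y, Q (x, y) = P x}

/-- The `Y`-marginal `Q_Y`. -/
def margY (Q : X × Y → ℝ) (y : Y) : ℝ := ∑ x, Q (x, y)

/-- Mutual information `I(Q)` of a joint distribution with `X`-marginal `P`. -/
def mutInfo (P : X → ℝ) (Q : X × Y → ℝ) : ℝ :=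
  ∑ x, ∑ y, Q (x, y) * Real.log (Q (x, y) / (P x * margY Q y))

open Classical in
/-- `f_W(Q) = ∑ Q(x,y) log W(y|x)`, equal to `-∞` if `Q` charges a pair with `W(y|x) = 0`. -/
def logLik (W : DMC X Y) (Q : X × Y → ℝ) : EReal :=
  if ∀ x y, 0 < Q (x, y) → 0 < W.prob x y then
    ((∑ x, ∑ y, Q (x, y) * Real.log (W.prob x y) : ℝ) : EReal)
  else ⊥

/-- `f_𝒲(Q) = max_{W ∈ 𝒲} f_W(Q)`. -/
def genLogLik (𝒲 : Set (DMC X Y)) (Q : X × Y → ℝ) : EReal :=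
  ⨆ W ∈ 𝒲, logLik W Q

open Classical in
/-- `D(Q_{Y|X} ‖ W | P)` for a joint distribution `Q` with `X`-marginal `P`, equal to `+∞` if `Q`
charges a pair with `W(y|x) = 0`. -/
def condDiv (P : X → ℝ) (W : DMC X Y) (Q : X × Y → ℝ) : EReal :=
  if ∀ x y, 0 < Q (x, y) → 0 < W.prob x y then
    ((∑ x, ∑ y, Q (x, y) * Real.log (Q (x, y) / (P x * W.prob x y)) : ℝ) : EReal)
  else ⊤

/-- `𝐬(q, γ)`: the minimum of `I(Q) + [-α - f_𝒲(Q) + γ]₊` over the joint distributions `Q` with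
marginals `P` and `q` for which `f_𝒲(Q) > -∞`. -/
def sFun (α : ℝ) (P : X → ℝ) (𝒲 : Set (DMC X Y)) (q : Y → ℝ) (γ : EReal) : EReal :=
  ⨅ Q ∈ {Q | Q ∈ jointLaws Y P ∧ ⊥ < genLogLik 𝒲 Q ∧ margY Q = q},
    ((mutInfo P Q : ℝ) : EReal) + max (((-α : ℝ) : EReal) - genLogLik 𝒲 Q + γ) 0

/-- `[R - I(Q)]₊`. -/
def rateGap (R : ℝ) (P : X → ℝ) (Q : X × Y → ℝ) : ℝ := max (R - mutInfo P Q) 0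

/-- The feasible set `𝒥₁ ∩ 𝒥₂`. -/
def setJ (R α : ℝ) (P : X → ℝ) (𝒲 𝒱 : Set (DMC X Y)) : Set (X × Y → ℝ) :=
  {Qt | Qt ∈ jointLaws Y P ∧
    genLogLik 𝒲 Qt ≤ ((-α : ℝ) : EReal) + genLogLik 𝒱 Qt ∧
    (R : EReal) ≤ sFun α P 𝒲 (margY Qt) (genLogLik 𝒱 Qt)}

/-- The feasible set `𝒦₁ ∩ 𝒦₂ ∩ 𝒦₃ ∩ 𝒦₄` of pairs `(Q̃, Q̄)`. -/
def setK (R α : ℝ) (P : X → ℝ) (𝒲 𝒱 : Set (DMC X Y)) : Set ((X × Y → ℝ) × (X × Y → ℝ)) :=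
  {p | p.1 ∈ jointLaws Y P ∧ p.2 ∈ jointLaws Y P ∧
    margY p.2 = margY p.1 ∧
    genLogLik 𝒲 p.2 ≤ ((-α : ℝ) : EReal) + genLogLik 𝒱 p.2 ∧
    (α : EReal) + genLogLik 𝒲 p.1 - ((rateGap R P p.2 : ℝ) : EReal) ≤ genLogLik 𝒱 p.2 ∧
    (R : EReal) ≤ sFun α P 𝒲 (margY p.1) (genLogLik 𝒱 p.2 + ((rateGap R P p.2 : ℝ) : EReal))}

/-- The exponent `E_A` when the channel is `W`. -/
def expA (R α : ℝ) (P : X → ℝ) (W : DMC X Y) (𝒲 𝒱 : Set (DMC X Y)) : EReal :=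
  ⨅ Qt ∈ setJ R α P 𝒲 𝒱, condDiv P W Qt

/-- The exponent `E_B` when the channel is `W`. -/
def expB (R α : ℝ) (P : X → ℝ) (W : DMC X Y) (𝒲 𝒱 : Set (DMC X Y)) : EReal :=
  ⨅ p ∈ setK R α P 𝒲 𝒱, condDiv P W p.1 + ((max (mutInfo P p.2 - R) 0 : ℝ) : EReal)

/-- The universal type-enumeration random coding exponent `min {E_A, E_B}` when the channel
is `W`. -/
def teExponent (R α : ℝ) (P : X → ℝ) (W : DMC X Y) (𝒲 𝒱 : Set (DMC X Y)) : EReal :=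
  min (expA R α P W 𝒲 𝒱) (expB R α P W 𝒲 𝒱)

/-- The exponent for the worst channel of the class. As `D(Q_{Y|X} ‖ W | P) = -f_W(Q) - H_Q(Y|X)`,
this is the exponent for simple hypotheses with `f_W` replaced by `f_𝒲` in the divergence too. -/
def teExponentWorst (R α : ℝ) (P : X → ℝ) (𝒲 𝒱 : Set (DMC X Y)) : EReal :=
  ⨅ W ∈ 𝒲, teExponent R α P W 𝒲 𝒱

end Exponents

end

/-! The code is random with constant composition: its type tends to P, its support lies in that of
P, and the codewords are drawn without replacement from `Ω × Fin L`, where Ω is the type class. With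
L = 1 they are distinct; a larger L lets them repeat. The method of types reduces everything to the
type enumerators N_y(K), the number of codewords that have joint type K with the output y.
`exists_good_code` gives one code whose enumerators are all within a polynomial factor Λ of their
means, or at most about Λ if the mean is below one. Averaged over the outputs of a type, the number
of pairs of different codewords with prescribed joint types is also at most Λ times its natural
size. The code does not depend on the classes or on α.

If the detector rejects y, then some joint type K' carries, up to the number of joint types, the
whole sum over 𝒱, and it beats every class of codewords in the sum over 𝒲. So a large false-alarm
probability yields tables K (sent word) and K' (dominating words) satisfying `Witness`. An
ultrafilter limit (`Witness.limit`) turns them into laws Q and Q' satisfying the constraints of E_A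
or E_B: one law above the rate plays both roles in E_A, and all other cases fall under E_B. In E_B
the penalty [I(Q')-R]₊ is the cost of finding another codeword of type K'. The result is
`eventually_faProb_le`, uniform over a class 𝒰, which may be {W}, 𝒲 or, in the exchanged problem, 𝒱.

Misdetection is a false alarm with 𝒲 and 𝒱 exchanged and α replaced by -α, so it remains to compare
the two exponents (`teExponentWorst_le_add_of_pos`). A nearly optimal configuration of the exchanged
problem is moved along a segment towards the law of the channel, and its cost does not grow. Because
the exchanged exponent is positive, the free endpoint lies strictly outside its feasible region, so
the segment crosses the boundary, where the total likelihoods of 𝒱 and 𝒲 differ exactly by exp(α).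
There a law attaining the level of 𝒲 and one attaining that of 𝒱 form a feasible point of the
original problem that costs at most α more (`teExponentWorst_le_of_lvl_eq`). -/

noncomputable section

/-! ### Uniformly random injections. -/

section Embeddings

open Classical in
-- Splitting the domain into J and its complement makes an extension of f the same as an injection
-- of the complement into what the range of f leaves free.
theorem card_embedding_extending {I Ω : Type*} [Fintype I] [Fintype Ω] (J : Finset I)
    (f : J ↪ Ω) :
    (Finset.univ.filter fun e : I ↪ Ω => (Function.Embedding.subtype (· ∈ J)).trans e = f).card =
      (Fintype.card Ω - J.card).descFactorial (Fintype.card I - J.card) := by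
  let E₁ : (I ↪ Ω) ≃ ({j // j ∈ J} ⊕ {j // ¬ j ∈ J} ↪ Ω) :=
    Equiv.embeddingCongr (Equiv.sumCompl (· ∈ J)).symm (Equiv.refl Ω)
  let E : (I ↪ Ω) ≃ Σ f : {j // j ∈ J} ↪ Ω, {j // ¬ j ∈ J} ↪ ↥(Set.range f)ᶜ :=
    E₁.trans Equiv.sumEmbeddingEquivSigmaEmbeddingRestricted
  have hE : ∀ e, (E e).1 = (Function.Embedding.subtype (· ∈ J)).trans e := by
    intro e; ext j; rfl
  have h1 : (Finset.univ.filter fun e : I ↪ Ω =>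
      (Function.Embedding.subtype (· ∈ J)).trans e = f).card =
      Fintype.card {s : (Σ f : {j // j ∈ J} ↪ Ω, {j // ¬ j ∈ J} ↪ ↥(Set.range f)ᶜ) // s.1 = f} := by
    rw [← Fintype.card_subtype]
    exact Fintype.card_congr (Equiv.subtypeEquiv E fun e => by rw [hE])
  let E₂ : {s : (Σ f : {j // j ∈ J} ↪ Ω, {j // ¬ j ∈ J} ↪ ↥(Set.range f)ᶜ) // s.1 = f} ≃
      ({j // ¬ j ∈ J} ↪ ↥(Set.range f)ᶜ) :=
    { toFun := fun s => s.2 ▸ s.1.2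
      invFun := fun g => ⟨⟨f, g⟩, rfl⟩
      left_inv := by rintro ⟨⟨g, x⟩, rfl⟩; rfl
      right_inv := fun g => rfl }
  rw [h1, Fintype.card_congr E₂, Fintype.card_embedding_eq]
  congr 1
  · rw [Fintype.card_compl_set, Set.card_range_of_injective f.injective]; simp
  · rw [Fintype.card_subtype_compl]; simp

open Classical in
-- All injections of J have equally many extensions, so the restriction of a uniformly random
-- injection is uniformly random.
theorem card_embedding_filter_restrict {I Ω : Type*} [Fintype I] [Fintype Ω] (J : Finset I)
    (p : (J ↪ Ω) → Prop) :
    (Finset.univ.filter fun e : I ↪ Ω =>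
        p ((Function.Embedding.subtype (· ∈ J)).trans e)).card *
        (Fintype.card Ω).descFactorial J.card =
      (Finset.univ.filter p).card * Fintype.card (I ↪ Ω) := by
  have hJ : J.card ≤ Fintype.card I := Finset.card_le_univ J
  have h1 : (Finset.univ.filter fun e : I ↪ Ω =>
        p ((Function.Embedding.subtype (· ∈ J)).trans e)).card =
      (Finset.univ.filter p).card *
        (Fintype.card Ω - J.card).descFactorial (Fintype.card I - J.card) := by
    rw [Finset.card_eq_sum_card_fiberwise (t := Finset.univ.filter p)
      (f := fun e : I ↪ Ω => (Function.Embedding.subtype (· ∈ J)).trans e)]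
    · rw [← smul_eq_mul, ← Finset.sum_const]
      refine Finset.sum_congr rfl fun f hf => ?_
      rw [← card_embedding_extending J f, Finset.filter_filter]
      congr 1
      ext e
      simp only [Finset.mem_filter, Finset.mem_univ, true_and] at hf ⊢
      exact ⟨fun h => h.2, fun h => ⟨h ▸ hf, h⟩⟩
    · intro e he
      simpa using he
  have h2 : Fintype.card (I ↪ Ω) =
      (Fintype.card Ω - J.card).descFactorial (Fintype.card I - J.card) *
        (Fintype.card Ω).descFactorial J.card := by
    rw [Fintype.card_embedding_eq, Nat.descFactorial_mul_descFactorial hJ]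
  rw [h1, h2, mul_assoc]

/-- Factor by factor, (a-k)/(b-k) ≤ a/b: sampling without replacement is dominated by sampling with
replacement. -/
theorem descFactorial_mul_pow_le {a b : ℕ} (hab : a ≤ b) (k : ℕ) :
    a.descFactorial k * b ^ k ≤ a ^ k * b.descFactorial k := by
  induction k with
  | zero => simp
  | succ k ih =>
    rw [Nat.descFactorial_succ, Nat.descFactorial_succ, pow_succ, pow_succ]
    have h : (a - k) * b ≤ a * (b - k) := by
      rcases le_total a k with h | h
      · simp [Nat.sub_eq_zero_of_le h]
      · zify [h, h.trans hab]; nlinarith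
    calc (a - k) * a.descFactorial k * (b ^ k * b)
        = ((a - k) * b) * (a.descFactorial k * b ^ k) := by ring
      _ ≤ (a * (b - k)) * (a ^ k * b.descFactorial k) := Nat.mul_le_mul h ih
      _ = _ := by ring

open Classical in
/-- A uniformly random injection maps `J` into `A` with probability at most `(|A|/|Ω|)^|J|`. -/
theorem card_embedding_mapsTo_le {I Ω : Type*} [Fintype I] [Fintype Ω] (J : Finset I)
    (A : Finset Ω) (h : Fintype.card I ≤ Fintype.card Ω) :
    (Finset.univ.filter fun e : I ↪ Ω => ∀ j ∈ J, e j ∈ A).card * Fintype.card Ω ^ J.card ≤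
      A.card ^ J.card * Fintype.card (I ↪ Ω) := by
  have h1 := card_embedding_filter_restrict J (fun f : J ↪ Ω => ∀ j, f j ∈ A)
  have h2 : (Finset.univ.filter fun f : J ↪ Ω => ∀ j, f j ∈ A).card =
      A.card.descFactorial J.card := by
    rw [← Fintype.card_subtype]
    have := Fintype.card_congr (Equiv.codRestrict J (A : Set Ω))
    rw [Fintype.card_embedding_eq] at this
    simpa using this
  have h3 : (Finset.univ.filter fun e : I ↪ Ω => ∀ j ∈ J, e j ∈ A).card *
      (Fintype.card Ω).descFactorial J.card =
      A.card.descFactorial J.card * Fintype.card (I ↪ Ω) := by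
    rw [← h2]
    convert h1 using 3
    · ext e; simp
    · ext f; simp
  have hpos : 0 < (Fintype.card Ω).descFactorial J.card :=
    Nat.descFactorial_pos.2 ((Finset.card_le_univ J).trans h)
  refine Nat.le_of_mul_le_mul_right ?_ hpos
  calc _ = (A.card.descFactorial J.card * Fintype.card Ω ^ J.card) * Fintype.card (I ↪ Ω) := by
        rw [mul_right_comm, h3]; ring
    _ ≤ (A.card ^ J.card * (Fintype.card Ω).descFactorial J.card) * Fintype.card (I ↪ Ω) :=
        Nat.mul_le_mul_right _ (descFactorial_mul_pow_le (Finset.card_le_univ A) _)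
    _ = _ := by ring

open Classical in
/-- Two values of a uniformly random injection lie in given sets with probability at most twice
the product of the densities. -/
theorem card_embedding_pair_le {I Ω : Type*} [Fintype I] [Fintype Ω] {i j : I} (hij : i ≠ j)
    (A B : Finset Ω) (h : Fintype.card I ≤ Fintype.card Ω) :
    (Finset.univ.filter fun e : I ↪ Ω => e i ∈ A ∧ e j ∈ B).card * Fintype.card Ω ^ 2 ≤
      2 * (A.card * B.card) * Fintype.card (I ↪ Ω) := by
  let J : Finset I := {i, j}
  have hJ : J.card = 2 := Finset.card_pair hij
  have hi : i ∈ J := by simp [J]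
  have hj : j ∈ J := by simp [J]
  have h1 := card_embedding_filter_restrict J
    (fun f : J ↪ Ω => f ⟨i, hi⟩ ∈ A ∧ f ⟨j, hj⟩ ∈ B)
  have h2 : (Finset.univ.filter fun f : J ↪ Ω => f ⟨i, hi⟩ ∈ A ∧ f ⟨j, hj⟩ ∈ B).card ≤
      A.card * B.card := by
    rw [← Finset.card_product]
    refine Finset.card_le_card_of_injOn (fun f => (f ⟨i, hi⟩, f ⟨j, hj⟩)) ?_ ?_
    · intro f hf; simpa using hf
    · intro f _ g _ hfg
      simp only [Prod.mk.injEq] at hfg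
      ext ⟨x, hx⟩
      have hx' : x = i ∨ x = j := by simpa [J] using hx
      rcases hx' with rfl | rfl
      · exact hfg.1
      · exact hfg.2
  have hΩ : 2 ≤ Fintype.card Ω := by
    refine le_trans ?_ h
    rw [← hJ]; exact Finset.card_le_univ J
  rw [hJ] at h1
  -- The factor 2 of the statement: N² ≤ 2N(N-1) as soon as N ≥ 2.
  have h3 : (Fintype.card Ω) ^ 2 ≤ 2 * (Fintype.card Ω).descFactorial 2 := by
    obtain ⟨k, hk⟩ := Nat.exists_eq_add_of_le hΩ
    rw [hk]
    simp only [Nat.descFactorial_succ, Nat.descFactorial_zero]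
    have : 2 + k - 1 = 1 + k := by omega
    rw [this]; simp only [Nat.sub_zero, mul_one]; nlinarith
  calc _ ≤ (Finset.univ.filter fun e : I ↪ Ω => e i ∈ A ∧ e j ∈ B).card *
        (2 * (Fintype.card Ω).descFactorial 2) := Nat.mul_le_mul_left _ h3
    _ = 2 * ((Finset.univ.filter fun f : J ↪ Ω => f ⟨i, hi⟩ ∈ A ∧ f ⟨j, hj⟩ ∈ B).card *
        Fintype.card (I ↪ Ω)) := by
        have h4 : (Finset.univ.filter fun e : I ↪ Ω => e i ∈ A ∧ e j ∈ B).card *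
            (Fintype.card Ω).descFactorial 2 = (Finset.univ.filter fun f : J ↪ Ω =>
              f ⟨i, hi⟩ ∈ A ∧ f ⟨j, hj⟩ ∈ B).card * Fintype.card (I ↪ Ω) := by
          convert h1 using 3
          · ext e; simp
          · ext f; simp
        rw [← h4]; ring
    _ ≤ 2 * ((A.card * B.card) * Fintype.card (I ↪ Ω)) := by gcongr
    _ = _ := by ring

end Embeddings

/-! ### Concentration of the number of codewords in prescribed sets. -/

section RandomCode

variable {Ω : Type*} [Fintype Ω] {M L : ℕ}

open Classical in
/-- The number of codewords of the code `m ↦ (e m).1` that lie in `S`. -/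
def hits (S : Finset Ω) (e : Fin M ↪ Ω × Fin L) : ℕ :=
  (Finset.univ.filter fun m => (e m).1 ∈ S).card

/-- The density of `S` in `Ω`. -/
def dens (S : Finset Ω) : ℝ := S.card / Fintype.card Ω

theorem dens_nonneg (S : Finset Ω) : 0 ≤ dens S := by unfold dens; positivity

theorem dens_le_one (S : Finset Ω) : dens S ≤ 1 := by
  unfold dens
  exact div_le_one_of_le₀ (by exact_mod_cast Finset.card_le_univ S) (by positivity)

open Classical in
theorem dens_compl [Nonempty Ω] (S : Finset Ω) : dens Sᶜ = 1 - dens S := by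
  unfold dens
  have : (0 : ℝ) < Fintype.card Ω := by exact_mod_cast Fintype.card_pos
  rw [Finset.card_compl, Nat.cast_sub (Finset.card_le_univ S)]
  field_simp

open Classical in
-- The label in `Fin L` only allows a codeword to be used up to L times; S × `Fin L` has the same
-- density as S, so L disappears from the bound.
theorem card_code_mapsTo_le [Nonempty Ω] (hL : 0 < L) (h : M ≤ Fintype.card Ω * L)
    (J : Finset (Fin M)) (S : Finset Ω) :
    ((Finset.univ.filter fun e : Fin M ↪ Ω × Fin L => ∀ j ∈ J, (e j).1 ∈ S).card : ℝ) ≤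
      dens S ^ J.card * Fintype.card (Fin M ↪ Ω × Fin L) := by
  have h1 := card_embedding_mapsTo_le (I := Fin M) J (S ×ˢ (Finset.univ : Finset (Fin L)))
    (by simpa using h)
  simp only [Finset.mem_product, Finset.mem_univ, and_true, Finset.card_product,
    Finset.card_univ, Fintype.card_prod, Fintype.card_fin] at h1
  have hΩ : (0 : ℝ) < Fintype.card Ω := by exact_mod_cast Fintype.card_pos
  have hL' : (0 : ℝ) < L := by exact_mod_cast hL
  have h2 : dens S ^ J.card = ((S.card * L : ℝ) ^ J.card) / ((Fintype.card Ω * L : ℝ) ^ J.card) := by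
    unfold dens
    rw [← div_pow, mul_div_mul_right _ _ hL'.ne']
  rw [h2, div_mul_eq_mul_div, le_div_iff₀ (by positivity)]
  exact_mod_cast h1

open Classical in
theorem card_code_pair_le [Nonempty Ω] (hL : 0 < L) (h : M ≤ Fintype.card Ω * L)
    {i j : Fin M} (hij : i ≠ j) (S S' : Finset Ω) :
    ((Finset.univ.filter fun e : Fin M ↪ Ω × Fin L => (e i).1 ∈ S ∧ (e j).1 ∈ S').card : ℝ) ≤
      2 * (dens S * dens S') * Fintype.card (Fin M ↪ Ω × Fin L) := by
  have h1 := card_embedding_pair_le hij (S ×ˢ (Finset.univ : Finset (Fin L)))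
    (S' ×ˢ (Finset.univ : Finset (Fin L))) (by simpa using h)
  simp only [Finset.mem_product, Finset.mem_univ, and_true, Finset.card_product,
    Finset.card_univ, Fintype.card_prod, Fintype.card_fin] at h1
  have hΩ : (0 : ℝ) < Fintype.card Ω := by exact_mod_cast Fintype.card_pos
  have hL' : (0 : ℝ) < L := by exact_mod_cast hL
  have h2 : dens S * dens S' = ((S.card * L) * (S'.card * L) : ℝ) / ((Fintype.card Ω * L : ℝ) ^ 2) := by
    unfold dens
    field_simp
  rw [h2, mul_div_assoc', div_mul_eq_mul_div, le_div_iff₀ (by positivity)]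
  exact_mod_cast h1

open Classical in
-- Union bound over the k-element sets of messages that may all fall into S.
theorem card_le_hits [Nonempty Ω] (hL : 0 < L) (h : M ≤ Fintype.card Ω * L)
    (S : Finset Ω) (k : ℕ) :
    ((Finset.univ.filter fun e : Fin M ↪ Ω × Fin L => k ≤ hits S e).card : ℝ) ≤
      M.choose k * dens S ^ k * Fintype.card (Fin M ↪ Ω × Fin L) := by
  have hsub : (Finset.univ.filter fun e : Fin M ↪ Ω × Fin L => k ≤ hits S e) ⊆
      (Finset.powersetCard k (Finset.univ : Finset (Fin M))).biUnion fun J =>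
        Finset.univ.filter fun e : Fin M ↪ Ω × Fin L => ∀ j ∈ J, (e j).1 ∈ S := by
    intro e he
    simp only [Finset.mem_filter, Finset.mem_univ, true_and] at he
    obtain ⟨J, hJ, hJk⟩ := Finset.exists_subset_card_eq he
    simp only [Finset.mem_biUnion, Finset.mem_powersetCard, Finset.mem_filter, Finset.mem_univ,
      true_and]
    exact ⟨J, ⟨Finset.subset_univ _, hJk⟩, fun j hj => by simpa using hJ hj⟩
  have hcard := (Finset.card_le_card hsub).trans Finset.card_biUnion_le
  calc ((Finset.univ.filter fun e : Fin M ↪ Ω × Fin L => k ≤ hits S e).card : ℝ)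
      ≤ ∑ J ∈ Finset.powersetCard k (Finset.univ : Finset (Fin M)),
        ((Finset.univ.filter fun e : Fin M ↪ Ω × Fin L => ∀ j ∈ J, (e j).1 ∈ S).card : ℝ) := by
        exact_mod_cast hcard
    _ ≤ ∑ J ∈ Finset.powersetCard k (Finset.univ : Finset (Fin M)),
        dens S ^ k * Fintype.card (Fin M ↪ Ω × Fin L) := by
        refine Finset.sum_le_sum fun J hJ => ?_
        rw [← (Finset.mem_powersetCard.1 hJ).2]
        exact card_code_mapsTo_le hL h J S
    _ = _ := by
        rw [Finset.sum_const, Finset.card_powersetCard, Finset.card_univ, Fintype.card_fin,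
          nsmul_eq_mul, mul_assoc]

open Classical in
theorem hits_add_hits_compl (S : Finset Ω) (e : Fin M ↪ Ω × Fin L) :
    hits S e + hits Sᶜ e = M := by
  have := Finset.card_filter_add_card_filter_not (s := (Finset.univ : Finset (Fin M)))
    (fun m => (e m).1 ∈ S)
  simpa [hits] using this

open Classical in
-- Few hits of S are many hits of its complement, so the upper-tail bound also serves for the lower
-- tail.
theorem card_hits_le [Nonempty Ω] (hL : 0 < L) (h : M ≤ Fintype.card Ω * L)
    (S : Finset Ω) {l : ℕ} (hl : l ≤ M) :
    ((Finset.univ.filter fun e : Fin M ↪ Ω × Fin L => hits S e ≤ l).card : ℝ) ≤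
      M.choose l * (1 - dens S) ^ (M - l) * Fintype.card (Fin M ↪ Ω × Fin L) := by
  have h1 := card_le_hits hL h Sᶜ (M - l)
  rw [dens_compl, Nat.choose_symm hl] at h1
  refine le_trans ?_ h1
  norm_cast
  refine Finset.card_le_card fun e he => ?_
  simp only [Finset.mem_filter, Finset.mem_univ, true_and] at he ⊢
  have := hits_add_hits_compl S e
  omega

/-- Since Mp ≤ k/Λ and k! ≥ (k/e)^k, the left side is at most (e/Λ)^k ≤ e^(-k). -/
theorem choose_mul_pow_le_exp {M k : ℕ} {p Λ : ℝ} (hp : 0 ≤ p) (hΛ : Real.exp 2 ≤ Λ)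
    (hk : Λ * max 1 (M * p) ≤ k) : (M.choose k : ℝ) * p ^ k ≤ Real.exp (-(Λ / 2)) := by
  have hΛ0 : 0 < Λ := (Real.exp_pos 2).trans_le hΛ
  have hkΛ : Λ ≤ k := le_trans (le_mul_of_one_le_right hΛ0.le (le_max_left _ _)) hk
  have hk0 : (0 : ℝ) < k := hΛ0.trans_le hkΛ
  have h1 : (M.choose k : ℝ) ≤ (M : ℝ) ^ k / (k.factorial : ℝ) := by
    exact_mod_cast Nat.choose_le_pow_div (α := ℝ) k M
  have h2 : (k : ℝ) ^ k / (k.factorial : ℝ) ≤ Real.exp k :=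
    Real.pow_div_factorial_le_exp _ hk0.le k
  have hf : (0 : ℝ) < k.factorial := by exact_mod_cast k.factorial_pos
  have h3 : (M * p : ℝ) ≤ k / Λ := by
    rw [le_div_iff₀ hΛ0, mul_comm]
    exact (mul_le_mul_of_nonneg_left (le_max_right _ _) hΛ0.le).trans hk
  have h4 : (1 / Λ : ℝ) ≤ Real.exp (-2) := by
    rw [Real.exp_neg, ← one_div]; exact one_div_le_one_div_of_le (Real.exp_pos 2) hΛ
  calc (M.choose k : ℝ) * p ^ k ≤ (M : ℝ) ^ k / (k.factorial : ℝ) * p ^ k := by gcongr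
    _ = (M * p) ^ k / (k.factorial : ℝ) := by rw [mul_pow]; ring
    _ ≤ (k / Λ) ^ k / (k.factorial : ℝ) := by gcongr
    _ = ((k : ℝ) ^ k / (k.factorial : ℝ)) * (1 / Λ) ^ k := by rw [div_pow, div_pow, one_pow]; ring
    _ ≤ Real.exp k * Real.exp (-2) ^ k := by gcongr
    _ = Real.exp (-k) := by rw [← Real.exp_nat_mul, ← Real.exp_add]; congr 1; ring
    _ ≤ Real.exp (-(Λ / 2)) := by rw [Real.exp_le_exp]; linarith

/-- The left side is at most exp(l log M - p(M-l)). As lΛ ≤ Mp, the bounds 4 log M ≤ Λ and 4 ≤ Λ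
make l log M and pl at most Mp/4 each, which leaves -Mp/2. -/
theorem choose_mul_one_sub_pow_le_exp {M l : ℕ} {p Λ : ℝ} (hM : 0 < M) (hp1 : p ≤ 1)
    (hΛ : 4 ≤ Λ) (hΛM : 4 * Real.log M ≤ Λ) (hMp : Λ ≤ M * p) (hl : (l : ℝ) ≤ M * p / Λ)
    (hlM : l ≤ M) :
    (M.choose l : ℝ) * (1 - p) ^ (M - l) ≤ Real.exp (-(Λ / 2)) := by
  have hM0 : (0 : ℝ) < M := by exact_mod_cast hM
  have hΛ0 : 0 < Λ := by linarith
  have hl' : (l : ℝ) * Λ ≤ M * p := by rwa [le_div_iff₀ hΛ0] at hl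
  have h1 : (M.choose l : ℝ) ≤ Real.exp (l * Real.log M) := by
    rw [Real.exp_nat_mul, Real.exp_log hM0]
    exact_mod_cast Nat.choose_le_pow M l
  have h2 : (1 - p) ^ (M - l) ≤ Real.exp (-(p * (M - l))) := by
    calc (1 - p) ^ (M - l) ≤ Real.exp (-p) ^ (M - l) :=
          pow_le_pow_left₀ (by linarith) (Real.one_sub_le_exp_neg p) _
      _ = _ := by rw [← Real.exp_nat_mul, Nat.cast_sub hlM]; congr 1; ring
  calc _ ≤ Real.exp (l * Real.log M) * Real.exp (-(p * (M - l))) := by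
        have : 0 ≤ (1 - p) ^ (M - l) := pow_nonneg (by linarith) _
        gcongr
    _ = Real.exp (l * Real.log M - p * (M - l)) := by rw [← Real.exp_add]; congr 1
    _ ≤ _ := by
        rw [Real.exp_le_exp]
        have hl0 : (0 : ℝ) ≤ l := Nat.cast_nonneg l
        have a1 : l * (4 * Real.log M) ≤ l * Λ := mul_le_mul_of_nonneg_left hΛM hl0
        have a2 : (l : ℝ) * 4 ≤ l * Λ := mul_le_mul_of_nonneg_left hΛ hl0
        have a3 : p * l ≤ l := mul_le_of_le_one_left hl0 hp1
        nlinarith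

open Classical in
/-- The number of ordered pairs of different codewords that lie in `S × S'`. -/
def pairHits (S S' : Finset Ω) (e : Fin M ↪ Ω × Fin L) : ℕ :=
  (Finset.univ.filter fun m : Fin M × Fin M =>
    m.1 ≠ m.2 ∧ (e m.1).1 ∈ S ∧ (e m.2).1 ∈ S').card

open Classical in
theorem sum_pairHits_le [Nonempty Ω] (hL : 0 < L) (h : M ≤ Fintype.card Ω * L)
    (S S' : Finset Ω) :
    (∑ e : Fin M ↪ Ω × Fin L, (pairHits S S' e : ℝ)) ≤
      2 * (M : ℝ) ^ 2 * (dens S * dens S') * Fintype.card (Fin M ↪ Ω × Fin L) := by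
  have h1 : ∀ e : Fin M ↪ Ω × Fin L, (pairHits S S' e : ℝ) = ∑ m : Fin M × Fin M,
      if m.1 ≠ m.2 ∧ (e m.1).1 ∈ S ∧ (e m.2).1 ∈ S' then 1 else 0 := by
    intro e; rw [pairHits, Finset.card_filter]; push_cast; rfl
  simp_rw [h1]
  rw [Finset.sum_comm]
  calc _ ≤ ∑ m : Fin M × Fin M, 2 * (dens S * dens S') * Fintype.card (Fin M ↪ Ω × Fin L) := by
        refine Finset.sum_le_sum fun m _ => ?_
        by_cases hm : m.1 = m.2
        · simp only [hm, ne_eq, not_true_eq_false, false_and, if_false, Finset.sum_const_zero]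
          have := dens_nonneg S
          have := dens_nonneg S'
          positivity
        · refine le_trans (le_of_eq ?_) (card_code_pair_le hL h hm S S')
          rw [Finset.card_filter]; push_cast
          simp [hm]
    _ = _ := by
        rw [Finset.sum_const, Finset.card_univ, Fintype.card_prod, Fintype.card_fin, nsmul_eq_mul]
        push_cast; ring

open Classical in
-- Pairs are controlled only through the mean, by Markov's inequality. Summing over I beforehand
-- keeps the number of such weak events small.
theorem card_sum_pairHits_gt [Nonempty Ω] {ι : Type*} (hL : 0 < L) (h : M ≤ Fintype.card Ω * L)
    (S : ι → Finset Ω) (I : Finset (ι × ι)) {Λ : ℝ} (hΛ : 0 < Λ) :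
    ((Finset.univ.filter fun e : Fin M ↪ Ω × Fin L =>
      Λ * M ^ 2 * ∑ i ∈ I, dens (S i.1) * dens (S i.2) <
        ∑ i ∈ I, (pairHits (S i.1) (S i.2) e : ℝ)).card : ℝ) ≤
      2 / Λ * Fintype.card (Fin M ↪ Ω × Fin L) := by
  set Z : (Fin M ↪ Ω × Fin L) → ℝ := fun e => ∑ i ∈ I, (pairHits (S i.1) (S i.2) e : ℝ) with hZ
  set B : ℝ := M ^ 2 * ∑ i ∈ I, dens (S i.1) * dens (S i.2) with hB
  have hB0 : 0 ≤ B := mul_nonneg (by positivity)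
    (Finset.sum_nonneg fun i _ => mul_nonneg (dens_nonneg _) (dens_nonneg _))
  have hZ0 : ∀ e, 0 ≤ Z e := fun e => Finset.sum_nonneg fun i _ => Nat.cast_nonneg _
  have hsum : ∑ e, Z e ≤ 2 * B * Fintype.card (Fin M ↪ Ω × Fin L) := by
    simp only [hZ]
    rw [Finset.sum_comm]
    calc _ ≤ ∑ i ∈ I, 2 * (M : ℝ) ^ 2 * (dens (S i.1) * dens (S i.2)) *
            Fintype.card (Fin M ↪ Ω × Fin L) :=
          Finset.sum_le_sum fun i _ => sum_pairHits_le hL h _ _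
      _ = _ := by rw [← Finset.sum_mul, ← Finset.mul_sum, hB]; ring
  have hΛB : Λ * M ^ 2 * ∑ i ∈ I, dens (S i.1) * dens (S i.2) = Λ * B := by rw [hB]; ring
  rw [hΛB]
  have hmarkov : ((Finset.univ.filter fun e => Λ * B < Z e).card : ℝ) * (Λ * B) ≤ ∑ e, Z e := by
    rw [← nsmul_eq_mul, ← Finset.sum_const]
    refine (Finset.sum_le_sum fun e he => (Finset.mem_filter.1 he).2.le).trans ?_
    exact Finset.sum_le_sum_of_subset_of_nonneg (Finset.subset_univ _) fun e _ _ => hZ0 e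
  -- With a vanishing threshold Markov's inequality says nothing, but then the sum vanishes
  -- identically and the strict inequality never holds.
  rcases hB0.eq_or_lt with hB' | hB'
  · have hz : ∀ e, Z e = 0 := by
      have : ∑ e, Z e = 0 := le_antisymm (by simpa [← hB'] using hsum)
        (Finset.sum_nonneg fun e _ => hZ0 e)
      intro e
      exact (Finset.sum_eq_zero_iff_of_nonneg fun e _ => hZ0 e).1 this e (Finset.mem_univ e)
    rw [Finset.filter_false_of_mem (by intro e _; change ¬ Λ * B < Z e; rw [hz, ← hB']; simp)]
    simp; positivity
  · have h2 := hmarkov.trans hsum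
    rw [div_mul_eq_mul_div, le_div_iff₀ hΛ]
    refine le_of_mul_le_mul_right ?_ hB'
    linarith

/-- A random code with the codewords in `Ω` has, for a finite family of subsets of `Ω`, about the
expected number of codewords in each of them; the codewords are distinct if `L = 1`. -/
theorem exists_good_code [Nonempty Ω] {ι κ : Type*} [Fintype ι] [Fintype κ] (hL : 0 < L)
    (hM : 0 < M) (h : M ≤ Fintype.card Ω * L) (S : ι → Finset Ω) (I : κ → Finset (ι × ι))
    {Λ : ℝ} (hΛ : Real.exp 2 ≤ Λ) (hΛM : 4 * Real.log M ≤ Λ)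
    (hcount : 2 * Fintype.card ι * Real.exp (-(Λ / 2)) + 2 * Fintype.card κ / Λ < 1) :
    ∃ e : Fin M ↪ Ω × Fin L,
      (∀ i, (hits (S i) e : ℝ) ≤ 2 * Λ * max 1 (M * dens (S i))) ∧
      (∀ i, Λ ≤ M * dens (S i) → M * dens (S i) / Λ ≤ hits (S i) e) ∧
      ∀ c, ∑ i ∈ I c, (pairHits (S i.1) (S i.2) e : ℝ) ≤
        Λ * M ^ 2 * ∑ i ∈ I c, dens (S i.1) * dens (S i.2) := by
  classical
  have hΛ4 : 4 ≤ Λ := by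
    have h1 : (2 : ℝ) ≤ Real.exp 1 := by have := Real.add_one_le_exp (1 : ℝ); linarith
    have h2 : Real.exp 2 = Real.exp 1 * Real.exp 1 := by rw [← Real.exp_add]; norm_num
    nlinarith
  have hΛ0 : 0 < Λ := by linarith
  -- If no code is good, the three families of bad events cover all injections, although `hcount`
  -- makes their proportions add up to less than one.
  by_contra hcon
  push Not at hcon
  set E := Fin M ↪ Ω × Fin L
  have hE : 0 < (Fintype.card E : ℝ) := by
    have : Nonempty E := Function.Embedding.nonempty_of_card_le (by simpa using h)
    exact_mod_cast Fintype.card_pos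
  let A : ι → Finset E := fun i => Finset.univ.filter fun e =>
    ⌈Λ * max 1 (M * dens (S i))⌉₊ ≤ hits (S i) e
  let B : ι → Finset E := fun i => if Λ ≤ M * dens (S i) then
    Finset.univ.filter fun e => hits (S i) e ≤ ⌊M * dens (S i) / Λ⌋₊ else ∅
  let C : κ → Finset E := fun c => Finset.univ.filter fun e =>
    Λ * M ^ 2 * ∑ i ∈ I c, dens (S i.1) * dens (S i.2) <
        ∑ i ∈ I c, (pairHits (S i.1) (S i.2) e : ℝ)
  have hcover : (Finset.univ : Finset E) ⊆
      (Finset.univ.biUnion A ∪ Finset.univ.biUnion B) ∪ Finset.univ.biUnion C := by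
    intro e _
    simp only [Finset.mem_union, Finset.mem_biUnion, Finset.mem_univ, true_and]
    by_cases h1 : ∀ i, (hits (S i) e : ℝ) ≤ 2 * Λ * max 1 (M * dens (S i))
    · by_cases h2 : ∀ i, Λ ≤ M * dens (S i) → M * dens (S i) / Λ ≤ hits (S i) e
      · obtain ⟨c, hc⟩ := hcon e h1 h2
        exact Or.inr ⟨c, by simpa [C] using hc⟩
      · push Not at h2
        obtain ⟨i, hi, hi'⟩ := h2
        refine Or.inl (Or.inr ⟨i, ?_⟩)
        simp only [B, if_pos hi, Finset.mem_filter, Finset.mem_univ, true_and]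
        exact Nat.le_floor hi'.le
    · push Not at h1
      obtain ⟨i, hi⟩ := h1
      refine Or.inl (Or.inl ⟨i, ?_⟩)
      simp only [A, Finset.mem_filter, Finset.mem_univ, true_and]
      refine Nat.ceil_le.2 (le_trans ?_ hi.le)
      have := mul_nonneg hΛ0.le (zero_le_one.trans (le_max_left 1 (M * dens (S i))))
      linarith
  have hA : ∀ i, ((A i).card : ℝ) ≤ Real.exp (-(Λ / 2)) * Fintype.card E := fun i =>
    (card_le_hits hL h (S i) _).trans (mul_le_mul_of_nonneg_right
      (choose_mul_pow_le_exp (dens_nonneg _) hΛ (Nat.le_ceil _)) hE.le)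
  have hB : ∀ i, ((B i).card : ℝ) ≤ Real.exp (-(Λ / 2)) * Fintype.card E := by
    intro i
    by_cases hi : Λ ≤ M * dens (S i)
    · simp only [B, if_pos hi]
      have hfl : (⌊M * dens (S i) / Λ⌋₊ : ℝ) ≤ M * dens (S i) / Λ :=
        Nat.floor_le (div_nonneg (mul_nonneg (Nat.cast_nonneg _) (dens_nonneg _)) hΛ0.le)
      have hlM : ⌊M * dens (S i) / Λ⌋₊ ≤ M := by
        have h1 : (M : ℝ) * dens (S i) ≤ M :=
          mul_le_of_le_one_right (Nat.cast_nonneg _) (dens_le_one _)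
        have h2 : (M : ℝ) * dens (S i) / Λ ≤ M :=
          (div_le_self (hΛ0.le.trans hi) (by linarith)).trans h1
        exact_mod_cast hfl.trans h2
      exact (card_hits_le hL h (S i) hlM).trans (mul_le_mul_of_nonneg_right
        (choose_mul_one_sub_pow_le_exp hM (dens_le_one _) hΛ4 hΛM hi hfl hlM) hE.le)
    · simp only [B, if_neg hi, Finset.card_empty, Nat.cast_zero]
      positivity
  have hC : ∀ c, ((C c).card : ℝ) ≤ 2 / Λ * Fintype.card E := fun c =>
    card_sum_pairHits_gt hL h S (I c) hΛ0
  have hle : (Fintype.card E : ℝ) ≤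
      (2 * Fintype.card ι * Real.exp (-(Λ / 2)) + 2 * Fintype.card κ / Λ) * Fintype.card E := by
    have h1 := (Finset.card_le_card hcover).trans ((Finset.card_union_le _ _).trans
      (Nat.add_le_add_right (Finset.card_union_le _ _) _))
    have h2 := h1.trans (Nat.add_le_add (Nat.add_le_add Finset.card_biUnion_le
      Finset.card_biUnion_le) Finset.card_biUnion_le)
    rw [Finset.card_univ] at h2
    calc (Fintype.card E : ℝ) ≤ (∑ i, ((A i).card : ℝ) + ∑ i, ((B i).card : ℝ)) +
          ∑ c, ((C c).card : ℝ) := by exact_mod_cast h2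
      _ ≤ (∑ i : ι, Real.exp (-(Λ / 2)) * Fintype.card E +
          ∑ i : ι, Real.exp (-(Λ / 2)) * Fintype.card E) +
          ∑ c : κ, 2 / Λ * Fintype.card E := by
          gcongr with i _ i _ c _
          · exact hA i
          · exact hB i
          · exact hC c
      _ = _ := by
          simp only [Finset.sum_const, Finset.card_univ, nsmul_eq_mul]; ring
  nlinarith

end RandomCode

/-! ### Types of sequences and their type classes. -/

section Types

open scoped Nat
open Classical

variable {A B : Type*} {n : ℕ}

/-- The type (empirical counts) of a sequence. -/
def cnt (z : Fin n → A) (a : A) : ℕ := (Finset.univ.filter fun i => z i = a).card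

/-- The sequences of a given type. -/
def typeClass [Fintype A] (n : ℕ) (k : A → ℕ) : Finset (Fin n → A) :=
  Finset.univ.filter fun z => cnt z = k

/-- The push-forward of a table of counts. -/
def pushCnt [Fintype A] (π : A → B) (K : A → ℕ) (b : B) : ℕ :=
  ∑ a ∈ Finset.univ.filter (fun a => π a = b), K a

theorem cnt_comp [Fintype A] (π : A → B) (z : Fin n → A) : cnt (π ∘ z) = pushCnt π (cnt z) := by
  ext b
  simp only [cnt, pushCnt, Function.comp]
  rw [Finset.card_eq_sum_card_fiberwise (f := z) (t := Finset.univ.filter (fun a => π a = b))]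
  · refine Finset.sum_congr rfl fun a ha => ?_
    rw [Finset.filter_filter]
    congr 1; ext i
    simp only [Finset.mem_filter, Finset.mem_univ, true_and] at ha ⊢
    exact ⟨fun h => h.2, fun h => ⟨h ▸ ha, h⟩⟩
  · intro i hi; simpa using hi

theorem sum_cnt [Fintype A] (z : Fin n → A) : ∑ a, cnt z a = n := by
  have := Finset.card_eq_sum_card_fiberwise (f := z) (s := Finset.univ) (t := Finset.univ)
    (fun i _ => by simp)
  simpa [cnt] using this.symm

theorem cnt_comp_perm (z : Fin n → A) (σ : Equiv.Perm (Fin n)) : cnt (z ∘ σ) = cnt z := by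
  ext a
  refine Finset.card_equiv σ fun i => ?_
  simp

theorem exists_cnt_eq [Fintype A] (k : A → ℕ) (hk : ∑ a, k a = n) : ∃ z : Fin n → A, cnt z = k := by
  have e : Fin n ≃ Σ a, Fin (k a) := Fintype.equivOfCardEq (by simp [hk])
  refine ⟨fun i => (e i).1, ?_⟩
  ext a
  have h1 : (Finset.univ.filter fun i => (e i).1 = a).card =
      (Finset.univ.filter fun s : Σ a, Fin (k a) => s.1 = a).card :=
    Finset.card_equiv e fun i => by simp
  have h2 : (Finset.univ.filter fun s : Σ a, Fin (k a) => s.1 = a) =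
      (Finset.univ : Finset (Fin (k a))).map ⟨fun j => (⟨a, j⟩ : Σ a, Fin (k a)), fun i j h => by
        simpa using h⟩ := by
    ext ⟨b, j⟩
    simp only [Finset.mem_filter, Finset.mem_univ, true_and, Finset.mem_map]
    constructor
    · rintro rfl; exact ⟨j, rfl⟩
    · rintro ⟨i, hi⟩; cases hi; rfl
  rw [cnt, h1, h2]; simp

theorem exists_perm_of_cnt_eq {z w : Fin n → A} (h : cnt z = cnt w) :
    ∃ σ : Equiv.Perm (Fin n), w ∘ σ = z := by
  refine ⟨Equiv.ofFiberEquiv (f := z) (g := w) fun a => Fintype.equivOfCardEq ?_, ?_⟩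
  · have := congrFun h a
    simpa [cnt, Fintype.card_subtype] using this
  · ext i; exact Equiv.ofFiberEquiv_map _ i

/-- The number of sequences of a type is a multinomial coefficient. -/
theorem card_typeClass_mul [Fintype A] (k : A → ℕ) (hk : ∑ a, k a = n) :
    (typeClass n k).card * ∏ a, (k a)! = n ! := by
  obtain ⟨z, rfl⟩ := exists_cnt_eq k hk
  -- Orbit-stabiliser: the n! permutations of positions are sorted by the sequence they produce, and
  -- each fibre is a coset of the stabiliser of z, of order ∏ k(a)!.
  have h1 : (Finset.univ : Finset (Equiv.Perm (Fin n))).card =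
      ∑ w ∈ typeClass n (cnt z), (Finset.univ.filter fun σ : Equiv.Perm (Fin n) => z ∘ σ = w).card :=
    Finset.card_eq_sum_card_fiberwise (f := fun σ : Equiv.Perm (Fin n) => z ∘ σ) fun σ _ => by
      simp [typeClass, cnt_comp_perm]
  have h2 : ∀ w ∈ typeClass n (cnt z),
      (Finset.univ.filter fun σ : Equiv.Perm (Fin n) => z ∘ σ = w).card = ∏ a, (cnt z a)! := by
    intro w hw
    have hw' : cnt w = cnt z := by simpa [typeClass] using hw
    obtain ⟨τ, hτ⟩ := exists_perm_of_cnt_eq hw'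
    have h3 := DomMulAct.stabilizer_card (f := z)
    have h4 : ∀ a, Fintype.card {i // z i = a} = cnt z a := fun a => by
      simp [cnt, Fintype.card_subtype]
    simp only [h4] at h3
    rw [← h3, Fintype.card_subtype]
    refine Finset.card_equiv (Equiv.mulRight τ⁻¹) fun σ => ?_
    simp only [Finset.mem_filter, Finset.mem_univ, true_and, Equiv.coe_mulRight,
      Equiv.Perm.coe_mul]
    rw [← hτ]
    constructor
    · intro h
      ext i
      have := congrFun h (τ⁻¹ i)
      simpa using this
    · intro h
      ext i
      have := congrFun h (τ i)
      simpa using this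
  rw [Finset.sum_congr rfl h2, Finset.sum_const, smul_eq_mul] at h1
  rw [← h1, Finset.card_univ, Fintype.card_perm, Fintype.card_fin]

theorem card_typeClass_pos [Fintype A] (k : A → ℕ) (hk : ∑ a, k a = n) :
    0 < (typeClass n k).card := by
  obtain ⟨z, hz⟩ := exists_cnt_eq k hk
  exact Finset.card_pos.2 ⟨z, by simp [typeClass, hz]⟩

/-- The number of liftings of type `K` does not depend on the sequence that is lifted. -/
theorem card_typeClass_mul_card_lift [Fintype A] [Fintype B] (π : A → B) (K : A → ℕ)
    (z : Fin n → B) (hz : cnt z = pushCnt π K) :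
    (typeClass n (pushCnt π K)).card * ((typeClass n K).filter fun w => π ∘ w = z).card =
      (typeClass n K).card := by
  have h1 : (typeClass n K).card = ∑ z' ∈ typeClass n (pushCnt π K),
      ((typeClass n K).filter fun w => π ∘ w = z').card :=
    Finset.card_eq_sum_card_fiberwise (f := fun w => π ∘ w) fun w hw => by
      have hw' : cnt w = K := by simpa [typeClass] using hw
      simp [typeClass, cnt_comp, hw']
  rw [h1, ← smul_eq_mul, ← Finset.sum_const]
  refine Finset.sum_congr rfl fun z' hz' => ?_
  have hz'' : cnt z' = cnt z := by simpa [typeClass, hz] using hz'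
  -- A permutation of the positions carries one fibre onto the other and preserves the type K.
  obtain ⟨σ, hσ⟩ := exists_perm_of_cnt_eq hz''
  refine Finset.card_equiv (Equiv.arrowCongr σ.symm (Equiv.refl A)) fun w => ?_
  have he : (Equiv.arrowCongr σ.symm (Equiv.refl A)) w = w ∘ σ := by ext i; simp [Equiv.arrowCongr]
  rw [he]
  simp only [typeClass, Finset.mem_filter, Finset.mem_univ, true_and, cnt_comp_perm]
  refine and_congr_right fun _ => ?_
  rw [← hσ, ← Function.comp_assoc]
  exact ⟨fun h => by rw [h], fun h => by
    have := congrArg (· ∘ σ.symm) h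
    simpa [Function.comp_assoc] using this⟩

end Types

/-! ### Type classes grow like the exponential of the entropy. -/

section Asymptotics

open scoped Nat

theorem log_factorial_bounds (k : ℕ) :
    k * Real.log k - k ≤ Real.log k ! ∧
      Real.log k ! ≤ k * Real.log k - k + (Real.log (k + 1) + 1) := by
  rcases Nat.eq_zero_or_pos k with rfl | hk
  · simp
  have hk0 : (0 : ℝ) < k := by exact_mod_cast hk
  constructor
  · have h := Real.pow_div_factorial_le_exp (k : ℝ) hk0.le k
    have hf : (0 : ℝ) < k ! := by exact_mod_cast k.factorial_pos
    have h2 := Real.log_le_log (by positivity) h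
    rw [Real.log_exp, Real.log_div (by positivity) hf.ne', Real.log_pow] at h2
    linarith
  -- This form passes through the induction by log((m+2)/(m+1)) ≥ 1/(m+2). The shift from k+1 to k
  -- afterwards costs log(k+1) + 1.
  · have key : ∀ m : ℕ, Real.log m ! ≤ (m + 1) * Real.log (m + 1) - m := by
      intro m
      induction m with
      | zero => simp
      | succ m ih =>
        have hm1 : (0 : ℝ) < m + 1 := by positivity
        have hm2 : (0 : ℝ) < m + 2 := by positivity
        rw [Nat.factorial_succ]
        push_cast
        rw [Real.log_mul hm1.ne' (by exact_mod_cast m.factorial_ne_zero)]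
        have h := Real.one_sub_inv_le_log_of_pos (div_pos hm2 hm1)
        rw [Real.log_div hm2.ne' hm1.ne', inv_div] at h
        have h2 : (1 : ℝ) - (m + 1) / (m + 2) = 1 / (m + 2) := by field_simp; ring
        rw [h2, div_le_iff₀ hm2] at h
        have h3 : ((m : ℝ) + 1 + 1) = m + 2 := by ring
        rw [h3]; nlinarith
    have h1 := key k
    have h := Real.log_le_sub_one_of_pos (div_pos (by positivity : (0 : ℝ) < k + 1) hk0)
    rw [Real.log_div (by positivity) hk0.ne'] at h
    have h2 : ((k : ℝ) + 1) / k - 1 = 1 / k := by field_simp; ring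
    rw [h2, le_div_iff₀ hk0] at h
    nlinarith

/-- In the logarithm of the multinomial coefficient the linear Stirling terms cancel and the main
terms give n times the entropy exactly. Each of the |A| + 1 factorials leaves an error of at most
log(n+1) + 1. -/
theorem abs_log_card_typeClass_sub_le {A : Type*} [Fintype A] {n : ℕ} (hn : 0 < n) (k : A → ℕ)
    (hk : ∑ a, k a = n) :
    |Real.log (typeClass n k).card / n - entropy fun a => (k a / n : ℝ)| ≤
      (Fintype.card A + 1) * ((Real.log (n + 1) + 1) / n) := by
  have hn0 : (0 : ℝ) < n := by exact_mod_cast hn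
  have hle : ∀ a, k a ≤ n := fun a => by
    rw [← hk]; exact Finset.single_le_sum (fun _ _ => Nat.zero_le _) (Finset.mem_univ a)
  have h1 : Real.log n ! = Real.log (typeClass n k).card + ∑ a, Real.log (k a)! := by
    rw [← card_typeClass_mul k hk, Nat.cast_mul, Nat.cast_prod, Real.log_mul, Real.log_prod]
    · intro a _; exact_mod_cast (k a).factorial_ne_zero
    · exact_mod_cast (card_typeClass_pos k hk).ne'
    · exact Finset.prod_ne_zero_iff.2 fun a _ => by exact_mod_cast (k a).factorial_ne_zero
  have hsum : ∑ a, (k a : ℝ) = n := by exact_mod_cast hk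
  have h2 : entropy (fun a => (k a / n : ℝ)) * n = n * Real.log n - ∑ a, k a * Real.log (k a) := by
    rw [entropy, Finset.sum_mul]
    calc _ = ∑ a, ((k a : ℝ) * Real.log n - k a * Real.log (k a)) := by
          refine Finset.sum_congr rfl fun a _ => ?_
          rcases Nat.eq_zero_or_pos (k a) with h | h
          · simp [h]
          · have : (0 : ℝ) < k a := by exact_mod_cast h
            rw [Real.negMulLog, Real.log_div this.ne' hn0.ne']
            field_simp; ring
      _ = _ := by rw [Finset.sum_sub_distrib, ← Finset.sum_mul, hsum]
  obtain ⟨b1, b2⟩ := log_factorial_bounds n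
  have b3 : ∑ a, ((k a : ℝ) * Real.log (k a) - k a) ≤ ∑ a, Real.log (k a)! :=
    Finset.sum_le_sum fun a _ => (log_factorial_bounds (k a)).1
  have b4 : ∑ a, Real.log (k a)! ≤
      ∑ a, ((k a : ℝ) * Real.log (k a) - k a + (Real.log (n + 1) + 1)) := by
    refine Finset.sum_le_sum fun a _ => (log_factorial_bounds (k a)).2.trans ?_
    have : Real.log ((k a : ℝ) + 1) ≤ Real.log (n + 1) :=
      Real.log_le_log (by positivity) (by have := hle a; gcongr)
    linarith
  rw [Finset.sum_sub_distrib, hsum] at b3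
  rw [Finset.sum_add_distrib, Finset.sum_sub_distrib, hsum, Finset.sum_const, Finset.card_univ,
    nsmul_eq_mul] at b4
  have hpos : 0 ≤ Real.log ((n : ℝ) + 1) + 1 := by
    have := Real.log_nonneg (by linarith : (1 : ℝ) ≤ n + 1); linarith
  have hA : 0 ≤ (Fintype.card A : ℝ) * (Real.log (n + 1) + 1) := by positivity
  have h3 : Real.log (typeClass n k).card / n - entropy (fun a => (k a / n : ℝ)) =
      (Real.log (typeClass n k).card - entropy (fun a => (k a / n : ℝ)) * n) / n := by
    field_simp
  rw [h3, abs_div, abs_of_pos hn0, ← mul_div_assoc]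
  gcongr
  rw [abs_le]
  constructor <;> linarith

theorem tendsto_log_add_one_div (c : ℝ) :
    Tendsto (fun n : ℕ => (Real.log (n + 1) + c) / n) atTop (nhds 0) := by
  have h1 : Tendsto (fun n : ℕ => Real.log ((n : ℝ) + 1) / ((n : ℝ) + 1)) atTop (nhds 0) := by
    have h := Real.isLittleO_log_id_atTop.tendsto_div_nhds_zero
    exact h.comp (tendsto_atTop_add_const_right _ 1 tendsto_natCast_atTop_atTop)
  have h2 : Tendsto (fun n : ℕ => 1 + (1 : ℝ) / n) atTop (nhds (1 + 0)) :=
    tendsto_const_nhds.add tendsto_one_div_atTop_nhds_zero_nat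
  have h3 : Tendsto (fun n : ℕ => c * ((1 : ℝ) / n)) atTop (nhds (c * 0)) :=
    tendsto_const_nhds.mul tendsto_one_div_atTop_nhds_zero_nat
  have h4 := (h1.mul h2).add h3
  simp only [zero_mul, mul_zero, add_zero] at h4
  refine h4.congr' ?_
  filter_upwards [eventually_gt_atTop 0] with n hn
  have : (0 : ℝ) < n := by exact_mod_cast hn
  field_simp

theorem continuous_entropy {A : Type*} [Fintype A] : Continuous (entropy : (A → ℝ) → ℝ) := by
  unfold entropy
  exact continuous_finsetSum _ fun a _ => Real.continuous_negMulLog.comp (continuous_apply a)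

/-- The number of sequences of type `k n` grows like `exp (n H(q))` if `k n / n → q`. -/
theorem tendsto_card_typeClass_rpow {A : Type*} [Fintype A] {𝒢 : Filter ℕ} (h𝒢 : 𝒢 ≤ atTop)
    {k : ℕ → A → ℕ} (hk : ∀ᶠ n in 𝒢, ∑ a, k n a = n) {q : A → ℝ}
    (hq : Tendsto (fun n a => (k n a / n : ℝ)) 𝒢 (nhds q)) :
    Tendsto (fun n => ((typeClass n (k n)).card : ℝ) ^ ((n : ℝ)⁻¹)) 𝒢
      (nhds (Real.exp (entropy q))) := by
  have h1 : Tendsto (fun n => entropy fun a => (k n a / n : ℝ)) 𝒢 (nhds (entropy q)) :=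
    (continuous_entropy.tendsto q).comp hq
  have h2 : Tendsto (fun n : ℕ => (Fintype.card A + 1) * ((Real.log (n + 1) + 1) / n)) 𝒢
      (nhds 0) := by
    simpa using ((tendsto_log_add_one_div 1).mono_left h𝒢).const_mul (Fintype.card A + 1 : ℝ)
  have h3 : Tendsto (fun n => Real.log (typeClass n (k n)).card / n -
      entropy fun a => (k n a / n : ℝ)) 𝒢 (nhds 0) := by
    refine squeeze_zero_norm' ?_ h2
    filter_upwards [hk, h𝒢 (eventually_gt_atTop 0)] with n hn hn0
    exact abs_log_card_typeClass_sub_le hn0 (k n) hn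
  have h4 := h3.add h1
  simp only [sub_add_cancel, zero_add] at h4
  refine ((Real.continuous_exp.tendsto _).comp h4).congr' ?_
  filter_upwards [hk] with n hn
  have : (0 : ℝ) < (typeClass n (k n)).card := by exact_mod_cast card_typeClass_pos _ hn
  rw [Function.comp, Real.rpow_def_of_pos this, div_eq_mul_inv]

end Asymptotics

/-! ### Joint types, their margins, and approximation of joint laws by them. -/

section JointTypes

open Classical

variable {X Y : Type*} [Fintype X] [Fintype Y] {n : ℕ}

/-- The joint type of two sequences. -/
def jointCnt (x : Fin n → X) (y : Fin n → Y) : X × Y → ℕ := cnt fun i => (x i, y i)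

def rowCnt (K : X × Y → ℕ) (x : X) : ℕ := ∑ y, K (x, y)

def colCnt (K : X × Y → ℕ) (y : Y) : ℕ := ∑ x, K (x, y)

theorem pushCnt_fst (K : X × Y → ℕ) : pushCnt Prod.fst K = rowCnt K := by
  ext a
  rw [pushCnt, rowCnt, Finset.sum_filter, Fintype.sum_prod_type_right]
  simp

theorem pushCnt_snd (K : X × Y → ℕ) : pushCnt Prod.snd K = colCnt K := by
  ext a
  rw [pushCnt, colCnt, Finset.sum_filter, Fintype.sum_prod_type]
  simp

theorem rowCnt_jointCnt (x : Fin n → X) (y : Fin n → Y) : rowCnt (jointCnt x y) = cnt x := by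
  rw [← pushCnt_fst, jointCnt, ← cnt_comp]; rfl

theorem colCnt_jointCnt (x : Fin n → X) (y : Fin n → Y) : colCnt (jointCnt x y) = cnt y := by
  rw [← pushCnt_snd, jointCnt, ← cnt_comp]; rfl

theorem sum_rowCnt (K : X × Y → ℕ) : ∑ x, rowCnt K x = ∑ p, K p := (Fintype.sum_prod_type _).symm

theorem sum_colCnt (K : X × Y → ℕ) : ∑ y, colCnt K y = ∑ p, K p :=
  (Fintype.sum_prod_type_right _).symm

theorem card_typeClass_mul_card_left (K : X × Y → ℕ) (y : Fin n → Y) (hy : cnt y = colCnt K) :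
    (typeClass n (colCnt K)).card *
      (Finset.univ.filter fun x : Fin n → X => jointCnt x y = K).card = (typeClass n K).card := by
  rw [← pushCnt_snd] at hy ⊢
  rw [← card_typeClass_mul_card_lift Prod.snd K y hy]
  congr 1
  refine Finset.card_bij (fun x _ i => (x i, y i)) ?_ ?_ ?_
  · intro x hx
    simp only [Finset.mem_filter, Finset.mem_univ, true_and, typeClass] at hx ⊢
    exact ⟨hx, rfl⟩
  · intro x _ x' _ h
    ext i; exact (Prod.mk.inj (congrFun h i)).1
  · intro w hw
    simp only [Finset.mem_filter, Finset.mem_univ, true_and, typeClass] at hw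
    refine ⟨fun i => (w i).1, ?_, ?_⟩
    · simp only [Finset.mem_filter, Finset.mem_univ, true_and]
      rw [← hw.1, jointCnt, ← hw.2]; rfl
    · rw [← hw.2]; rfl

theorem card_typeClass_mul_card_right (K : X × Y → ℕ) (x : Fin n → X) (hx : cnt x = rowCnt K) :
    (typeClass n (rowCnt K)).card *
      (Finset.univ.filter fun y : Fin n → Y => jointCnt x y = K).card = (typeClass n K).card := by
  rw [← pushCnt_fst] at hx ⊢
  rw [← card_typeClass_mul_card_lift Prod.fst K x hx]
  congr 1
  refine Finset.card_bij (fun y _ i => (x i, y i)) ?_ ?_ ?_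
  · intro x hx
    simp only [Finset.mem_filter, Finset.mem_univ, true_and, typeClass] at hx ⊢
    exact ⟨hx, rfl⟩
  · intro x _ x' _ h
    ext i; exact (Prod.mk.inj (congrFun h i)).2
  · intro w hw
    simp only [Finset.mem_filter, Finset.mem_univ, true_and, typeClass] at hw
    refine ⟨fun i => (w i).2, ?_, ?_⟩
    · simp only [Finset.mem_filter, Finset.mem_univ, true_and]
      rw [← hw.1, jointCnt, ← hw.2]; rfl
    · rw [← hw.2]; rfl

/-- A table of counts with prescribed margins. -/
theorem exists_table (k : X → ℕ) (l : Y → ℕ) (h : ∑ x, k x = ∑ y, l y) :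
    ∃ K : X × Y → ℕ, rowCnt K = k ∧ colCnt K = l := by
  obtain ⟨x, hx⟩ := exists_cnt_eq k rfl
  obtain ⟨y, hy⟩ := exists_cnt_eq l h.symm
  exact ⟨jointCnt x y, by rw [rowCnt_jointCnt, hx], by rw [colCnt_jointCnt, hy]⟩

/-- A table below the prescribed margins can be completed. -/
theorem exists_table_ge (K₀ : X × Y → ℕ) (k : X → ℕ) (l : Y → ℕ) (h : ∑ x, k x = ∑ y, l y)
    (hk : ∀ x, rowCnt K₀ x ≤ k x) (hl : ∀ y, colCnt K₀ y ≤ l y) :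
    ∃ K : X × Y → ℕ, K₀ ≤ K ∧ rowCnt K = k ∧ colCnt K = l := by
  obtain ⟨D, hDk, hDl⟩ := exists_table (fun x => k x - rowCnt K₀ x) (fun y => l y - colCnt K₀ y)
    (by
      have h1 : ∑ x, (k x - rowCnt K₀ x) + ∑ x, rowCnt K₀ x = ∑ x, k x := by
        rw [← Finset.sum_add_distrib]
        exact Finset.sum_congr rfl fun x _ => Nat.sub_add_cancel (hk x)
      have h2 : ∑ y, (l y - colCnt K₀ y) + ∑ y, colCnt K₀ y = ∑ y, l y := by
        rw [← Finset.sum_add_distrib]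
        exact Finset.sum_congr rfl fun x _ => Nat.sub_add_cancel (hl x)
      rw [sum_rowCnt] at h1
      rw [sum_colCnt] at h2
      omega)
  refine ⟨K₀ + D, fun p => Nat.le_add_right _ _, ?_, ?_⟩
  · ext x
    have h1 := congrFun hDk x
    have h2 : rowCnt (K₀ + D) x = rowCnt K₀ x + rowCnt D x := by
      simp [rowCnt, Finset.sum_add_distrib]
    rw [h2, h1]; have := hk x; omega
  · ext y
    have h1 := congrFun hDl y
    have h2 : colCnt (K₀ + D) y = colCnt K₀ y + colCnt D y := by
      simp [colCnt, Finset.sum_add_distrib]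
    rw [h2, h1]; have := hl y; omega

theorem tendsto_floor_mul_div {𝒢 : Filter ℕ} (h𝒢 : 𝒢 ≤ atTop) {u : ℕ → ℝ} {a : ℝ}
    (hu : Tendsto u 𝒢 (nhds a)) (hu0 : ∀ n, 0 ≤ u n) :
    Tendsto (fun n : ℕ => (⌊n * u n⌋₊ : ℝ) / n) 𝒢 (nhds a) := by
  have h1 : Tendsto (fun n : ℕ => u n - (1 : ℝ) / n) 𝒢 (nhds (a - 0)) :=
    hu.sub (tendsto_one_div_atTop_nhds_zero_nat.mono_left h𝒢)
  rw [sub_zero] at h1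
  refine tendsto_of_tendsto_of_tendsto_of_le_of_le' h1 hu ?_ ?_
  · filter_upwards [h𝒢 (eventually_gt_atTop 0)] with n hn
    have hn0 : (0 : ℝ) < n := by exact_mod_cast hn
    rw [le_div_iff₀ hn0, sub_mul, div_mul_cancel₀ _ hn0.ne']
    have := Nat.lt_floor_add_one ((n : ℝ) * u n)
    linarith
  · filter_upwards [h𝒢 (eventually_gt_atTop 0)] with n hn
    have hn0 : (0 : ℝ) < n := by exact_mod_cast hn
    rw [div_le_iff₀ hn0]
    exact (Nat.floor_le (mul_nonneg hn0.le (hu0 n))).trans (mul_comm _ _).le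

/-- A joint distribution is a limit of joint types with prescribed marginal types. -/
theorem exists_tendsto_table {𝒢 : Filter ℕ} (h𝒢 : 𝒢 ≤ atTop) {k : ℕ → X → ℕ} {l : ℕ → Y → ℕ}
    {Q : X × Y → ℝ} (hQ : ∀ p, 0 ≤ Q p) (hk : ∀ n, ∑ x, k n x = n) (hl : ∀ n, ∑ y, l n y = n)
    (hkQ : ∀ x, Tendsto (fun n => (k n x / n : ℝ)) 𝒢 (nhds (∑ y, Q (x, y))))
    (hlQ : ∀ y, Tendsto (fun n => (l n y / n : ℝ)) 𝒢 (nhds (∑ x, Q (x, y)))) :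
    ∃ K : ℕ → X × Y → ℕ, (∀ n, rowCnt (K n) = k n) ∧ (∀ n, colCnt (K n) = l n) ∧
      Tendsto (fun n p => (K n p / n : ℝ)) 𝒢 (nhds Q) := by
  let P : X → ℝ := fun x => ∑ y, Q (x, y)
  let q : Y → ℝ := fun y => ∑ x, Q (x, y)
  have hP0 : ∀ x, 0 ≤ P x := fun x => Finset.sum_nonneg fun y _ => hQ _
  have hq0 : ∀ y, 0 ≤ q y := fun y => Finset.sum_nonneg fun x _ => hQ _
  -- Q is shrunk wherever a prescribed margin is below its limit, so that after rounding down
  -- neither margin is exceeded and the table can be completed.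
  let u : ℕ → X × Y → ℝ := fun n p => Q p * min 1 ((k n p.1 / n : ℝ) / P p.1) *
    min 1 ((l n p.2 / n : ℝ) / q p.2)
  have hu0 : ∀ n p, 0 ≤ u n p := fun n p => by
    have := hQ p; have := hP0 p.1; have := hq0 p.2
    positivity
  let K₀ : ℕ → X × Y → ℕ := fun n p => ⌊n * u n p⌋₊
  have hK₀ : ∀ n p, (K₀ n p : ℝ) ≤ n * u n p := fun n p =>
    Nat.floor_le (mul_nonneg (Nat.cast_nonneg _) (hu0 n p))
  have hmin : ∀ (n : ℕ) (a b : ℝ), 0 ≤ a → 0 ≤ b → n * (a * min 1 ((b / n) / a)) ≤ b := by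
    intro n a b ha hb
    rcases ha.eq_or_lt with rfl | ha
    · simpa using hb
    rcases Nat.eq_zero_or_pos n with rfl | hn
    · simpa using hb
    have hn0 : (0 : ℝ) < n := by exact_mod_cast hn
    calc (n : ℝ) * (a * min 1 ((b / n) / a)) ≤ n * (a * ((b / n) / a)) := by
          gcongr; exact min_le_right _ _
      _ = b := by field_simp
  have hrow : ∀ n x, rowCnt (K₀ n) x ≤ k n x := by
    intro n x
    have : (rowCnt (K₀ n) x : ℝ) ≤ k n x := by
      rw [rowCnt]; push_cast
      calc ∑ y, (K₀ n (x, y) : ℝ) ≤ ∑ y, n * (Q (x, y) * min 1 ((k n x / n : ℝ) / P x)) := by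
            refine Finset.sum_le_sum fun y _ => (hK₀ n _).trans ?_
            refine mul_le_mul_of_nonneg_left ?_ (Nat.cast_nonneg _)
            have := hQ (x, y); have := hP0 x
            exact mul_le_of_le_one_right (by positivity) (min_le_left _ _)
        _ = n * (P x * min 1 ((k n x / n : ℝ) / P x)) := by
            rw [← Finset.mul_sum, ← Finset.sum_mul]
        _ ≤ _ := hmin n _ _ (hP0 x) (Nat.cast_nonneg _)
    exact_mod_cast this
  have hcol : ∀ n y, colCnt (K₀ n) y ≤ l n y := by
    intro n y
    have : (colCnt (K₀ n) y : ℝ) ≤ l n y := by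
      rw [colCnt]; push_cast
      calc ∑ x, (K₀ n (x, y) : ℝ) ≤ ∑ x, n * (Q (x, y) * min 1 ((l n y / n : ℝ) / q y)) := by
            refine Finset.sum_le_sum fun x _ => (hK₀ n _).trans ?_
            refine mul_le_mul_of_nonneg_left ?_ (Nat.cast_nonneg _)
            have := hQ (x, y); have := hq0 y
            simp only [u]
            have h1 : Q (x, y) * min 1 ((k n x / n : ℝ) / P x) ≤ Q (x, y) :=
              mul_le_of_le_one_right (by positivity) (min_le_left _ _)
            gcongr
        _ = n * (q y * min 1 ((l n y / n : ℝ) / q y)) := by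
            rw [← Finset.mul_sum, ← Finset.sum_mul]
        _ ≤ _ := hmin n _ _ (hq0 y) (Nat.cast_nonneg _)
    exact_mod_cast this
  choose K hK hKk hKl using fun n => exists_table_ge (K₀ n) (k n) (l n)
    ((hk n).trans (hl n).symm) (hrow n) (hcol n)
  refine ⟨K, hKk, hKl, ?_⟩
  have hu : ∀ p, Tendsto (fun n => u n p) 𝒢 (nhds (Q p)) := by
    rintro ⟨x, y⟩
    rcases (hQ (x, y)).eq_or_lt with h | h
    · simpa [u, ← h] using tendsto_const_nhds
    have hPx : 0 < P x := h.trans_le (Finset.single_le_sum (f := fun y => Q (x, y))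
      (fun y _ => hQ _) (Finset.mem_univ y))
    have hqy : 0 < q y := h.trans_le (Finset.single_le_sum (f := fun x => Q (x, y))
      (fun x _ => hQ _) (Finset.mem_univ x))
    have h1 := (tendsto_const_nhds (x := (1 : ℝ))).min ((hkQ x).div_const (P x))
    have h2 := (tendsto_const_nhds (x := (1 : ℝ))).min ((hlQ y).div_const (q y))
    rw [show (∑ y, Q (x, y)) / P x = 1 from div_self hPx.ne', min_self] at h1
    rw [show (∑ x, Q (x, y)) / q y = 1 from div_self hqy.ne', min_self] at h2
    simpa using ((tendsto_const_nhds (x := Q (x, y))).mul h1).mul h2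
  have hK₀t : ∀ p, Tendsto (fun n => (K₀ n p / n : ℝ)) 𝒢 (nhds (Q p)) := fun p =>
    tendsto_floor_mul_div h𝒢 (hu p) fun n => hu0 n p
  -- The completion only adds, and what it adds to an entry is at most the deficit of its row, which
  -- vanishes in the limit.
  have hdiff : ∀ p, Tendsto (fun n => (K n p / n : ℝ) - K₀ n p / n) 𝒢 (nhds 0) := by
    rintro ⟨x, y⟩
    have h1 : Tendsto (fun n => (k n x / n : ℝ) - ∑ y, (K₀ n (x, y) / n : ℝ)) 𝒢
        (nhds (∑ y, Q (x, y) - ∑ y, Q (x, y))) :=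
      (hkQ x).sub (tendsto_finsetSum _ fun y _ => hK₀t (x, y))
    rw [sub_self] at h1
    refine squeeze_zero (fun n => ?_) (fun n => ?_) h1
    · have := hK n (x, y)
      rw [← sub_div]
      have h2 : (K₀ n (x, y) : ℝ) ≤ K n (x, y) := by exact_mod_cast this
      exact div_nonneg (by linarith) (Nat.cast_nonneg _)
    · have h2 : (k n x : ℝ) = ∑ y, (K n (x, y) : ℝ) := by
        rw [← congrFun (hKk n) x, rowCnt]; push_cast; rfl
      rw [h2, Finset.sum_div, ← Finset.sum_sub_distrib]
      refine Finset.single_le_sum (f := fun y => (K n (x, y) / n : ℝ) - K₀ n (x, y) / n)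
        (fun y _ => ?_) (Finset.mem_univ y)
      rw [← sub_div]
      have h2 : (K₀ n (x, y) : ℝ) ≤ K n (x, y) := by exact_mod_cast hK n (x, y)
      exact div_nonneg (by linarith) (Nat.cast_nonneg _)
  rw [tendsto_pi_nhds]
  intro p
  simpa using (hdiff p).add (hK₀t p)

/-- A distribution is a limit of types with the same support. -/
theorem exists_tendsto_type {P : X → ℝ} (hP : P ∈ stdSimplex ℝ X) :
    ∃ k : ℕ → X → ℕ, (∀ n, ∑ x, k n x = n) ∧ (∀ n x, P x = 0 → k n x = 0) ∧
      Tendsto (fun n x => (k n x / n : ℝ)) atTop (nhds P) := by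
  obtain ⟨hP0, hP1⟩ := hP
  obtain ⟨x₀, hx₀⟩ : ∃ x, P x ≠ 0 := by
    by_contra h
    push Not at h
    simp [h] at hP1
  let f : ℕ → X → ℕ := fun n x => ⌊n * P x⌋₊
  have hf : ∀ n, ∑ x, f n x ≤ n := by
    intro n
    have : ∑ x, (f n x : ℝ) ≤ n := by
      calc ∑ x, (f n x : ℝ) ≤ ∑ x, n * P x :=
            Finset.sum_le_sum fun x _ => Nat.floor_le (mul_nonneg (Nat.cast_nonneg _) (hP0 x))
        _ = n := by rw [← Finset.mul_sum, hP1, mul_one]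
    exact_mod_cast this
  -- The rounding deficit goes to a letter of positive probability, which keeps the support.
  let k : ℕ → X → ℕ := fun n x => f n x + if x = x₀ then n - ∑ x, f n x else 0
  have hft : ∀ x, Tendsto (fun n => (f n x / n : ℝ)) atTop (nhds (P x)) := fun x =>
    tendsto_floor_mul_div le_rfl tendsto_const_nhds fun _ => hP0 x
  refine ⟨k, fun n => ?_, fun n x hx => ?_, ?_⟩
  · simp only [k, Finset.sum_add_distrib, Finset.sum_ite_eq', Finset.mem_univ, if_true]
    have := hf n; omega
  · have : x ≠ x₀ := fun h => hx₀ (h ▸ hx)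
    simp [k, f, hx, this]
  · rw [tendsto_pi_nhds]
    intro x
    have h1 : Tendsto (fun n : ℕ => if x = x₀ then 1 - ∑ x, (f n x / n : ℝ) else 0) atTop
        (nhds 0) := by
      split_ifs
      · have := (tendsto_const_nhds (x := (1 : ℝ))).sub
          (tendsto_finsetSum Finset.univ fun x _ => hft x)
        rwa [hP1, sub_self] at this
      · exact tendsto_const_nhds
    have h2 := (hft x).add h1
    rw [add_zero] at h2
    refine h2.congr' ?_
    filter_upwards [eventually_gt_atTop 0] with n hn
    have hn0 : (0 : ℝ) < n := by exact_mod_cast hn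
    simp only [k]
    split_ifs
    · push_cast [hf n]
      rw [add_div, sub_div, div_self hn0.ne', Finset.sum_div]
    · simp

end JointTypes

/-! ### Generalised likelihoods as functions of the joint type. -/

section Likelihood

open Classical

theorem DMC.prob_le_one {X Y : Type*} [Fintype Y] (W : DMC X Y) (x : X) (y : Y) : W.prob x y ≤ 1 := by
  rw [← W.sum_eq_one x]
  exact Finset.single_le_sum (fun y _ => W.nonneg x y) (Finset.mem_univ y)

variable {X Y : Type*} [Fintype X] [Fintype Y]

/-- `exp (f_W(Q))`, for tables `Q` that need not be normalised. -/
def likR (W : DMC X Y) (Q : X × Y → ℝ) : ℝ :=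
  if ∀ x y, 0 < Q (x, y) → 0 < W.prob x y then
    Real.exp (∑ x, ∑ y, Q (x, y) * Real.log (W.prob x y))
  else 0

/-- `exp (f_𝒰(Q))`. -/
def supLik (𝒰 : Set (DMC X Y)) (Q : X × Y → ℝ) : ℝ := ⨆ U : 𝒰, likR (U : DMC X Y) Q

theorem likR_nonneg (W : DMC X Y) (Q : X × Y → ℝ) : 0 ≤ likR W Q := by
  unfold likR; split_ifs <;> positivity

theorem likR_le_one (W : DMC X Y) {Q : X × Y → ℝ} (hQ : ∀ p, 0 ≤ Q p) : likR W Q ≤ 1 := by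
  unfold likR
  split_ifs
  · refine Real.exp_le_one_iff.2 (Finset.sum_nonpos fun x _ => Finset.sum_nonpos fun y _ => ?_)
    exact mul_nonpos_of_nonneg_of_nonpos (hQ _)
      (Real.log_nonpos (W.nonneg x y) (W.prob_le_one x y))
  · exact zero_le_one

theorem bddAbove_likR (𝒰 : Set (DMC X Y)) {Q : X × Y → ℝ} (hQ : ∀ p, 0 ≤ Q p) :
    BddAbove (Set.range fun U : 𝒰 => likR (U : DMC X Y) Q) :=
  ⟨1, by rintro _ ⟨U, rfl⟩; exact likR_le_one _ hQ⟩

theorem likR_le_supLik {𝒰 : Set (DMC X Y)} {U : DMC X Y} (hU : U ∈ 𝒰) {Q : X × Y → ℝ}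
    (hQ : ∀ p, 0 ≤ Q p) : likR U Q ≤ supLik 𝒰 Q :=
  le_ciSup (bddAbove_likR 𝒰 hQ) ⟨U, hU⟩

theorem supLik_nonneg (𝒰 : Set (DMC X Y)) (Q : X × Y → ℝ) : 0 ≤ supLik 𝒰 Q :=
  Real.iSup_nonneg fun _ => likR_nonneg _ _

theorem supLik_singleton (W : DMC X Y) (Q : X × Y → ℝ) : supLik {W} Q = likR W Q := by
  unfold supLik
  rw [ciSup_unique]
  rfl

theorem log_ofReal_likR (W : DMC X Y) (Q : X × Y → ℝ) :
    ENNReal.log (ENNReal.ofReal (likR W Q)) = logLik W Q := by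
  unfold likR logLik
  split_ifs
  · rw [ENNReal.log_ofReal_of_pos (Real.exp_pos _), Real.log_exp]
  · simp

theorem log_ofReal_supLik {𝒰 : Set (DMC X Y)} (h : 𝒰.Nonempty) {Q : X × Y → ℝ}
    (hQ : ∀ p, 0 ≤ Q p) :
    ENNReal.log (ENNReal.ofReal (supLik 𝒰 Q)) = genLogLik 𝒰 Q := by
  have : Nonempty 𝒰 := h.to_subtype
  have h1 : ENNReal.ofReal (supLik 𝒰 Q) = ⨆ U : 𝒰, ENNReal.ofReal (likR (U : DMC X Y) Q) := by
    refine (Monotone.map_ciSup_of_continuousAt ENNReal.continuous_ofReal.continuousAt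
      (fun a b => ENNReal.ofReal_le_ofReal) (bddAbove_likR 𝒰 hQ))
  rw [h1, ← ENNReal.logOrderIso_apply, OrderIso.map_iSup, genLogLik, iSup_subtype']
  exact iSup_congr fun U => log_ofReal_likR _ _

/-- Logarithms of probabilities are nonpositive, and a larger table can only charge more forbidden
pairs. -/
theorem likR_anti (W : DMC X Y) {Q Q' : X × Y → ℝ} (h : ∀ p, Q p ≤ Q' p) :
    likR W Q' ≤ likR W Q := by
  by_cases hW : ∀ x y, 0 < Q' (x, y) → 0 < W.prob x y
  · have hW' : ∀ x y, 0 < Q (x, y) → 0 < W.prob x y := fun x y hxy => hW x y (hxy.trans_le (h _))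
    rw [likR, likR, if_pos hW, if_pos hW', Real.exp_le_exp]
    refine Finset.sum_le_sum fun x _ => Finset.sum_le_sum fun y _ => ?_
    exact mul_le_mul_of_nonpos_right (h _) (Real.log_nonpos (W.nonneg x y) (W.prob_le_one x y))
  · rw [likR, if_neg hW]; exact likR_nonneg _ _

theorem supLik_anti (𝒰 : Set (DMC X Y)) {Q Q' : X × Y → ℝ} (hQ : ∀ p, 0 ≤ Q p)
    (h : ∀ p, Q p ≤ Q' p) : supLik 𝒰 Q' ≤ supLik 𝒰 Q :=
  ciSup_mono (bddAbove_likR 𝒰 hQ) fun _ => likR_anti _ h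

theorem likR_smul (W : DMC X Y) (Q : X × Y → ℝ) {c : ℝ} (hc : 0 < c) :
    likR W (fun p => c * Q p) = likR W Q ^ c := by
  have : (∀ x y, 0 < c * Q (x, y) → 0 < W.prob x y) ↔ ∀ x y, 0 < Q (x, y) → 0 < W.prob x y := by
    simp only [mul_pos_iff_of_pos_left hc]
  by_cases hW : ∀ x y, 0 < Q (x, y) → 0 < W.prob x y
  · rw [likR, likR, if_pos hW, if_pos (this.2 hW), ← Real.exp_mul, Finset.sum_mul]
    congr 1
    refine Finset.sum_congr rfl fun x _ => ?_
    rw [Finset.sum_mul]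
    exact Finset.sum_congr rfl fun y _ => by ring
  · rw [likR, likR, if_neg hW, if_neg (mt this.1 hW), Real.zero_rpow hc.ne']

theorem supLik_smul {𝒰 : Set (DMC X Y)} (h : 𝒰.Nonempty) {Q : X × Y → ℝ} (hQ : ∀ p, 0 ≤ Q p)
    {c : ℝ} (hc : 0 < c) : supLik 𝒰 (fun p => c * Q p) = supLik 𝒰 Q ^ c := by
  have : Nonempty 𝒰 := h.to_subtype
  refine le_antisymm (ciSup_le fun U => ?_) ?_
  · rw [likR_smul _ _ hc]
    exact Real.rpow_le_rpow (likR_nonneg _ _) (likR_le_supLik U.2 hQ) hc.le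
  · have h1 : supLik 𝒰 Q ≤ (supLik 𝒰 fun p => c * Q p) ^ c⁻¹ := by
      refine ciSup_le fun U => ?_
      rw [← Real.rpow_rpow_inv (likR_nonneg _ _) hc.ne', ← likR_smul _ _ hc]
      exact Real.rpow_le_rpow (likR_nonneg _ _)
        (likR_le_supLik U.2 fun p => mul_nonneg hc.le (hQ p)) (inv_nonneg.2 hc.le)
    calc supLik 𝒰 Q ^ c ≤ ((supLik 𝒰 fun p => c * Q p) ^ c⁻¹) ^ c :=
          Real.rpow_le_rpow (supLik_nonneg _ _) h1 hc.le
      _ = _ := Real.rpow_inv_rpow (supLik_nonneg _ _) hc.ne'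

theorem lik_eq_likR (W : DMC X Y) {n : ℕ} (x : Fin n → X) (y : Fin n → Y) :
    W.lik x y = likR W fun p => jointCnt x y p := by
  have h1 : W.lik x y = ∏ p : X × Y, W.prob p.1 p.2 ^ jointCnt x y p := by
    rw [DMC.lik, ← Finset.prod_fiberwise Finset.univ (fun i => (x i, y i))]
    refine Finset.prod_congr rfl fun p _ => ?_
    have hcard : jointCnt x y p = (Finset.univ.filter fun i => (x i, y i) = p).card := by
      unfold jointCnt cnt; congr
    rw [hcard, ← Finset.prod_const]
    refine Finset.prod_congr rfl fun i hi => ?_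
    rw [← (Finset.mem_filter.1 hi).2]
  rw [h1, likR]
  split_ifs with h
  · rw [← Fintype.sum_prod_type', Real.exp_sum]
    refine Finset.prod_congr rfl fun p _ => ?_
    rcases Nat.eq_zero_or_pos (jointCnt x y p) with h0 | h0
    · simp [h0]
    · have := h p.1 p.2 (by exact_mod_cast h0)
      rw [Real.exp_nat_mul, Real.exp_log this]
  · push Not at h
    obtain ⟨a, b, hab, hW⟩ := h
    refine Finset.prod_eq_zero (Finset.mem_univ (a, b)) ?_
    have h0 : W.prob a b = 0 := le_antisymm hW (W.nonneg a b)
    have : jointCnt x y (a, b) ≠ 0 := by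
      have : 0 < jointCnt x y (a, b) := by exact_mod_cast hab
      exact this.ne'
    simp [h0, this]

theorem maxLik_eq_supLik (𝒰 : Set (DMC X Y)) {n : ℕ} (x : Fin n → X) (y : Fin n → Y) :
    maxLik 𝒰 x y = supLik 𝒰 fun p => jointCnt x y p := by
  unfold maxLik supLik
  simp_rw [lik_eq_likR]

/-- Exponentiating replaces the value -∞ by the real number 0 and loses no continuity; from here on
the argument is multiplicative. -/
theorem continuousOn_supLik {𝒰 : Set (DMC X Y)} (h𝒰 : 𝒰.Nonempty) {P : X → ℝ}
    (h : ContinuousOn (genLogLik 𝒰) (jointLaws Y P)) :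
    ContinuousOn (supLik 𝒰) (jointLaws Y P) := by
  have h1 : ContinuousOn (fun Q => (EReal.exp (genLogLik 𝒰 Q)).toReal) (jointLaws Y P) := by
    intro Q hQ
    refine (ENNReal.tendsto_toReal ?_).comp ((ENNReal.continuous_exp.tendsto _).comp (h Q hQ))
    rw [← log_ofReal_supLik h𝒰 hQ.1, ENNReal.exp_log]
    exact ENNReal.ofReal_ne_top
  refine h1.congr fun Q hQ => ?_
  simp only
  rw [← log_ofReal_supLik h𝒰 hQ.1, ENNReal.exp_log, ENNReal.toReal_ofReal (supLik_nonneg _ _)]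

/-- Along tables whose `X`-marginals tend to `P` without leaving its support, the generalised
likelihood is as continuous as on the joint distributions with `X`-marginal `P`. -/
theorem tendsto_supLik {𝒰 : Set (DMC X Y)} (h𝒰 : 𝒰.Nonempty) {P : X → ℝ} (hP : ∀ x, 0 ≤ P x)
    (hc : ContinuousOn (supLik 𝒰) (jointLaws Y P)) {ι : Type*} {𝒢 : Filter ι}
    {Qn : ι → X × Y → ℝ} {Q : X × Y → ℝ} (hQn : ∀ i p, 0 ≤ Qn i p)
    (hQn0 : ∀ i x y, P x = 0 → Qn i (x, y) = 0) (hQ : Q ∈ jointLaws Y P)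
    (hlim : Tendsto Qn 𝒢 (nhds Q)) :
    Tendsto (fun i => supLik 𝒰 (Qn i)) 𝒢 (nhds (supLik 𝒰 Q)) := by
  have hlim' := tendsto_pi_nhds.1 hlim
  let r : ι → X → ℝ := fun i x => ∑ y, Qn i (x, y)
  have hr : ∀ x, Tendsto (fun i => r i x) 𝒢 (nhds (P x)) := fun x => by
    rw [← hQ.2 x]; exact tendsto_finsetSum _ fun y _ => hlim' (x, y)
  have hr0 : ∀ i x, 0 ≤ r i x := fun i x => Finset.sum_nonneg fun y _ => hQn i _
  -- The rows are rescaled to have marginal exactly P, so that the continuity hypothesis applies; an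
  -- empty row is replaced by that of Q.
  let Q' : ι → X × Y → ℝ := fun i p =>
    if r i p.1 = 0 then Q p else Qn i p * (P p.1 / r i p.1)
  have hQ' : ∀ i, Q' i ∈ jointLaws Y P := by
    intro i
    refine ⟨fun p => ?_, fun x => ?_⟩
    · simp only [Q']; split_ifs
      · exact hQ.1 p
      · exact mul_nonneg (hQn i p) (div_nonneg (hP _) (hr0 i _))
    · simp only [Q']; split_ifs with h
      · exact hQ.2 x
      · rw [← Finset.sum_mul]
        change r i x * (P x / r i x) = P x
        field_simp
  have hev : ∀ᶠ i in 𝒢, ∀ x, 0 < P x → 0 < r i x := by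
    rw [eventually_all]
    intro x
    by_cases hx : 0 < P x
    · exact ((hr x).eventually (lt_mem_nhds hx)).mono fun i hi _ => hi
    · exact Eventually.of_forall fun i h => absurd h hx
  have hzero : ∀ x, ¬ 0 < P x → P x = 0 := fun x h => le_antisymm (not_lt.1 h) (hP x)
  have hr00 : ∀ i x, P x = 0 → r i x = 0 := fun i x hx =>
    Finset.sum_eq_zero fun y _ => hQn0 i x y hx
  have hQzero : ∀ x y, P x = 0 → Q (x, y) = 0 := fun x y hx => by
    have h1 := hQ.2 x
    rw [hx] at h1
    exact (Finset.sum_eq_zero_iff_of_nonneg fun y _ => hQ.1 _).1 h1 y (Finset.mem_univ y)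
  have hQ't : Tendsto Q' 𝒢 (nhds Q) := by
    rw [tendsto_pi_nhds]
    rintro ⟨x, y⟩
    by_cases hx : 0 < P x
    · have h1 := (hlim' (x, y)).mul ((tendsto_const_nhds (x := P x)).div (hr x) hx.ne')
      rw [div_self hx.ne', mul_one] at h1
      refine h1.congr' ?_
      filter_upwards [hev] with i hi
      simp only [Q', Pi.div_apply]
      rw [if_neg (hi x hx).ne']
    · have : ∀ i, Q' i (x, y) = Q (x, y) := fun i => by
        simp only [Q']; rw [if_pos (hr00 i x (hzero x hx))]
      simp only [this]
      exact tendsto_const_nhds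
  have hmain : Tendsto (fun i => supLik 𝒰 (Q' i)) 𝒢 (nhds (supLik 𝒰 Q)) :=
    (hc Q hQ).tendsto.comp (tendsto_nhdsWithin_iff.2 ⟨hQ't, Eventually.of_forall hQ'⟩)
  -- The table lies between (1-d)Q' and (1+d)Q'. As the likelihood is antitone and scaling a table
  -- raises it to a power, it is squeezed between the powers 1+d and 1-d of its value at Q'.
  let d : ι → ℝ := fun i => ∑ x, if 0 < P x then |r i x / P x - 1| else 0
  have hd : Tendsto d 𝒢 (nhds 0) := by
    have : ∀ x, Tendsto (fun i => if 0 < P x then |r i x / P x - 1| else 0) 𝒢 (nhds 0) := by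
      intro x
      split_ifs with hx
      · have h1 := (((hr x).div_const (P x)).sub_const 1).abs
        rwa [div_self hx.ne', sub_self, abs_zero] at h1
      · exact tendsto_const_nhds
    simpa using tendsto_finsetSum Finset.univ fun x _ => this x
  have hdx : ∀ i x, 0 < P x → |r i x / P x - 1| ≤ d i := fun i x hx => by
    have := Finset.single_le_sum (f := fun x => if 0 < P x then |r i x / P x - 1| else 0)
      (fun x _ => by split_ifs <;> positivity) (Finset.mem_univ x)
    simpa [hx] using this
  have hrepr : ∀ᶠ i in 𝒢, ∀ x y, 0 < P x → Qn i (x, y) = r i x / P x * Q' i (x, y) := by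
    filter_upwards [hev] with i hi x y hx
    have := hi x hx
    simp only [Q']
    rw [if_neg this.ne']
    field_simp
  have hQ'zero : ∀ i x y, P x = 0 → Q' i (x, y) = 0 := fun i x y hx => by
    simp only [Q']; rw [if_pos (hr00 i x hx)]; exact hQzero x y hx
  have hup : Tendsto (fun i => supLik 𝒰 (Q' i) ^ (1 - d i)) 𝒢 (nhds (supLik 𝒰 Q)) := by
    have := hmain.rpow (tendsto_const_nhds.sub hd) (Or.inr (by norm_num : (0 : ℝ) < 1 - 0))
    simpa using this
  have hlo : Tendsto (fun i => supLik 𝒰 (Q' i) ^ (1 + d i)) 𝒢 (nhds (supLik 𝒰 Q)) := by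
    have := hmain.rpow (tendsto_const_nhds.add hd) (Or.inr (by norm_num : (0 : ℝ) < 1 + 0))
    simpa using this
  have hd1 : ∀ᶠ i in 𝒢, d i < 1 := hd.eventually (gt_mem_nhds one_pos)
  refine tendsto_of_tendsto_of_tendsto_of_le_of_le' hlo hup ?_ ?_
  · filter_upwards [hrepr] with i hi
    have hd0 : 0 ≤ d i := Finset.sum_nonneg fun x _ => by split_ifs <;> positivity
    rw [← supLik_smul h𝒰 (hQ' i).1 (by linarith)]
    refine supLik_anti 𝒰 (hQn i) ?_
    rintro ⟨x, y⟩
    by_cases hx : 0 < P x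
    · rw [hi x y hx]
      refine mul_le_mul_of_nonneg_right ?_ ((hQ' i).1 _)
      have := (abs_le.1 (hdx i x hx)).2; linarith
    · rw [hQn0 i x y (hzero x hx), hQ'zero i x y (hzero x hx), mul_zero]
  · filter_upwards [hrepr, hd1] with i hi hdi
    rw [← supLik_smul h𝒰 (hQ' i).1 (by linarith)]
    refine supLik_anti 𝒰 (fun p => mul_nonneg (by linarith) ((hQ' i).1 p)) ?_
    rintro ⟨x, y⟩
    by_cases hx : 0 < P x
    · rw [hi x y hx]
      refine mul_le_mul_of_nonneg_right ?_ ((hQ' i).1 _)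
      have := (abs_le.1 (hdx i x hx)).1; linarith
    · rw [hQn0 i x y (hzero x hx), hQ'zero i x y (hzero x hx), mul_zero]

/-- Upper semicontinuity of the generalised likelihood along tables whose `X`-marginals tend to `P`
without leaving its support. -/
def SupLikUsc (P : X → ℝ) (𝒰 : Set (DMC X Y)) : Prop :=
  ∀ (𝒢 : Filter ℕ) (Qn : ℕ → X × Y → ℝ) (Q : X × Y → ℝ), (∀ i p, 0 ≤ Qn i p) →
    (∀ i x y, P x = 0 → Qn i (x, y) = 0) → Q ∈ jointLaws Y P → Tendsto Qn 𝒢 (nhds Q) →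
    ∃ g : ℕ → ℝ, (∀ᶠ i in 𝒢, supLik 𝒰 (Qn i) ≤ g i) ∧ Tendsto g 𝒢 (nhds (supLik 𝒰 Q))

theorem supLikUsc_of_continuousOn {𝒰 : Set (DMC X Y)} (h𝒰 : 𝒰.Nonempty) {P : X → ℝ}
    (hP : ∀ x, 0 ≤ P x) (hc : ContinuousOn (supLik 𝒰) (jointLaws Y P)) : SupLikUsc P 𝒰 :=
  fun _ _ _ h1 h2 h3 h4 => ⟨_, Eventually.of_forall fun _ => le_rfl,
    tendsto_supLik h𝒰 hP hc h1 h2 h3 h4⟩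

/-- A single f_W may be -∞ along a sequence and finite at its limit, so it need not be continuous.
The reverse cannot happen: a forbidden pair charged by the limit is eventually charged. This
suffices for the exponents of individual channels. -/
theorem supLikUsc_singleton (W : DMC X Y) (P : X → ℝ) : SupLikUsc P {W} := by
  intro 𝒢 Qn Q _ _ _ hlim
  have hlim' := tendsto_pi_nhds.1 hlim
  simp only [supLik_singleton]
  by_cases hW : ∀ x y, 0 < Q (x, y) → 0 < W.prob x y
  · refine ⟨fun i => Real.exp (∑ x, ∑ y, Qn i (x, y) * Real.log (W.prob x y)),
      Eventually.of_forall fun i => ?_, ?_⟩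
    · unfold likR; split_ifs
      · exact le_rfl
      · positivity
    · rw [likR, if_pos hW]
      refine (Real.continuous_exp.tendsto _).comp ?_
      exact tendsto_finsetSum _ fun x _ => tendsto_finsetSum _ fun y _ =>
        (hlim' (x, y)).mul_const _
  · refine ⟨fun _ => 0, ?_, ?_⟩
    · push Not at hW
      obtain ⟨x, y, hxy, hWxy⟩ := hW
      filter_upwards [(hlim' (x, y)).eventually (lt_mem_nhds hxy)] with i hi
      rw [likR, if_neg]
      intro h
      exact absurd (h x y hi) (not_lt.2 hWxy)
    · rw [likR, if_neg hW]; exact tendsto_const_nhds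

end Likelihood

/-! ### Entropy forms of mutual information and divergence. -/

section Information

variable {X Y : Type*} [Fintype X] [Fintype Y]

theorem le_of_mem_jointLaws {X Y : Type*} [Fintype Y] {P : X → ℝ} {Q : X × Y → ℝ} (hQ : Q ∈ jointLaws Y P) (x : X) (y : Y) :
    Q (x, y) ≤ P x := by
  rw [← hQ.2 x]
  exact Finset.single_le_sum (f := fun y => Q (x, y)) (fun y _ => hQ.1 _) (Finset.mem_univ y)

theorem le_margY {P : X → ℝ} {Q : X × Y → ℝ} (hQ : Q ∈ jointLaws Y P) (x : X)
    (y : Y) : Q (x, y) ≤ margY Q y :=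
  Finset.single_le_sum (f := fun x => Q (x, y)) (fun _ _ => hQ.1 _) (Finset.mem_univ x)

theorem entropy_prod (Q : X × Y → ℝ) :
    entropy Q = -∑ x, ∑ y, Q (x, y) * Real.log (Q (x, y)) := by
  simp only [entropy, Fintype.sum_prod_type, Real.negMulLog, neg_mul, Finset.sum_neg_distrib]

theorem sum_mul_log_left {P : X → ℝ} {Q : X × Y → ℝ} (hQ : Q ∈ jointLaws Y P) :
    ∑ x, ∑ y, Q (x, y) * Real.log (P x) = -entropy P := by
  simp only [entropy, Real.negMulLog, neg_mul, Finset.sum_neg_distrib, neg_neg]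
  refine Finset.sum_congr rfl fun x _ => ?_
  rw [← Finset.sum_mul, hQ.2]

theorem mutInfo_eq {P : X → ℝ} {Q : X × Y → ℝ} (hQ : Q ∈ jointLaws Y P) :
    mutInfo P Q = entropy P + entropy (margY Q) - entropy Q := by
  have h1 : ∑ x, ∑ y, Q (x, y) * Real.log (margY Q y) = -entropy (margY Q) := by
    rw [Finset.sum_comm]
    simp only [entropy, Real.negMulLog, neg_mul, Finset.sum_neg_distrib, neg_neg]
    refine Finset.sum_congr rfl fun y _ => ?_
    rw [← Finset.sum_mul]; rfl
  have h2 : mutInfo P Q = ∑ x, ∑ y, (Q (x, y) * Real.log (Q (x, y)) -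
      Q (x, y) * Real.log (P x) - Q (x, y) * Real.log (margY Q y)) := by
    refine Finset.sum_congr rfl fun x _ => Finset.sum_congr rfl fun y _ => ?_
    rcases (hQ.1 (x, y)).eq_or_lt with h | h
    · simp [← h]
    · have hP := h.trans_le (le_of_mem_jointLaws hQ x y)
      have hq := h.trans_le (le_margY hQ x y)
      rw [Real.log_div h.ne' (mul_pos hP hq).ne', Real.log_mul hP.ne' hq.ne']; ring
  simp only [Finset.sum_sub_distrib] at h2
  rw [h2, sum_mul_log_left hQ, h1, entropy_prod]; ring

theorem condDiv_of_pos {P : X → ℝ} {Q : X × Y → ℝ} (hQ : Q ∈ jointLaws Y P) (W : DMC X Y)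
    (h : 0 < likR W Q) :
    condDiv P W Q = ((entropy P - entropy Q - Real.log (likR W Q) : ℝ) : EReal) := by
  have hs : ∀ x y, 0 < Q (x, y) → 0 < W.prob x y := by
    by_contra hs
    rw [likR, if_neg hs] at h
    exact lt_irrefl _ h
  rw [condDiv, if_pos hs, likR, if_pos hs, Real.log_exp]
  congr 1
  have h2 : ∑ x, ∑ y, Q (x, y) * Real.log (Q (x, y) / (P x * W.prob x y)) =
      ∑ x, ∑ y, (Q (x, y) * Real.log (Q (x, y)) -
      Q (x, y) * Real.log (P x) - Q (x, y) * Real.log (W.prob x y)) := by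
    refine Finset.sum_congr rfl fun x _ => Finset.sum_congr rfl fun y _ => ?_
    rcases (hQ.1 (x, y)).eq_or_lt with h | h
    · simp [← h]
    · have hP := h.trans_le (le_of_mem_jointLaws hQ x y)
      have hq := hs x y h
      rw [Real.log_div h.ne' (mul_pos hP hq).ne', Real.log_mul hP.ne' hq.ne']; ring
  simp only [Finset.sum_sub_distrib] at h2
  rw [h2, sum_mul_log_left hQ, entropy_prod]; ring

theorem condDiv_of_eq_zero {P : X → ℝ} {Q : X × Y → ℝ} {W : DMC X Y} (h : likR W Q = 0) :
    condDiv P W Q = ⊤ := by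
  rw [condDiv, if_neg]
  intro hs
  rw [likR, if_pos hs] at h
  exact (Real.exp_pos _).ne' h

/-- Multiplicative form of D = H(P) - H(Q) - f_W(Q). The strict hypothesis already forces a positive
likelihood. -/
theorem condDiv_lt_of {P : X → ℝ} {Q : X × Y → ℝ} (hQ : Q ∈ jointLaws Y P) (W : DMC X Y) {c : ℝ}
    (h : Real.exp (-c) < likR W Q * Real.exp (entropy Q - entropy P)) :
    condDiv P W Q < c := by
  have hpos : 0 < likR W Q := by
    rcases (likR_nonneg W Q).eq_or_lt with h0 | h0
    · rw [← h0, zero_mul] at h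
      exact absurd h (not_lt.2 (Real.exp_pos _).le)
    · exact h0
  rw [condDiv_of_pos hQ W hpos]
  rw [← Real.log_lt_log_iff (Real.exp_pos _) (by positivity), Real.log_exp,
    Real.log_mul hpos.ne' (Real.exp_pos _).ne', Real.log_exp] at h
  exact_mod_cast (by linarith)

theorem continuous_margY {X Y : Type*} [Fintype X] : Continuous (margY : (X × Y → ℝ) → Y → ℝ) :=
  continuous_pi fun y => continuous_finsetSum _ fun x _ => continuous_apply (x, y)

theorem continuousOn_mutInfo (P : X → ℝ) : ContinuousOn (mutInfo P) (jointLaws Y P) := by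
  have : Continuous fun Q : X × Y → ℝ => entropy P + entropy (margY Q) - entropy Q :=
    (continuous_const.add (continuous_entropy.comp continuous_margY)).sub continuous_entropy
  exact this.continuousOn.congr fun Q hQ => mutInfo_eq hQ

theorem isCompact_jointLaws {X Y : Type*} [Fintype Y] (P : X → ℝ) : IsCompact (jointLaws Y P) := by
  have hcl : IsClosed (jointLaws Y P) := by
    have h1 : jointLaws Y P = (⋂ p, {Q | 0 ≤ Q p}) ∩ ⋂ x, {Q | ∑ y, Q (x, y) = P x} := by
      ext Q; simp [jointLaws]
    rw [h1]
    refine (isClosed_iInter fun p => isClosed_le continuous_const (continuous_apply p)).inter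
      (isClosed_iInter fun x => isClosed_eq ?_ continuous_const)
    exact continuous_finsetSum _ fun y _ => continuous_apply (x, y)
  refine (isCompact_univ_pi fun p : X × Y => isCompact_Icc (a := (0 : ℝ)) (b := P p.1)).of_isClosed_subset
    hcl ?_
  intro Q hQ p _
  exact ⟨hQ.1 p, le_of_mem_jointLaws hQ p.1 p.2⟩

end Information

/-! ### The feasible sets in multiplicative form. -/

section Feasibility

variable {X Y : Type*} [Fintype X] [Fintype Y]

/-- The codewords that occur in typical numbers contribute to the sum of the likelihoods over `𝒲`
at most `exp (-α) γ` (per letter). -/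
def BackgroundLe (R α : ℝ) (P : X → ℝ) (𝒲 : Set (DMC X Y)) (q : Y → ℝ) (γ : ℝ) : Prop :=
  ∀ Q ∈ jointLaws Y P, margY Q = q → mutInfo P Q < R →
    Real.exp α * supLik 𝒲 Q * Real.exp (R - mutInfo P Q) ≤ γ

theorem log_ofReal_exp (a : ℝ) : ENNReal.log (ENNReal.ofReal (Real.exp a)) = a := by
  rw [ENNReal.log_ofReal_of_pos (Real.exp_pos _), Real.log_exp]

theorem coe_add_log_ofReal (c a : ℝ) :
    (c : EReal) + ENNReal.log (ENNReal.ofReal a) =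
      ENNReal.log (ENNReal.ofReal (Real.exp c * a)) := by
  rw [ENNReal.ofReal_mul (Real.exp_pos c).le, ENNReal.log_mul_add, log_ofReal_exp]

theorem log_ofReal_le_log_ofReal {a b : ℝ} (hb : 0 ≤ b) :
    ENNReal.log (ENNReal.ofReal a) ≤ ENNReal.log (ENNReal.ofReal b) ↔ a ≤ b := by
  rw [ENNReal.log_le_log_iff, ENNReal.ofReal_le_ofReal_iff hb]

theorem exp_neg_mul_le_iff {α a b : ℝ} : a ≤ Real.exp (-α) * b ↔ Real.exp α * a ≤ b := by
  rw [Real.exp_neg, inv_mul_eq_div, le_div_iff₀ (Real.exp_pos α), mul_comm]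

/-- Laws with I ≥ R meet the bound trivially. For I < R the positive part must be at least R - I >
0, so the bracket can be dropped and the inequality exponentiated. -/
theorem le_sFun_iff {R α : ℝ} {P : X → ℝ} {𝒲 : Set (DMC X Y)} (h𝒲 : 𝒲.Nonempty) {q : Y → ℝ}
    {γ : ℝ} (hγ : 0 ≤ γ) :
    (R : EReal) ≤ sFun α P 𝒲 q (ENNReal.log (ENNReal.ofReal γ)) ↔ BackgroundLe R α P 𝒲 q γ := by
  rw [sFun, le_iInf₂_iff]
  have key : ∀ Q ∈ jointLaws Y P, 0 < supLik 𝒲 Q →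
      ((R : EReal) ≤ ((mutInfo P Q : ℝ) : EReal) + max (((-α : ℝ) : EReal) - genLogLik 𝒲 Q +
        ENNReal.log (ENNReal.ofReal γ)) 0 ↔
      (mutInfo P Q < R → Real.exp α * supLik 𝒲 Q * Real.exp (R - mutInfo P Q) ≤ γ)) := by
    intro Q hQ ha
    rw [← log_ofReal_supLik h𝒲 hQ.1, ENNReal.log_ofReal_of_pos ha]
    -- For γ = 0 the positive part vanishes, and both sides say that a law of positive likelihood
    -- has I ≥ R.
    rcases hγ.eq_or_lt with h | h
    · rw [← h]
      simp only [ENNReal.ofReal_zero, ENNReal.log_zero, EReal.add_bot, bot_le, sup_of_le_right,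
        add_zero]
      rw [EReal.coe_le_coe_iff]
      constructor
      · intro h1 h2; linarith
      · intro h1
        by_contra h2
        have := h1 (not_le.1 h2)
        have h3 : 0 < Real.exp α * supLik 𝒲 Q * Real.exp (R - mutInfo P Q) := by positivity
        linarith
    · rw [ENNReal.log_ofReal_of_pos h]
      have hcoe : ((mutInfo P Q : ℝ) : EReal) + max (((-α : ℝ) : EReal) -
          ((Real.log (supLik 𝒲 Q) : ℝ) : EReal) + ((Real.log γ : ℝ) : EReal)) 0 =
          ((mutInfo P Q + max (-α - Real.log (supLik 𝒲 Q) + Real.log γ) 0 : ℝ) : EReal) := by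
        rw [EReal.coe_add, EReal.coe_strictMono.monotone.map_max]; norm_cast
      rw [hcoe, EReal.coe_le_coe_iff]
      have h3 : (Real.exp α * supLik 𝒲 Q * Real.exp (R - mutInfo P Q) ≤ γ) ↔
          α + Real.log (supLik 𝒲 Q) + (R - mutInfo P Q) ≤ Real.log γ := by
        rw [← Real.log_le_log_iff (by positivity) h, Real.log_mul (by positivity) (by positivity),
          Real.log_mul (by positivity) (by positivity), Real.log_exp, Real.log_exp]
      rw [h3]
      constructor
      · intro h1 h2
        rcases max_cases (-α - Real.log (supLik 𝒲 Q) + Real.log γ) 0 with h4 | h4 <;> linarith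
      · intro h1
        rcases lt_or_ge (mutInfo P Q) R with h2 | h2
        · have := h1 h2
          have := le_max_left (-α - Real.log (supLik 𝒲 Q) + Real.log γ) 0
          linarith
        · have := le_max_right (-α - Real.log (supLik 𝒲 Q) + Real.log γ) 0
          linarith
  constructor
  · intro h Q hQ hq hI
    rcases (supLik_nonneg 𝒲 Q).eq_or_lt with h0 | h0
    · rw [← h0, mul_zero, zero_mul]; exact hγ
    · refine (key Q hQ h0).1 (h Q ⟨hQ, ?_, hq⟩) hI
      rw [← log_ofReal_supLik h𝒲 hQ.1, ENNReal.bot_lt_log_iff]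
      simpa using h0
  · rintro h Q ⟨hQ, hbot, hq⟩
    have h0 : 0 < supLik 𝒲 Q := by
      rw [← log_ofReal_supLik h𝒲 hQ.1, ENNReal.bot_lt_log_iff] at hbot
      simpa using hbot
    exact (key Q hQ h0).2 (h Q hQ hq)

theorem mem_setJ_iff {R α : ℝ} {P : X → ℝ} {𝒲 𝒱 : Set (DMC X Y)} (h𝒲 : 𝒲.Nonempty)
    (h𝒱 : 𝒱.Nonempty) {Q : X × Y → ℝ} :
    Q ∈ setJ R α P 𝒲 𝒱 ↔ Q ∈ jointLaws Y P ∧ Real.exp α * supLik 𝒲 Q ≤ supLik 𝒱 Q ∧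
      BackgroundLe R α P 𝒲 (margY Q) (supLik 𝒱 Q) := by
  rw [setJ, Set.mem_ofPred_eq]
  refine and_congr_right fun hQ => ?_
  rw [← log_ofReal_supLik h𝒲 hQ.1, ← log_ofReal_supLik h𝒱 hQ.1, coe_add_log_ofReal,
    log_ofReal_le_log_ofReal (mul_nonneg (Real.exp_pos _).le (supLik_nonneg _ _)),
    exp_neg_mul_le_iff, le_sFun_iff h𝒲 (supLik_nonneg _ _)]

theorem mem_setK_iff {R α : ℝ} {P : X → ℝ} {𝒲 𝒱 : Set (DMC X Y)} (h𝒲 : 𝒲.Nonempty)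
    (h𝒱 : 𝒱.Nonempty) {Qt Qb : X × Y → ℝ} :
    (Qt, Qb) ∈ setK R α P 𝒲 𝒱 ↔ Qt ∈ jointLaws Y P ∧ Qb ∈ jointLaws Y P ∧ margY Qb = margY Qt ∧
      Real.exp α * supLik 𝒲 Qb ≤ supLik 𝒱 Qb ∧
      Real.exp α * supLik 𝒲 Qt ≤ supLik 𝒱 Qb * Real.exp (rateGap R P Qb) ∧
      BackgroundLe R α P 𝒲 (margY Qt) (supLik 𝒱 Qb * Real.exp (rateGap R P Qb)) := by
  rw [setK, Set.mem_ofPred_eq]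
  refine and_congr_right fun hQt => and_congr_right fun hQb => and_congr_right fun _ => ?_
  simp only
  rw [← log_ofReal_supLik h𝒲 hQb.1, ← log_ofReal_supLik h𝒱 hQb.1, ← log_ofReal_supLik h𝒲 hQt.1,
    coe_add_log_ofReal, coe_add_log_ofReal,
    log_ofReal_le_log_ofReal (mul_nonneg (Real.exp_pos _).le (supLik_nonneg _ _)),
    exp_neg_mul_le_iff, sub_eq_add_neg, add_comm _ (-((rateGap R P Qb : ℝ) : EReal)),
    ← EReal.coe_neg, coe_add_log_ofReal, log_ofReal_le_log_ofReal (supLik_nonneg _ _),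
    add_comm (ENNReal.log _), coe_add_log_ofReal, mul_comm (supLik 𝒱 Qb),
    le_sFun_iff h𝒲 (mul_nonneg (Real.exp_pos _).le (supLik_nonneg _ _))]
  refine and_congr_right fun _ => and_congr_left fun _ => ?_
  have := exp_neg_mul_le_iff (α := -rateGap R P Qb) (a := Real.exp α * supLik 𝒲 Qt)
    (b := supLik 𝒱 Qb)
  rw [neg_neg] at this
  exact this.symm

end Feasibility

/-! ### Mixtures lower information and divergence. -/

section Convexity

/-- The left side is the supporting plane of the convex homogeneous function a log(a/b) along a =
bc. The choice c = 1 gives nonnegativity of information and divergence. -/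
theorem mul_log_div_ge {a b c : ℝ} (ha : 0 ≤ a) (hb : 0 ≤ b) (hab : b = 0 → a = 0) (hc : 0 < c) :
    a * Real.log c + a - b * c ≤ a * Real.log (a / b) := by
  rcases ha.eq_or_lt with h | h
  · rw [← h]; simp; positivity
  · have hb' : 0 < b := lt_of_le_of_ne hb fun h0 => h.ne' (hab h0.symm)
    have h1 := Real.one_sub_inv_le_log_of_pos (div_pos h (mul_pos hb' hc))
    rw [Real.log_div h.ne' (by positivity), Real.log_mul hb'.ne' hc.ne', inv_div] at h1
    have h2 := mul_le_mul_of_nonneg_left h1 h.le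
    have h3 : a * (1 - b * c / a) = a - b * c := by field_simp
    rw [h3] at h2
    rw [Real.log_div h.ne' hb'.ne']
    linarith

/-- The log-sum inequality for a mixture with a common second term. -/
theorem mix_mul_log_le {a b b' t : ℝ} (ha : 0 ≤ a) (hb : 0 ≤ b) (hab : b = 0 → a = 0)
    (hb' : 0 ≤ b') (ht : 0 ≤ t) (ht1 : t ≤ 1) :
    ((1 - t) * a + t * b') * Real.log (((1 - t) * a + t * b') / ((1 - t) * b + t * b')) ≤
      (1 - t) * (a * Real.log (a / b)) := by
  have ht' : 0 ≤ 1 - t := by linarith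
  have h1a := mul_nonneg ht' ha
  have h1b := mul_nonneg ht' hb
  have h1b' := mul_nonneg ht hb'
  rcases (add_nonneg h1a h1b').eq_or_lt with hu | hu
  · have : (1 - t) * a = 0 := by linarith
    rw [← hu, zero_mul, ← mul_assoc, this, zero_mul]
  have hv : 0 < (1 - t) * b + t * b' := by
    by_contra h
    have hb0 : (1 - t) * b = 0 := by linarith
    have hb'0 : t * b' = 0 := by linarith
    rcases mul_eq_zero.1 hb0 with h0 | h0
    · rw [h0, hb'0] at hu; simp at hu
    · rw [hab h0, hb'0] at hu; simp at hu
  -- The supporting plane is taken at the ratio of the two mixtures; the common part contributes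
  -- only b' log c ≤ b'(c-1).
  set c := ((1 - t) * a + t * b') / ((1 - t) * b + t * b') with hc
  have hc0 : 0 < c := div_pos hu hv
  have e1 := mul_le_mul_of_nonneg_left (mul_log_div_ge ha hb hab hc0) ht'
  have e2 : t * b' * Real.log c ≤ t * b' * (c - 1) :=
    mul_le_mul_of_nonneg_left (Real.log_le_sub_one_of_pos hc0) h1b'
  have e3 : ((1 - t) * b + t * b') * c = (1 - t) * a + t * b' := by rw [hc]; field_simp
  nlinarith

variable {X Y : Type*} [Fintype X] [Fintype Y]

/-- Mixtures of joint distributions. -/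
def mixLaw {A : Type*} (t : ℝ) (Q Q' : A → ℝ) (p : A) : ℝ := (1 - t) * Q p + t * Q' p

/-- The product distribution. -/
def prodLaw (P : X → ℝ) (q : Y → ℝ) (p : X × Y) : ℝ := P p.1 * q p.2

/-- The joint distribution of the input and the output of a channel. -/
def chanLaw (P : X → ℝ) (V : DMC X Y) (p : X × Y) : ℝ := P p.1 * V.prob p.1 p.2

theorem mixLaw_mem {X Y : Type*} [Fintype Y] {P : X → ℝ} {Q Q' : X × Y → ℝ} (hQ : Q ∈ jointLaws Y P)
    (hQ' : Q' ∈ jointLaws Y P) {t : ℝ} (ht : 0 ≤ t) (ht1 : t ≤ 1) :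
    mixLaw t Q Q' ∈ jointLaws Y P := by
  refine ⟨fun p => add_nonneg (mul_nonneg (by linarith) (hQ.1 p)) (mul_nonneg ht (hQ'.1 p)),
    fun x => ?_⟩
  simp only [mixLaw, Finset.sum_add_distrib, ← Finset.mul_sum, hQ.2, hQ'.2]
  ring

theorem margY_mixLaw {X Y : Type*} [Fintype X] (Q Q' : X × Y → ℝ) (t : ℝ) :
    margY (mixLaw t Q Q') = mixLaw t (margY Q) (margY Q') := by
  ext y
  simp only [margY, mixLaw, Finset.sum_add_distrib, ← Finset.mul_sum]

theorem prodLaw_mem {P : X → ℝ} (hP : P ∈ stdSimplex ℝ X) {q : Y → ℝ} (hq : q ∈ stdSimplex ℝ Y) :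
    prodLaw P q ∈ jointLaws Y P :=
  ⟨fun p => mul_nonneg (hP.1 _) (hq.1 _), fun x => by
    simp only [prodLaw, ← Finset.mul_sum, hq.2, mul_one]⟩

theorem chanLaw_mem {P : X → ℝ} (hP : P ∈ stdSimplex ℝ X) (V : DMC X Y) :
    chanLaw P V ∈ jointLaws Y P :=
  ⟨fun p => mul_nonneg (hP.1 _) (V.nonneg _ _), fun x => by
    simp only [chanLaw, ← Finset.mul_sum, V.sum_eq_one, mul_one]⟩

theorem margY_prodLaw {X Y : Type*} [Fintype X] {P : X → ℝ} (hP : P ∈ stdSimplex ℝ X) (q : Y → ℝ) :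
    margY (prodLaw P q) = q := by
  ext y
  simp only [margY, prodLaw, ← Finset.sum_mul, hP.2, one_mul]

theorem margY_mem {P : X → ℝ} (hP : P ∈ stdSimplex ℝ X) {Q : X × Y → ℝ}
    (hQ : Q ∈ jointLaws Y P) : margY Q ∈ stdSimplex ℝ Y := by
  refine ⟨fun y => Finset.sum_nonneg fun x _ => hQ.1 _, ?_⟩
  simp only [margY]
  rw [Finset.sum_comm, ← hP.2]
  exact Finset.sum_congr rfl fun x _ => hQ.2 x

/-- The log-sum inequality entry by entry: in the product part the law equals the product of its
marginals, so it carries no information, even when its output marginal differs from that of Q. -/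
theorem mutInfo_mixLaw_le {P : X → ℝ} (hP : P ∈ stdSimplex ℝ X) {Q : X × Y → ℝ}
    (hQ : Q ∈ jointLaws Y P) {q : Y → ℝ} (hq : q ∈ stdSimplex ℝ Y) {t : ℝ} (ht : 0 ≤ t)
    (ht1 : t ≤ 1) : mutInfo P (mixLaw t Q (prodLaw P q)) ≤ (1 - t) * mutInfo P Q := by
  unfold mutInfo
  rw [margY_mixLaw, margY_prodLaw hP, Finset.mul_sum]
  refine Finset.sum_le_sum fun x _ => ?_
  rw [Finset.mul_sum]
  refine Finset.sum_le_sum fun y _ => ?_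
  have hm : 0 ≤ margY Q y := (margY_mem hP hQ).1 y
  have := mix_mul_log_le (hQ.1 (x, y)) (mul_nonneg (hP.1 x) hm) (fun h => by
      rcases mul_eq_zero.1 h with h | h
      · exact le_antisymm (h ▸ le_of_mem_jointLaws hQ x y) (hQ.1 _)
      · exact le_antisymm (h ▸ le_margY hQ x y) (hQ.1 _))
    (mul_nonneg (hP.1 x) (hq.1 y)) ht ht1
  have e : (1 - t) * (P x * margY Q y) + t * (P x * q y) = P x * mixLaw t (margY Q) q y := by
    simp only [mixLaw]; ring
  rw [e] at this
  exact this

theorem mutInfo_nonneg {P : X → ℝ} (hP : P ∈ stdSimplex ℝ X) {Q : X × Y → ℝ}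
    (hQ : Q ∈ jointLaws Y P) : 0 ≤ mutInfo P Q := by
  have h1 : ∑ x, ∑ y, (Q (x, y) - P x * margY Q y) ≤ mutInfo P Q := by
    refine Finset.sum_le_sum fun x _ => Finset.sum_le_sum fun y _ => ?_
    have := mul_log_div_ge (hQ.1 (x, y)) (mul_nonneg (hP.1 x) ((margY_mem hP hQ).1 y)) (fun h => by
      rcases mul_eq_zero.1 h with h | h
      · exact le_antisymm (h ▸ le_of_mem_jointLaws hQ x y) (hQ.1 _)
      · exact le_antisymm (h ▸ le_margY hQ x y) (hQ.1 _)) one_pos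
    simpa using this
  refine le_trans (le_of_eq ?_) h1
  simp only [Finset.sum_sub_distrib, hQ.2, ← Finset.mul_sum, (margY_mem hP hQ).2, mul_one, sub_self,
    Finset.sum_const_zero]

theorem mutInfo_prodLaw {P : X → ℝ} (hP : P ∈ stdSimplex ℝ X) {q : Y → ℝ}
    (hq : q ∈ stdSimplex ℝ Y) : mutInfo P (prodLaw P q) ≤ 0 := by
  have h := mutInfo_mixLaw_le hP (prodLaw_mem hP hq) hq zero_le_one le_rfl
  have : mixLaw 1 (prodLaw P q) (prodLaw P q) = prodLaw P q := by ext; simp [mixLaw]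
  rw [this] at h
  simpa using h

/-- The divergence does not increase on the way to the law of the channel. -/
theorem condDiv_mixLaw_le {P : X → ℝ} (hP : P ∈ stdSimplex ℝ X) {Q : X × Y → ℝ}
    (hQ : Q ∈ jointLaws Y P) (V : DMC X Y) {t : ℝ} (ht : 0 ≤ t) (ht1 : t ≤ 1) {c : ℝ}
    (h : condDiv P V Q ≤ c) : condDiv P V (mixLaw t Q (chanLaw P V)) ≤ ((1 - t) * c : ℝ) := by
  by_cases hs : ∀ x y, 0 < Q (x, y) → 0 < V.prob x y
  · have hs' : ∀ x y, 0 < mixLaw t Q (chanLaw P V) (x, y) → 0 < V.prob x y := by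
      intro x y hxy
      by_contra hV
      have hV0 : V.prob x y = 0 := le_antisymm (not_lt.1 hV) (V.nonneg x y)
      have hQ0 : Q (x, y) = 0 := le_antisymm (not_lt.1 fun h => hV (hs x y h)) (hQ.1 _)
      simp [mixLaw, chanLaw, hV0, hQ0] at hxy
    rw [condDiv, if_pos hs, EReal.coe_le_coe_iff] at h
    rw [condDiv, if_pos hs', EReal.coe_le_coe_iff]
    refine le_trans ?_ (mul_le_mul_of_nonneg_left h (by linarith))
    rw [Finset.mul_sum]
    refine Finset.sum_le_sum fun x _ => ?_
    rw [Finset.mul_sum]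
    refine Finset.sum_le_sum fun y _ => ?_
    have := mix_mul_log_le (hQ.1 (x, y)) (mul_nonneg (hP.1 x) (V.nonneg x y)) (fun h => by
        rcases mul_eq_zero.1 h with h | h
        · exact le_antisymm (h ▸ le_of_mem_jointLaws hQ x y) (hQ.1 _)
        · exact le_antisymm (not_lt.1 fun h' => (hs x y h').ne' h) (hQ.1 _))
      (mul_nonneg (hP.1 x) (V.nonneg x y)) ht ht1
    have e : (1 - t) * (P x * V.prob x y) + t * (P x * V.prob x y) = P x * V.prob x y := by ring
    rw [e] at this
    exact this
  · rw [condDiv, if_neg hs] at h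
    exact absurd h (not_le.2 (EReal.coe_lt_top c))

theorem condDiv_nonneg {P : X → ℝ} (hP : P ∈ stdSimplex ℝ X) {Q : X × Y → ℝ}
    (hQ : Q ∈ jointLaws Y P) (V : DMC X Y) : 0 ≤ condDiv P V Q := by
  unfold condDiv
  split_ifs with hs
  · rw [← EReal.coe_zero, EReal.coe_le_coe_iff]
    have h1 : ∑ x, ∑ y, (Q (x, y) - P x * V.prob x y) ≤
        ∑ x, ∑ y, Q (x, y) * Real.log (Q (x, y) / (P x * V.prob x y)) := by
      refine Finset.sum_le_sum fun x _ => Finset.sum_le_sum fun y _ => ?_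
      have := mul_log_div_ge (hQ.1 (x, y)) (mul_nonneg (hP.1 x) (V.nonneg x y)) (fun h => by
        rcases mul_eq_zero.1 h with h | h
        · exact le_antisymm (h ▸ le_of_mem_jointLaws hQ x y) (hQ.1 _)
        · exact le_antisymm (not_lt.1 fun h' => (hs x y h').ne' h) (hQ.1 _)) one_pos
      simpa using this
    refine le_trans (le_of_eq ?_) h1
    simp only [Finset.sum_sub_distrib, hQ.2, ← Finset.mul_sum, V.sum_eq_one, mul_one, sub_self,
    Finset.sum_const_zero]
  · exact le_top

theorem continuous_mixLaw {A : Type*} (Q Q' : A → ℝ) : Continuous fun t : ℝ => mixLaw t Q Q' := by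
  unfold mixLaw; fun_prop

end Convexity

/-! ### The contribution of typical codewords and its continuity. -/

section Background

variable {X Y : Type*} [Fintype X] [Fintype Y]

/-- The contributions of the codewords that occur in typical numbers. -/
def bgSet (R : ℝ) (P : X → ℝ) (𝒰 : Set (DMC X Y)) (q : Y → ℝ) : Set ℝ :=
  {v | ∃ Q ∈ jointLaws Y P, margY Q = q ∧ mutInfo P Q ≤ R ∧ 0 < R ∧
    supLik 𝒰 Q * Real.exp (R - mutInfo P Q) = v}

/-- The largest contribution of the codewords that occur in typical numbers. -/
def bgSup (R : ℝ) (P : X → ℝ) (𝒰 : Set (DMC X Y)) (q : Y → ℝ) : ℝ := sSup (bgSet R P 𝒰 q)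

variable {R : ℝ} {P : X → ℝ} {𝒰 : Set (DMC X Y)}

theorem supLik_le_one (𝒰 : Set (DMC X Y)) {Q : X × Y → ℝ} (hQ : ∀ p, 0 ≤ Q p) :
    supLik 𝒰 Q ≤ 1 :=
  Real.iSup_le (fun _ => likR_le_one _ hQ) zero_le_one

theorem le_bgSup (hP : P ∈ stdSimplex ℝ X) {Q : X × Y → ℝ} (hQ : Q ∈ jointLaws Y P)
    (hI : mutInfo P Q ≤ R) (hR : 0 < R) :
    supLik 𝒰 Q * Real.exp (R - mutInfo P Q) ≤ bgSup R P 𝒰 (margY Q) := by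
  refine le_csSup ⟨Real.exp R, ?_⟩ ⟨Q, hQ, rfl, hI, hR, rfl⟩
  rintro _ ⟨Q, hQ, _, _, _, rfl⟩
  calc supLik 𝒰 Q * Real.exp (R - mutInfo P Q) ≤ 1 * Real.exp R :=
        mul_le_mul (supLik_le_one _ hQ.1)
          (Real.exp_le_exp.2 (by have := mutInfo_nonneg hP hQ; linarith)) (Real.exp_pos _).le
          zero_le_one
    _ = _ := one_mul _

/-- The clause 0 < R in `bgSet` matters at R = 0, where no law has I < R: the set is then empty and
its real supremum is 0. -/
theorem bgSup_eq_zero (hR : R ≤ 0) (q : Y → ℝ) : bgSup R P 𝒰 q = 0 := by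
  have : bgSet R P 𝒰 q = ∅ := by
    ext v
    simp only [bgSet, Set.mem_ofPred_eq, Set.mem_empty_iff_false, iff_false]
    rintro ⟨_, _, _, _, h, _⟩
    linarith
  rw [bgSup, this, Real.sSup_empty]

theorem continuousOn_bgVal (hc : ContinuousOn (supLik 𝒰) (jointLaws Y P)) (R : ℝ) :
    ContinuousOn (fun Q => supLik 𝒰 Q * Real.exp (R - mutInfo P Q)) (jointLaws Y P) :=
  hc.mul (Real.continuous_exp.comp_continuousOn (continuousOn_const.sub (continuousOn_mutInfo P)))

theorem exists_eq_bgSup (hP : P ∈ stdSimplex ℝ X)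
    (hc : ContinuousOn (supLik 𝒰) (jointLaws Y P)) (hR : 0 < R) {q : Y → ℝ}
    (hq : q ∈ stdSimplex ℝ Y) :
    ∃ Q ∈ jointLaws Y P, margY Q = q ∧ mutInfo P Q ≤ R ∧
      supLik 𝒰 Q * Real.exp (R - mutInfo P Q) = bgSup R P 𝒰 q := by
  have hS : IsCompact (jointLaws Y P ∩ {Q | margY Q = q} ∩ mutInfo P ⁻¹' Set.Iic R) := by
    have hS1 : IsCompact (jointLaws Y P ∩ {Q | margY Q = q}) :=
      (isCompact_jointLaws P).inter_right (isClosed_eq continuous_margY continuous_const)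
    refine hS1.of_isClosed_subset ?_ Set.inter_subset_left
    exact ((continuousOn_mutInfo P).mono Set.inter_subset_left).preimage_isClosed_of_isClosed
      hS1.isClosed isClosed_Iic
  obtain ⟨Q, ⟨⟨hQ, hQq⟩, hQI⟩, hmax⟩ := hS.exists_isMaxOn
    ⟨prodLaw P q, ⟨prodLaw_mem hP hq, margY_prodLaw hP q⟩, (mutInfo_prodLaw hP hq).trans hR.le⟩
    ((continuousOn_bgVal hc R).mono fun Q hQ => hQ.1.1)
  refine ⟨Q, hQ, hQq, hQI, le_antisymm ?_ ?_⟩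
  · have hQq' : margY Q = q := hQq
    rw [← hQq']; exact le_bgSup hP hQ hQI hR
  · refine csSup_le ⟨_, Q, hQ, hQq, hQI, hR, rfl⟩ ?_
    rintro _ ⟨Q', hQ', hq', hI', _, rfl⟩
    exact hmax (show Q' ∈ _ from ⟨⟨hQ', hq'⟩, hI'⟩)

/-- The constraint ranges over I < R but the supremum over I ≤ R, where it is attained. A maximiser
with I = R is approached by mixing in the product of its marginals, which keeps the output marginal
and makes I smaller than R. -/
theorem backgroundLe_iff (hP : P ∈ stdSimplex ℝ X)
    (hc : ContinuousOn (supLik 𝒰) (jointLaws Y P)) {q : Y → ℝ}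
    (hq : q ∈ stdSimplex ℝ Y) {α γ : ℝ} (hγ : 0 ≤ γ) :
    BackgroundLe R α P 𝒰 q γ ↔ Real.exp α * bgSup R P 𝒰 q ≤ γ := by
  constructor
  · intro h
    rcases le_or_gt R 0 with hR | hR
    · rw [bgSup_eq_zero hR, mul_zero]; exact hγ
    obtain ⟨Q, hQ, rfl, hI, hv⟩ := exists_eq_bgSup hP hc hR hq
    rw [← hv]
    set Qt : ℝ → X × Y → ℝ := fun t => mixLaw t Q (prodLaw P (margY Q)) with hQt
    have hmem : ∀ t ∈ Set.Ioo (0 : ℝ) 1, Qt t ∈ jointLaws Y P := fun t ht =>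
      mixLaw_mem hQ (prodLaw_mem hP hq) ht.1.le ht.2.le
    have hQ0 : Qt 0 = Q := by ext p; simp [hQt, mixLaw]
    have hev : ∀ᶠ t in nhdsWithin (0 : ℝ) (Set.Ioi 0), t ∈ Set.Ioo (0 : ℝ) 1 :=
      Ioo_mem_nhdsGT one_pos
    have hlim : Tendsto Qt (nhdsWithin 0 (Set.Ioi 0)) (nhdsWithin Q (jointLaws Y P)) := by
      refine tendsto_nhdsWithin_iff.2 ⟨?_, hev.mono hmem⟩
      have := (continuous_mixLaw Q (prodLaw P (margY Q))).tendsto 0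
      rw [show mixLaw 0 Q (prodLaw P (margY Q)) = Q from hQ0] at this
      exact this.mono_left nhdsWithin_le_nhds
    have hlim2 := ((continuousOn_bgVal hc R Q hQ).tendsto.comp hlim).const_mul (Real.exp α)
    refine le_of_tendsto hlim2 (hev.mono fun t ht => ?_)
    have h1 := h (Qt t) (hmem t ht) (by
      rw [hQt, margY_mixLaw, margY_prodLaw hP]; ext y; simp only [mixLaw]; ring) (by
      calc mutInfo P (Qt t) ≤ (1 - t) * mutInfo P Q := mutInfo_mixLaw_le hP hQ hq ht.1.le ht.2.le
        _ ≤ (1 - t) * R := mul_le_mul_of_nonneg_left hI (by linarith [ht.2])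
        _ < R := by nlinarith [ht.1])
    simpa [mul_assoc] using h1
  · rintro h Q hQ rfl hI
    have hR : 0 < R := (mutInfo_nonneg hP hQ).trans_lt hI
    refine le_trans ?_ h
    rw [mul_assoc]
    exact mul_le_mul_of_nonneg_left (le_bgSup hP hQ hI.le hR) (Real.exp_pos α).le

theorem mixLaw_mem_stdSimplex {A : Type*} [Fintype A] {q r : A → ℝ} (hq : q ∈ stdSimplex ℝ A)
    (hr : r ∈ stdSimplex ℝ A) {t : ℝ} (ht : 0 ≤ t) (ht1 : t ≤ 1) :
    mixLaw t q r ∈ stdSimplex ℝ A := by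
  refine ⟨fun a => add_nonneg (mul_nonneg (by linarith) (hq.1 a)) (mul_nonneg ht (hr.1 a)), ?_⟩
  simp only [mixLaw, Finset.sum_add_distrib, ← Finset.mul_sum, hq.2, hr.2]; ring

/-- The maximum is attained, so each superlevel set is the projection of a compact set of pairs of a
parameter and a law. -/
theorem upperSemicontinuous_bgSup (hP : P ∈ stdSimplex ℝ X)
    (hc : ContinuousOn (supLik 𝒰) (jointLaws Y P)) (hR : 0 < R) {q r : Y → ℝ}
    (hq : q ∈ stdSimplex ℝ Y) (hr : r ∈ stdSimplex ℝ Y) :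
    UpperSemicontinuous fun t : unitInterval => bgSup R P 𝒰 (mixLaw (t : ℝ) q r) := by
  rw [upperSemicontinuous_iff_isClosed_preimage]
  intro c
  have : CompactSpace (jointLaws Y P) := isCompact_iff_compactSpace.1 (isCompact_jointLaws P)
  have hI := continuousOn_iff_continuous_domRestrict.1 (continuousOn_mutInfo (Y := Y) P)
  have hv := continuousOn_iff_continuous_domRestrict.1 (continuousOn_bgVal hc R)
  let S : Set (unitInterval × jointLaws Y P) :=
    {s | margY (s.2 : X × Y → ℝ) = mixLaw (s.1 : ℝ) q r} ∩
      ({s | mutInfo P (s.2 : X × Y → ℝ) ≤ R} ∩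
        {s | c ≤ supLik 𝒰 (s.2 : X × Y → ℝ) * Real.exp (R - mutInfo P (s.2 : X × Y → ℝ))})
  have hS : IsClosed S := by
    refine (isClosed_eq ?_ ?_).inter ((isClosed_le ?_ continuous_const).inter
      (isClosed_le continuous_const ?_))
    · exact continuous_margY.comp (continuous_subtype_val.comp continuous_snd)
    · exact (continuous_mixLaw q r).comp (continuous_subtype_val.comp continuous_fst)
    · exact hI.comp continuous_snd
    · exact hv.comp continuous_snd
  have hEq : (fun t : unitInterval => bgSup R P 𝒰 (mixLaw (t : ℝ) q r)) ⁻¹' Set.Ici c =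
      Prod.fst '' S := by
    ext t
    simp only [Set.mem_preimage, Set.mem_Ici, Set.mem_image]
    constructor
    · intro h
      obtain ⟨Q, hQ, hQq, hQI, hQv⟩ := exists_eq_bgSup hP hc hR
        (mixLaw_mem_stdSimplex hq hr t.2.1 t.2.2)
      exact ⟨(t, ⟨Q, hQ⟩), ⟨hQq, hQI, by rw [← hQv] at h; exact h⟩, rfl⟩
    · rintro ⟨⟨t', Q, hQ⟩, ⟨h1, h2, h3⟩, rfl⟩
      have h1' : margY Q = mixLaw (t' : ℝ) q r := h1
      change c ≤ bgSup R P 𝒰 (mixLaw (t' : ℝ) q r)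
      rw [← h1']
      exact le_trans h3 (le_bgSup hP hQ h2 hR)
  rw [hEq]
  exact (hS.isCompact.image continuous_fst).isClosed

/-- A maximiser at t is carried to nearby parameters by mixing in a little of a product law with
marginal q or r, which does not increase the information and so stays admissible. -/
theorem lowerSemicontinuous_bgSup (hP : P ∈ stdSimplex ℝ X)
    (hc : ContinuousOn (supLik 𝒰) (jointLaws Y P)) (hR : 0 < R) {q r : Y → ℝ}
    (hq : q ∈ stdSimplex ℝ Y) (hr : r ∈ stdSimplex ℝ Y) :
    LowerSemicontinuous fun t : unitInterval => bgSup R P 𝒰 (mixLaw (t : ℝ) q r) := by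
  rw [lowerSemicontinuous_iff_isClosed_preimage]
  intro c
  refine IsSeqClosed.isClosed ?_
  intro u t hu hut
  obtain ⟨Q, hQ, hQq, hQI, hQv⟩ := exists_eq_bgSup hP hc hR
        (mixLaw_mem_stdSimplex hq hr t.2.1 t.2.2)
  simp only [Set.mem_preimage, Set.mem_Iic] at hu ⊢
  rw [← hQv]
  have ht0 : 0 ≤ (t : ℝ) := t.2.1
  have ht1 : (t : ℝ) ≤ 1 := t.2.2
  -- The point u n lies between t and one endpoint w n of the segment; s n is the weight of that
  -- endpoint.
  let s : ℕ → ℝ := fun n => if (u n : ℝ) ≤ t then (t - u n) / t else (u n - t) / (1 - t)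
  let w : ℕ → Y → ℝ := fun n => if (u n : ℝ) ≤ t then q else r
  have hw : ∀ n, w n ∈ stdSimplex ℝ Y := fun n => by simp only [w]; split_ifs <;> assumption
  have hs0 : ∀ n, 0 ≤ s n := fun n => by
    simp only [s]; split_ifs with h
    · exact div_nonneg (by linarith) ht0
    · exact div_nonneg (by linarith) (by linarith)
  have hs1 : ∀ n, s n ≤ 1 := fun n => by
    have h0 : 0 ≤ (u n : ℝ) := (u n).2.1
    have h1 : (u n : ℝ) ≤ 1 := (u n).2.2
    simp only [s]; split_ifs with h
    · exact div_le_one_of_le₀ (by linarith) ht0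
    · exact div_le_one_of_le₀ (by linarith) (by linarith)
  have hmix : ∀ n, mixLaw (s n) (mixLaw (t : ℝ) q r) (w n) = mixLaw (u n : ℝ) q r := by
    intro n
    have h0 : 0 ≤ (u n : ℝ) := (u n).2.1
    have h1 : (u n : ℝ) ≤ 1 := (u n).2.2
    ext y
    simp only [mixLaw, s, w]
    split_ifs with h
    · rcases ht0.eq_or_lt with ht | ht
      · have hu0 : (u n : ℝ) = 0 := le_antisymm (ht ▸ h) h0
        simp [← ht, hu0]
      · field_simp; ring
    · have : 0 < 1 - (t : ℝ) := by linarith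
      field_simp; ring
  have hut' : Tendsto (fun n => (u n : ℝ)) atTop (nhds t) :=
    (continuous_subtype_val.tendsto t).comp hut
  have hst : Tendsto s atTop (nhds 0) := by
    have hb : Tendsto (fun n => |(u n : ℝ) - t| * (1 / t + 1 / (1 - t))) atTop (nhds 0) := by
      have := ((hut'.sub_const (t : ℝ)).abs).mul_const (1 / (t : ℝ) + 1 / (1 - t))
      simpa using this
    refine squeeze_zero hs0 (fun n => ?_) hb
    have e1 : 0 ≤ 1 / (t : ℝ) := by positivity
    have e2 : 0 ≤ 1 / (1 - (t : ℝ)) := one_div_nonneg.2 (by linarith)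
    simp only [s]; split_ifs with h
    · rw [div_eq_mul_one_div, abs_sub_comm, abs_of_nonneg (by linarith : 0 ≤ (t : ℝ) - u n)]
      exact mul_le_mul_of_nonneg_left (by linarith) (by linarith)
    · rw [div_eq_mul_one_div, abs_of_nonneg (by linarith : 0 ≤ (u n : ℝ) - t)]
      exact mul_le_mul_of_nonneg_left (by linarith) (by linarith)
  let Qn : ℕ → X × Y → ℝ := fun n => mixLaw (s n) Q (prodLaw P (w n))
  have hQn : ∀ n, Qn n ∈ jointLaws Y P := fun n =>
    mixLaw_mem hQ (prodLaw_mem hP (hw n)) (hs0 n) (hs1 n)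
  have hQnt : Tendsto Qn atTop (nhds Q) := by
    rw [tendsto_pi_nhds]
    intro p
    have hd : Tendsto (fun n => Qn n p - Q p) atTop (nhds 0) := by
      have hb : Tendsto (fun n => s n * (P p.1 + Q p)) atTop (nhds 0) := by
        simpa using hst.mul_const (P p.1 + Q p)
      refine squeeze_zero_norm (fun n => ?_) hb
      have e1 : Qn n p - Q p = s n * (P p.1 * w n p.2 - Q p) := by
        simp only [Qn, mixLaw, prodLaw]; ring
      have hw1 : w n p.2 ≤ 1 := by
        rw [← (hw n).2]
        exact Finset.single_le_sum (fun y _ => (hw n).1 y) (Finset.mem_univ _)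
      have hw0 := (hw n).1 p.2
      have hP0 := hP.1 p.1
      have hQ0 := hQ.1 p
      rw [e1, Real.norm_eq_abs, abs_mul, abs_of_nonneg (hs0 n)]
      refine mul_le_mul_of_nonneg_left ?_ (hs0 n)
      rw [abs_le]
      constructor <;> nlinarith
    simpa using hd.add_const (Q p)
  have hlim := (continuousOn_bgVal hc R Q hQ).tendsto.comp
    (tendsto_nhdsWithin_iff.2 ⟨hQnt, Eventually.of_forall hQn⟩)
  refine le_of_tendsto hlim (Eventually.of_forall fun n => le_trans ?_ (hu n))
  have hm : margY (Qn n) = mixLaw (u n : ℝ) q r := by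
    rw [margY_mixLaw, margY_prodLaw hP, hQq, hmix]
  rw [← hm]
  refine le_bgSup hP (hQn n) ?_ hR
  refine (mutInfo_mixLaw_le hP hQ (hw n) (hs0 n) (hs1 n)).trans (le_trans ?_ hQI)
  exact mul_le_of_le_one_left (mutInfo_nonneg hP hQ) (by linarith [hs0 n])

theorem continuous_bgSup (hP : P ∈ stdSimplex ℝ X)
    (hc : ContinuousOn (supLik 𝒰) (jointLaws Y P)) {q r : Y → ℝ}
    (hq : q ∈ stdSimplex ℝ Y) (hr : r ∈ stdSimplex ℝ Y) :
    Continuous fun t : unitInterval => bgSup R P 𝒰 (mixLaw (t : ℝ) q r) := by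
  rcases le_or_gt R 0 with hR | hR
  · simp only [bgSup_eq_zero hR]; exact continuous_const
  · exact continuous_iff_lower_upperSemicontinuous.2
      ⟨lowerSemicontinuous_bgSup hP hc hR hq hr, upperSemicontinuous_bgSup hP hc hR hq hr⟩

end Background

/-! ### Comparison of the false-alarm and misdetection exponents. -/

section Exchange

variable {X Y : Type*} [Fintype X] [Fintype Y] {R : ℝ} {P : X → ℝ} {𝒰 𝒲 𝒱 : Set (DMC X Y)}

/-- The largest contribution to the sum of the likelihoods when, besides the typical codewords,
there are codewords with joint laws `Q₁` and `Q₂` with the output. -/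
def lvl (R : ℝ) (P : X → ℝ) (𝒰 : Set (DMC X Y)) (Q₁ Q₂ : X × Y → ℝ) : ℝ :=
  max (max (supLik 𝒰 Q₁) (supLik 𝒰 Q₂)) (bgSup R P 𝒰 (margY Q₁))

theorem lvl_nonneg (R : ℝ) (P : X → ℝ) (𝒰 : Set (DMC X Y)) (Q₁ Q₂ : X × Y → ℝ) :
    0 ≤ lvl R P 𝒰 Q₁ Q₂ :=
  (supLik_nonneg _ _).trans ((le_max_left _ _).trans (le_max_left _ _))

/-- `Q` is one of the two given joint laws or the joint law of a typical codeword. -/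
def Occurs (R : ℝ) (P : X → ℝ) (Q₁ Q₂ Q : X × Y → ℝ) : Prop :=
  Q = Q₁ ∨ Q = Q₂ ∨ (mutInfo P Q ≤ R ∧ 0 < R)

theorem rateGap_nonneg (R : ℝ) (P : X → ℝ) (Q : X × Y → ℝ) : 0 ≤ rateGap R P Q := le_max_right _ _

theorem mutInfo_add_rateGap (R : ℝ) (P : X → ℝ) (Q : X × Y → ℝ) :
    mutInfo P Q + rateGap R P Q = R + max (mutInfo P Q - R) 0 := by
  unfold rateGap
  rcases le_total (mutInfo P Q) R with h | h
  · rw [max_eq_left (by linarith), max_eq_right (by linarith)]; ring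
  · rw [max_eq_right (by linarith), max_eq_left (by linarith)]; ring

/-- A law below the rate is part of the background, where its multiplicity exp(R-I) is already
counted; above the rate the multiplicity is one. -/
theorem mul_exp_rateGap_le_lvl (hP : P ∈ stdSimplex ℝ X) {Q₁ Q₂ Q : X × Y → ℝ}
    (hQ : Q ∈ jointLaws Y P) (hm : margY Q = margY Q₁) (h : Occurs R P Q₁ Q₂ Q) :
    supLik 𝒰 Q * Real.exp (rateGap R P Q) ≤ lvl R P 𝒰 Q₁ Q₂ := by
  by_cases h' : mutInfo P Q ≤ R ∧ 0 < R
  · have : rateGap R P Q = R - mutInfo P Q := max_eq_left (by linarith [h'.1])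
    rw [this]
    refine le_trans ?_ (le_max_right _ _)
    rw [← hm]
    exact le_bgSup hP hQ h'.1 h'.2
  · have : rateGap R P Q = 0 := by
      refine max_eq_right ?_
      by_contra hlt
      exact h' ⟨by linarith, by have := mutInfo_nonneg hP hQ; linarith⟩
    rw [this, Real.exp_zero, mul_one]
    rcases h with rfl | rfl | h
    · exact (le_max_left _ _).trans (le_max_left _ _)
    · exact (le_max_right _ _).trans (le_max_left _ _)
    · exact absurd h h'

theorem le_lvl_of_occurs (hP : P ∈ stdSimplex ℝ X) {Q₁ Q₂ Q : X × Y → ℝ}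
    (hQ : Q ∈ jointLaws Y P) (hm : margY Q = margY Q₁) (h : Occurs R P Q₁ Q₂ Q) :
    supLik 𝒰 Q ≤ lvl R P 𝒰 Q₁ Q₂ :=
  le_trans (le_mul_of_one_le_right (supLik_nonneg _ _)
    (Real.one_le_exp (rateGap_nonneg _ _ _))) (mul_exp_rateGap_le_lvl hP hQ hm h)

theorem exists_eq_lvl (hP : P ∈ stdSimplex ℝ X) (hc : ContinuousOn (supLik 𝒰) (jointLaws Y P))
    {Q₁ Q₂ : X × Y → ℝ} (hQ₁ : Q₁ ∈ jointLaws Y P) (hQ₂ : Q₂ ∈ jointLaws Y P)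
    (hm : margY Q₂ = margY Q₁) :
    ∃ Q ∈ jointLaws Y P, margY Q = margY Q₁ ∧ Occurs R P Q₁ Q₂ Q ∧
      supLik 𝒰 Q * Real.exp (rateGap R P Q) = lvl R P 𝒰 Q₁ Q₂ := by
  have key : ∀ Q ∈ jointLaws Y P, margY Q = margY Q₁ → Occurs R P Q₁ Q₂ Q →
      lvl R P 𝒰 Q₁ Q₂ ≤ supLik 𝒰 Q → supLik 𝒰 Q * Real.exp (rateGap R P Q) = lvl R P 𝒰 Q₁ Q₂ :=
    fun Q hQ hm ho h => le_antisymm (mul_exp_rateGap_le_lvl hP hQ hm ho) (h.trans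
      (le_mul_of_one_le_right (supLik_nonneg _ _) (Real.one_le_exp (rateGap_nonneg _ _ _))))
  by_cases h1 : lvl R P 𝒰 Q₁ Q₂ ≤ supLik 𝒰 Q₁
  · exact ⟨Q₁, hQ₁, rfl, Or.inl rfl, key _ hQ₁ rfl (Or.inl rfl) h1⟩
  by_cases h2 : lvl R P 𝒰 Q₁ Q₂ ≤ supLik 𝒰 Q₂
  · exact ⟨Q₂, hQ₂, hm, Or.inr (Or.inl rfl), key _ hQ₂ hm (Or.inr (Or.inl rfl)) h2⟩
  have h3 : lvl R P 𝒰 Q₁ Q₂ = bgSup R P 𝒰 (margY Q₁) := by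
    refine le_antisymm ?_ (le_max_right _ _)
    rcases le_max_iff.1 (le_refl (lvl R P 𝒰 Q₁ Q₂)) with h | h
    · rcases le_max_iff.1 h with h | h
      · exact absurd h h1
      · exact absurd h h2
    · exact h
  have hR : 0 < R := by
    by_contra hR
    rw [h3, bgSup_eq_zero (not_lt.1 hR)] at h1
    exact h1 (supLik_nonneg _ _)
  obtain ⟨Q, hQ, hQm, hQI, hQv⟩ := exists_eq_bgSup hP hc hR (margY_mem hP hQ₁)
  refine ⟨Q, hQ, hQm, Or.inr (Or.inr ⟨hQI, hR⟩), ?_⟩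
  have : rateGap R P Q = R - mutInfo P Q := max_eq_left (by linarith)
  rw [h3, this, hQv]

/-- The detector compares total levels only. Hence any law that occurs can play the sent word,
provided the second law attains the level of 𝒱. -/
theorem mem_setK_of_lvl_le (hP : P ∈ stdSimplex ℝ X) (h𝒲 : 𝒲.Nonempty) (h𝒱 : 𝒱.Nonempty)
    (hc : ContinuousOn (supLik 𝒲) (jointLaws Y P)) {α : ℝ} {Q₁ Q₂ Qs Qd : X × Y → ℝ}
    (hQ₁ : Q₁ ∈ jointLaws Y P) (hle : Real.exp α * lvl R P 𝒲 Q₁ Q₂ ≤ lvl R P 𝒱 Q₁ Q₂)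
    (hQs : Qs ∈ jointLaws Y P) (hms : margY Qs = margY Q₁) (hs : Occurs R P Q₁ Q₂ Qs)
    (hQd : Qd ∈ jointLaws Y P) (hmd : margY Qd = margY Q₁) (hd : Occurs R P Q₁ Q₂ Qd)
    (hv : supLik 𝒱 Qd * Real.exp (rateGap R P Qd) = lvl R P 𝒱 Q₁ Q₂) :
    (Qs, Qd) ∈ setK R α P 𝒲 𝒱 := by
  have hα := (Real.exp_pos α).le
  rw [mem_setK_iff h𝒲 h𝒱]
  refine ⟨hQs, hQd, hmd.trans hms.symm, ?_, ?_, ?_⟩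
  · have h1 := mul_le_mul_of_nonneg_left (mul_exp_rateGap_le_lvl (𝒰 := 𝒲) hP hQd hmd hd) hα
    have h2 := h1.trans hle
    rw [← hv, ← mul_assoc] at h2
    exact le_of_mul_le_mul_right h2 (Real.exp_pos _)
  · rw [hv]
    exact (mul_le_mul_of_nonneg_left (le_lvl_of_occurs hP hQs hms hs) hα).trans hle
  · rw [hv, hms, backgroundLe_iff hP hc (margY_mem hP hQ₁) (lvl_nonneg _ _ _ _ _)]
    exact (mul_le_mul_of_nonneg_left (le_max_right _ _) hα).trans hle

theorem mem_setJ_of_lvl_le (hP : P ∈ stdSimplex ℝ X) (h𝒲 : 𝒲.Nonempty) (h𝒱 : 𝒱.Nonempty)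
    (hc : ContinuousOn (supLik 𝒲) (jointLaws Y P)) {α : ℝ} {Q₁ Q₂ Q : X × Y → ℝ}
    (hQ₁ : Q₁ ∈ jointLaws Y P) (hle : Real.exp α * lvl R P 𝒲 Q₁ Q₂ ≤ lvl R P 𝒱 Q₁ Q₂)
    (hQ : Q ∈ jointLaws Y P) (hm : margY Q = margY Q₁) (ho : Occurs R P Q₁ Q₂ Q)
    (hv : supLik 𝒱 Q * Real.exp (rateGap R P Q) = lvl R P 𝒱 Q₁ Q₂) (hI : R ≤ mutInfo P Q) :
    Q ∈ setJ R α P 𝒲 𝒱 := by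
  have hα := (Real.exp_pos α).le
  have hgap : rateGap R P Q = 0 := max_eq_right (by linarith)
  rw [hgap, Real.exp_zero, mul_one] at hv
  rw [mem_setJ_iff h𝒲 h𝒱]
  refine ⟨hQ, ?_, ?_⟩
  · rw [hv]
    exact (mul_le_mul_of_nonneg_left (le_lvl_of_occurs hP hQ hm ho) hα).trans hle
  · rw [hv, hm, backgroundLe_iff hP hc (margY_mem hP hQ₁) (lvl_nonneg _ _ _ _ _)]
    exact (mul_le_mul_of_nonneg_left (le_max_right _ _) hα).trans hle

theorem exists_condDiv_lt (h𝒰 : 𝒰.Nonempty) {Q : X × Y → ℝ} (hQ : Q ∈ jointLaws Y P) {d : ℝ}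
    (h : Real.exp (-d) < supLik 𝒰 Q * Real.exp (entropy Q - entropy P)) :
    ∃ U ∈ 𝒰, condDiv P U Q < d := by
  have : Nonempty 𝒰 := h𝒰.to_subtype
  rw [← div_lt_iff₀ (Real.exp_pos _)] at h
  obtain ⟨U, hU⟩ := exists_lt_of_lt_ciSup h
  exact ⟨U, U.2, condDiv_lt_of hQ _ ((div_lt_iff₀ (Real.exp_pos _)).1 hU)⟩

theorem teExponentWorst_le_condDiv {α : ℝ} {Q : X × Y → ℝ} (hQ : Q ∈ setJ R α P 𝒲 𝒱)
    {W : DMC X Y} (hW : W ∈ 𝒲) : teExponentWorst R α P 𝒲 𝒱 ≤ condDiv P W Q :=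
  (iInf₂_le W hW).trans ((min_le_left _ _).trans (iInf₂_le Q hQ))

theorem teExponentWorst_le_condDiv_add {α : ℝ} {Qt Qb : X × Y → ℝ}
    (h : (Qt, Qb) ∈ setK R α P 𝒲 𝒱) {W : DMC X Y} (hW : W ∈ 𝒲) :
    teExponentWorst R α P 𝒲 𝒱 ≤
      condDiv P W Qt + ((max (mutInfo P Qb - R) 0 : ℝ) : EReal) :=
  (iInf₂_le W hW).trans ((min_le_right _ _).trans (iInf₂_le (Qt, Qb) h))

/-- A configuration on the boundary of the rejection region costs `α` more for the false alarm than
for the misdetection. -/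
theorem teExponentWorst_le_of_lvl_eq (hP : P ∈ stdSimplex ℝ X) (h𝒲 : 𝒲.Nonempty)
    (hc𝒲 : ContinuousOn (supLik 𝒲) (jointLaws Y P))
    (hc𝒱 : ContinuousOn (supLik 𝒱) (jointLaws Y P)) {α : ℝ} {Q₁ Q₂ : X × Y → ℝ}
    (hQ₁ : Q₁ ∈ jointLaws Y P) (hQ₂ : Q₂ ∈ jointLaws Y P) (hm : margY Q₂ = margY Q₁)
    (heq : Real.exp α * lvl R P 𝒲 Q₁ Q₂ = lvl R P 𝒱 Q₁ Q₂) {V : DMC X Y} (hV : V ∈ 𝒱)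
    {c d : ℝ} (hd : condDiv P V Q₁ ≤ d)
    (hcd : (Q₂ = Q₁ ∧ d ≤ c) ∨ d + max (mutInfo P Q₂ - R) 0 ≤ c) :
    teExponentWorst R α P 𝒲 𝒱 ≤ ((c + α : ℝ) : EReal) := by
  have hlik : 0 < likR V Q₁ := by
    rcases (likR_nonneg V Q₁).eq_or_lt with h | h
    · rw [condDiv_of_eq_zero h.symm] at hd
      exact absurd hd (not_le.2 (EReal.coe_lt_top d))
    · exact h
  rw [condDiv_of_pos hQ₁ V hlik, EReal.coe_le_coe_iff] at hd
  have hsup : likR V Q₁ ≤ supLik 𝒱 Q₁ := likR_le_supLik hV hQ₁.1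
  have hocc : Occurs R P Q₁ Q₂ Q₁ := Or.inl rfl
  have hL𝒱 : 0 < lvl R P 𝒱 Q₁ Q₂ :=
    (hlik.trans_le hsup).trans_le (le_lvl_of_occurs hP hQ₁ rfl hocc)
  have hL𝒲 : 0 < lvl R P 𝒲 Q₁ Q₂ := by
    rw [← heq] at hL𝒱
    exact (mul_pos_iff_of_pos_left (Real.exp_pos α)).1 hL𝒱
  obtain ⟨Qs, hQs, hms, hos, hvs⟩ := exists_eq_lvl (R := R) hP hc𝒲 hQ₁ hQ₂ hm
  obtain ⟨Qd, hQd, hmd, hod, hvd⟩ := exists_eq_lvl (R := R) hP hc𝒱 hQ₁ hQ₂ hm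
  have has : 0 < supLik 𝒲 Qs := by
    rw [← hvs] at hL𝒲
    exact (mul_pos_iff_of_pos_right (Real.exp_pos _)).1 hL𝒲
  have hlog : Real.log (lvl R P 𝒱 Q₁ Q₂) = α + Real.log (lvl R P 𝒲 Q₁ Q₂) := by
    rw [← heq, Real.log_mul (Real.exp_pos α).ne' hL𝒲.ne', Real.log_exp]
  have hlogs : Real.log (supLik 𝒲 Qs) + rateGap R P Qs = Real.log (lvl R P 𝒲 Q₁ Q₂) := by
    rw [← hvs, Real.log_mul has.ne' (Real.exp_pos _).ne', Real.log_exp]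
  have hlog₁ : Real.log (likR V Q₁) + rateGap R P Q₁ ≤ Real.log (lvl R P 𝒱 Q₁ Q₂) := by
    rw [← Real.log_exp (rateGap R P Q₁), ← Real.log_mul hlik.ne' (Real.exp_pos _).ne']
    refine Real.log_le_log (by positivity) (le_trans ?_ (mul_exp_rateGap_le_lvl hP hQ₁ rfl hocc))
    exact mul_le_mul_of_nonneg_right hsup (Real.exp_pos _).le
  have hI₁ := mutInfo_eq hQ₁
  have hIs := mutInfo_eq hQs
  rw [hms] at hIs
  have hg₁ := mutInfo_add_rateGap R P Q₁
  have hgs := mutInfo_add_rateGap R P Qs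
  -- As Qs attains the level of 𝒲, the divergence H(P) - H(Qs) - f_𝒲(Qs) becomes R + [I(Qs)-R]₊ -
  -- H(q) - log of the level, with q the output marginal.
  have hcost : ∀ d' : ℝ, R + max (mutInfo P Qs - R) 0 - entropy (margY Q₁) -
      Real.log (lvl R P 𝒲 Q₁ Q₂) < d' → ∃ W ∈ 𝒲, condDiv P W Qs < d' := by
    intro d' hd'
    refine exists_condDiv_lt h𝒲 hQs ?_
    rw [← Real.exp_log has, ← Real.exp_add, Real.exp_lt_exp]
    linarith
  have e1 : 0 ≤ max (mutInfo P Q₁ - R) 0 := le_max_right _ _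
  have e2 : 0 ≤ max (mutInfo P Q₂ - R) 0 := le_max_right _ _
  -- The same computation for V and Q₁ gives a lower bound on d in terms of the level of 𝒱, which
  -- exceeds that of 𝒲 by exactly α in the exponent.
  have hd₁ : R + max (mutInfo P Q₁ - R) 0 - entropy (margY Q₁) -
      Real.log (lvl R P 𝒲 Q₁ Q₂) ≤ d + α := by linarith
  have hzero : ∀ Q : X × Y → ℝ, mutInfo P Q ≤ R → max (mutInfo P Q - R) 0 = 0 :=
    fun Q h => max_eq_right (by linarith)
  refine EReal.le_of_forall_lt_iff_le.1 fun z hz => ?_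
  rw [EReal.coe_lt_coe_iff] at hz
  -- One law at or above the rate in both roles belongs to E_A. Otherwise E_B applies: Qs and Qd are
  -- different occurring laws or have no penalty, so the penalties of Q₁ and Q₂ are each charged at
  -- most once.
  by_cases hsd : Qs = Qd ∧ R ≤ mutInfo P Qs
  · have hJ : Qs ∈ setJ R α P 𝒲 𝒱 :=
      mem_setJ_of_lvl_le hP h𝒲 ⟨V, hV⟩ hc𝒲 hQ₁ heq.le hQs hms hos (by rw [hsd.1, hvd]) hsd.2
    obtain ⟨W, hW, hlt⟩ := hcost z (by
      rcases hos with rfl | rfl | h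
      · rcases hcd with h | h <;> linarith
      · rcases hcd with h | h
        · rw [h.1] at hd₁ ⊢; linarith
        · linarith
      · rw [hzero _ h.1]
        rcases hcd with h | h <;> linarith)
    exact (teExponentWorst_le_condDiv hJ hW).trans hlt.le
  · have hK : (Qs, Qd) ∈ setK R α P 𝒲 𝒱 :=
      mem_setK_of_lvl_le hP h𝒲 ⟨V, hV⟩ hc𝒲 hQ₁ heq.le hQs hms hos hQd hmd hod hvd
    have hsum : max (mutInfo P Qs - R) 0 + max (mutInfo P Qd - R) 0 + d ≤
        c + max (mutInfo P Q₁ - R) 0 := by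
      by_cases hsd' : Qs = Qd
      · have hlt : mutInfo P Qs ≤ R := by
          by_contra h
          exact hsd ⟨hsd', (not_le.1 h).le⟩
        rw [← hsd', hzero _ hlt]
        rcases hcd with h | h <;> linarith
      · rcases hcd with ⟨rfl, h⟩ | h
        · rcases hos with rfl | rfl | h1 <;> rcases hod with rfl | rfl | h2 <;>
            first
            | exact absurd rfl hsd'
            | (try rw [hzero _ h1.1]
               try rw [hzero _ h2.1]
               linarith)
        · rcases hos with rfl | rfl | h1 <;> rcases hod with rfl | rfl | h2 <;>
            first
            | exact absurd rfl hsd'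
            | (try rw [hzero _ h1.1]
               try rw [hzero _ h2.1]
               linarith)
    obtain ⟨W, hW, hlt⟩ := hcost (z - max (mutInfo P Qd - R) 0) (by linarith)
    refine (teExponentWorst_le_condDiv_add hK hW).trans ?_
    calc condDiv P W Qs + ((max (mutInfo P Qd - R) 0 : ℝ) : EReal)
        ≤ ((z - max (mutInfo P Qd - R) 0 : ℝ) : EReal) +
          ((max (mutInfo P Qd - R) 0 : ℝ) : EReal) := by gcongr
      _ = z := by rw [← EReal.coe_add]; congr 1; ring

/-- The law of the channel and a typical codeword cost nothing. -/
theorem teExponentWorst_le_of_lvl_le (hP : P ∈ stdSimplex ℝ X) (h𝒱 : 𝒱.Nonempty)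
    (hc𝒲 : ContinuousOn (supLik 𝒲) (jointLaws Y P))
    (hc𝒱 : ContinuousOn (supLik 𝒱) (jointLaws Y P)) {α : ℝ} {Q₁ Q₂ : X × Y → ℝ}
    (hQ₁ : Q₁ ∈ jointLaws Y P) (hQ₂ : Q₂ ∈ jointLaws Y P) (hm : margY Q₂ = margY Q₁)
    (hle : Real.exp α * lvl R P 𝒲 Q₁ Q₂ ≤ lvl R P 𝒱 Q₁ Q₂) {W : DMC X Y} (hW : W ∈ 𝒲)
    (hI : Q₂ = Q₁ ∨ mutInfo P Q₂ ≤ R) :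
    teExponentWorst R α P 𝒲 𝒱 ≤ condDiv P W Q₁ := by
  obtain ⟨Qd, hQd, hmd, hod, hvd⟩ := exists_eq_lvl (R := R) hP hc𝒱 hQ₁ hQ₂ hm
  by_cases hI' : mutInfo P Qd ≤ R
  · have hK : (Q₁, Qd) ∈ setK R α P 𝒲 𝒱 :=
      mem_setK_of_lvl_le hP ⟨W, hW⟩ h𝒱 hc𝒲 hQ₁ hle hQ₁ rfl (Or.inl rfl) hQd hmd hod hvd
    refine (teExponentWorst_le_condDiv_add hK hW).trans ?_
    rw [max_eq_right (by linarith), EReal.coe_zero, add_zero]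
  · have hd : Qd = Q₁ := by
      rcases hod with h | h | h
      · exact h
      · rcases hI with h2 | h2
        · exact h.trans h2
        · exact absurd (h ▸ h2) hI'
      · exact absurd h.1 hI'
    subst hd
    exact teExponentWorst_le_condDiv
      (mem_setJ_of_lvl_le hP ⟨W, hW⟩ h𝒱 hc𝒲 hQ₁ hle hQ₁ rfl (Or.inl rfl) hvd (not_le.1 hI').le) hW

theorem continuous_lvl_mixLaw (hP : P ∈ stdSimplex ℝ X)
    (hc : ContinuousOn (supLik 𝒰) (jointLaws Y P)) {Q₁ Q₂ R₁ R₂ : X × Y → ℝ}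
    (hQ₁ : Q₁ ∈ jointLaws Y P) (hQ₂ : Q₂ ∈ jointLaws Y P) (hR₁ : R₁ ∈ jointLaws Y P)
    (hR₂ : R₂ ∈ jointLaws Y P) :
    Continuous fun t : unitInterval =>
      lvl R P 𝒰 (mixLaw (t : ℝ) Q₁ R₁) (mixLaw (t : ℝ) Q₂ R₂) := by
  have h : ∀ {Q Q' : X × Y → ℝ}, Q ∈ jointLaws Y P → Q' ∈ jointLaws Y P →
      Continuous fun t : unitInterval => supLik 𝒰 (mixLaw (t : ℝ) Q Q') := fun {Q Q'} hQ hQ' =>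
    hc.comp_continuous ((continuous_mixLaw Q Q').comp continuous_subtype_val)
      fun t => mixLaw_mem hQ hQ' t.2.1 t.2.2
  unfold lvl
  simp_rw [margY_mixLaw]
  exact ((h hQ₁ hR₁).max (h hQ₂ hR₂)).max
    (continuous_bgSup hP hc (margY_mem hP hQ₁) (margY_mem hP hR₁))

theorem lvl_le_of_mem_setJ (hP : P ∈ stdSimplex ℝ X) (h𝒲 : 𝒲.Nonempty) (h𝒱 : 𝒱.Nonempty)
    (hc : ContinuousOn (supLik 𝒲) (jointLaws Y P)) {α : ℝ} {Q : X × Y → ℝ}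
    (h : Q ∈ setJ R α P 𝒲 𝒱) : Real.exp α * lvl R P 𝒲 Q Q ≤ lvl R P 𝒱 Q Q := by
  obtain ⟨hQ, h1, h2⟩ := (mem_setJ_iff h𝒲 h𝒱).1 h
  rw [backgroundLe_iff hP hc (margY_mem hP hQ) (supLik_nonneg _ _)] at h2
  have h3 : supLik 𝒱 Q ≤ lvl R P 𝒱 Q Q := (le_max_left _ _).trans (le_max_left _ _)
  rw [lvl, max_self, mul_max_of_nonneg _ _ (Real.exp_pos α).le]
  exact max_le (h1.trans h3) (h2.trans h3)

theorem lvl_le_of_mem_setK (hP : P ∈ stdSimplex ℝ X) (h𝒲 : 𝒲.Nonempty) (h𝒱 : 𝒱.Nonempty)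
    (hc : ContinuousOn (supLik 𝒲) (jointLaws Y P)) {α : ℝ} {Qt Qb : X × Y → ℝ}
    (h : (Qt, Qb) ∈ setK R α P 𝒲 𝒱) :
    Real.exp α * lvl R P 𝒲 Qt Qb ≤ lvl R P 𝒱 Qt Qb := by
  obtain ⟨hQt, hQb, hm, h1, h2, h3⟩ := (mem_setK_iff h𝒲 h𝒱).1 h
  rw [backgroundLe_iff hP hc (margY_mem hP hQt)
    (mul_nonneg (supLik_nonneg _ _) (Real.exp_pos _).le)] at h3
  have h4 : supLik 𝒱 Qb * Real.exp (rateGap R P Qb) ≤ lvl R P 𝒱 Qt Qb :=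
    mul_exp_rateGap_le_lvl hP hQb hm (Or.inr (Or.inl rfl))
  rw [lvl, mul_max_of_nonneg _ _ (Real.exp_pos α).le, mul_max_of_nonneg _ _ (Real.exp_pos α).le]
  exact max_le (max_le (h2.trans h4) (h1.trans ((le_max_right _ _).trans (le_max_left _ _))))
    (h3.trans h4)

/-- If the misdetection exponent is not trivial, then it is at least the false-alarm exponent
minus `α`. -/
theorem teExponentWorst_le_add_of_pos (hP : P ∈ stdSimplex ℝ X) (hR : 0 ≤ R) (h𝒲 : 𝒲.Nonempty)
    (h𝒱 : 𝒱.Nonempty) (hc𝒲 : ContinuousOn (supLik 𝒲) (jointLaws Y P))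
    (hc𝒱 : ContinuousOn (supLik 𝒱) (jointLaws Y P)) {α : ℝ}
    (hpos : 0 < teExponentWorst R (-α) P 𝒱 𝒲) {c : ℝ}
    (hlt : teExponentWorst R (-α) P 𝒱 𝒲 < c) :
    teExponentWorst R α P 𝒲 𝒱 ≤ ((c + α : ℝ) : EReal) := by
  -- Intermediate value theorem on the segment from a feasible configuration of the exchanged
  -- problem to the law of the channel V.
  have path : ∀ V ∈ 𝒱, ∀ Q₁ ∈ jointLaws Y P, ∀ Q₂ ∈ jointLaws Y P, ∀ R₂ ∈ jointLaws Y P,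
      margY Q₂ = margY Q₁ → margY R₂ = margY (chanLaw P V) →
      Real.exp (-α) * lvl R P 𝒱 Q₁ Q₂ ≤ lvl R P 𝒲 Q₁ Q₂ → (∃ d : ℝ, condDiv P V Q₁ ≤ d) →
      (R₂ = chanLaw P V ∨ mutInfo P R₂ ≤ R) → ∃ t : unitInterval,
        Real.exp α * lvl R P 𝒲 (mixLaw (t : ℝ) Q₁ (chanLaw P V)) (mixLaw (t : ℝ) Q₂ R₂) =
          lvl R P 𝒱 (mixLaw (t : ℝ) Q₁ (chanLaw P V)) (mixLaw (t : ℝ) Q₂ R₂) := by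
    rintro V hV Q₁ hQ₁ Q₂ hQ₂ R₂ hR₂ hm hmR hstart ⟨d, hd⟩ hend
    have hR₁ := chanLaw_mem hP V
    have hf := (continuous_lvl_mixLaw (R := R) hP hc𝒱 hQ₁ hQ₂ hR₁ hR₂).const_mul (Real.exp (-α))
    have hg := continuous_lvl_mixLaw (R := R) hP hc𝒲 hQ₁ hQ₂ hR₁ hR₂
    have m0 : ∀ Q Q' : X × Y → ℝ, mixLaw ((0 : unitInterval) : ℝ) Q Q' = Q := fun Q Q' => by
      ext; simp [mixLaw]
    have m1 : ∀ Q Q' : X × Y → ℝ, mixLaw ((1 : unitInterval) : ℝ) Q Q' = Q' := fun Q Q' => by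
      ext; simp [mixLaw]
    obtain ⟨t, ht⟩ := intermediate_value_univ₂ (a := (0 : unitInterval)) (b := 1) hf hg
      (by simpa only [m0] using hstart) (by
        simp only [m1]
        -- Were the endpoint still feasible, its zero divergence would contradict `hpos`.
        by_contra hcon
        have h1 := teExponentWorst_le_of_lvl_le hP h𝒲 hc𝒱 hc𝒲 hR₁ hR₂ hmR (not_le.1 hcon).le hV
          hend
        have h2 := condDiv_mixLaw_le hP hQ₁ V zero_le_one le_rfl hd
        have h3 : mixLaw 1 Q₁ (chanLaw P V) = chanLaw P V := by ext; simp [mixLaw]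
        rw [h3] at h2
        have h4 := hpos.trans_le (h1.trans h2)
        simp at h4)
    refine ⟨t, ?_⟩
    rw [← ht, ← mul_assoc, ← Real.exp_add, add_neg_cancel, Real.exp_zero, one_mul]
  have hmR : ∀ {Q₁ Q₂ R₁ R₂ : X × Y → ℝ}, margY Q₂ = margY Q₁ → margY R₂ = margY R₁ → ∀ t : ℝ,
      margY (mixLaw t Q₂ R₂) = margY (mixLaw t Q₁ R₁) := fun h1 h2 t => by
    rw [margY_mixLaw, margY_mixLaw, h1, h2]
  obtain ⟨V, hV, hVlt⟩ : ∃ V ∈ 𝒱, teExponent R (-α) P V 𝒱 𝒲 < c := by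
    simpa [teExponentWorst, iInf_lt_iff] using hlt
  have hR₁ := chanLaw_mem hP V
  have hle1 : ∀ {a t : ℝ}, 0 ≤ a → 0 ≤ t → (1 - t) * a ≤ a := fun ha ht => by nlinarith
  have hreal : ∀ {Q : X × Y → ℝ}, Q ∈ jointLaws Y P → condDiv P V Q < ⊤ →
      ∃ d : ℝ, 0 ≤ d ∧ condDiv P V Q = d := by
    intro Q hQ htop
    have h0 := condDiv_nonneg hP hQ V
    lift condDiv P V Q to ℝ using ⟨htop.ne, (lt_of_lt_of_le EReal.bot_lt_zero h0).ne'⟩ with d hd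
    exact ⟨d, by exact_mod_cast h0, rfl⟩
  rcases min_lt_iff.1 hVlt with h | h
  · obtain ⟨Q, hQJ, hQc⟩ : ∃ Q ∈ setJ R (-α) P 𝒱 𝒲, condDiv P V Q < c := by
      simpa only [expA, iInf_lt_iff, exists_prop] using h
    have hQ := hQJ.1
    obtain ⟨d, hd0, hd⟩ := hreal hQ (hQc.trans (EReal.coe_lt_top c))
    rw [hd, EReal.coe_lt_coe_iff] at hQc
    -- In E_A both laws coincide and move together to the law of the channel.
    obtain ⟨t, ht⟩ := path V hV Q hQ Q hQ _ hR₁ rfl rfl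
      (lvl_le_of_mem_setJ hP h𝒱 h𝒲 hc𝒱 hQJ) ⟨d, hd.le⟩ (Or.inl rfl)
    have hmem := mixLaw_mem hQ hR₁ t.2.1 t.2.2
    refine teExponentWorst_le_of_lvl_eq hP h𝒲 hc𝒲 hc𝒱 hmem hmem rfl ht hV
      (condDiv_mixLaw_le hP hQ V t.2.1 t.2.2 hd.le) (Or.inl ⟨rfl, ?_⟩)
    exact (hle1 hd0 t.2.1).trans hQc.le
  · obtain ⟨⟨Qt, Qb⟩, hK, hQc⟩ : ∃ p ∈ setK R (-α) P 𝒱 𝒲, condDiv P V p.1 +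
        ((max (mutInfo P p.2 - R) 0 : ℝ) : EReal) < c := by
      simpa only [expB, iInf_lt_iff, exists_prop] using h
    have hQt : Qt ∈ jointLaws Y P := hK.1
    have hQb : Qb ∈ jointLaws Y P := hK.2.1
    have hm : margY Qb = margY Qt := hK.2.2.1
    simp only at hQc
    have htop : condDiv P V Qt < ⊤ := by
      by_contra htop
      rw [not_lt_top_iff.1 htop, EReal.top_add_coe] at hQc
      exact absurd hQc (not_lt.2 le_top)
    obtain ⟨d, hd0, hd⟩ := hreal hQt htop
    rw [hd, ← EReal.coe_add, EReal.coe_lt_coe_iff] at hQc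
    have hq := margY_mem hP hR₁
    have hR₂ := prodLaw_mem hP hq
    -- In E_B the competing law moves to the product law with the same output marginal, so its
    -- information, and with it the penalty, does not grow.
    obtain ⟨t, ht⟩ := path V hV Qt hQt Qb hQb _ hR₂ hm (margY_prodLaw hP _)
      (lvl_le_of_mem_setK hP h𝒱 h𝒲 hc𝒱 hK) ⟨d, hd.le⟩
      (Or.inr ((mutInfo_prodLaw hP hq).trans hR))
    refine teExponentWorst_le_of_lvl_eq hP h𝒲 hc𝒲 hc𝒱 (mixLaw_mem hQt hR₁ t.2.1 t.2.2)
      (mixLaw_mem hQb hR₂ t.2.1 t.2.2) (hmR hm (margY_prodLaw hP _) t) ht hV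
      (condDiv_mixLaw_le hP hQt V t.2.1 t.2.2 hd.le) (Or.inr ?_)
    have h1 : max (mutInfo P (mixLaw (t : ℝ) Qb (prodLaw P (margY (chanLaw P V)))) - R) 0 ≤
        max (mutInfo P Qb - R) 0 := by
      refine max_le_max_right _ (sub_le_sub_right ?_ _)
      exact (mutInfo_mixLaw_le hP hQb hq t.2.1 t.2.2).trans (hle1 (mutInfo_nonneg hP hQb) t.2.1)
    have h2 := hle1 hd0 t.2.1
    linarith

end Exchange

/-! ### Codes with typical type enumerators. -/

section GoodCodes

open Classical

variable {X Y : Type*} [Fintype X] [Fintype Y] {n M : ℕ}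

/-- The probability that a random sequence of type `rowCnt K` has joint type `K` with a given
sequence of type `colCnt K`. -/
def shellDens (n : ℕ) (K : X × Y → ℕ) : ℝ :=
  (typeClass n K).card / ((typeClass n (rowCnt K)).card * (typeClass n (colCnt K)).card)

/-- The type enumerator: the number of codewords that have joint type `K` with `y`. -/
def enumCnt (x : Fin M → Fin n → X) (y : Fin n → Y) (K : X × Y → ℕ) : ℕ :=
  (Finset.univ.filter fun m => jointCnt (x m) y = K).card

/-- The number of ordered pairs of different codewords with joint types `K` and `K'` with `y`. -/
def enumPairCnt (x : Fin M → Fin n → X) (y : Fin n → Y) (K K' : X × Y → ℕ) : ℕ :=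
  (Finset.univ.filter fun m : Fin M × Fin M =>
    m.1 ≠ m.2 ∧ jointCnt (x m.1) y = K ∧ jointCnt (x m.2) y = K').card

/-- A code of composition `k` whose type enumerators are, up to the factor `Λ`, not far from their
expectations for a random code. -/
structure GoodCode (Y : Type*) [Fintype Y] (k : X → ℕ) (Λ : ℝ) (x : Fin M → Fin n → X) : Prop where
  cnt_eq : ∀ m, cnt (x m) = k
  enum_le : ∀ (y : Fin n → Y) (K : X × Y → ℕ), rowCnt K = k → colCnt K = cnt y →
    (enumCnt x y K : ℝ) ≤ 2 * Λ * max 1 (M * shellDens n K)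
  le_enum : ∀ (y : Fin n → Y) (K : X × Y → ℕ), rowCnt K = k → colCnt K = cnt y →
    Λ ≤ M * shellDens n K → M * shellDens n K / Λ ≤ enumCnt x y K
  pair_le : ∀ K K' : X × Y → ℕ, rowCnt K = k → rowCnt K' = k → colCnt K' = colCnt K →
    ∑ y ∈ typeClass n (colCnt K), (enumPairCnt x y K K' : ℝ) ≤
      Λ * M ^ 2 * ((typeClass n (colCnt K)).card * (shellDens n K * shellDens n K'))

theorem le_of_sum_eq {A : Type*} [Fintype A] {K : A → ℕ} (h : ∑ a, K a = n) (a : A) : K a ≤ n := by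
  rw [← h]; exact Finset.single_le_sum (fun _ _ => Nat.zero_le _) (Finset.mem_univ a)

/-- The tables of counts with entries at most `n`. -/
abbrev Table (X Y : Type*) (n : ℕ) : Type _ := X × Y → Fin (n + 1)

def Table.toFun (K : Table X Y n) (p : X × Y) : ℕ := K p

def Table.ofFun (K : X × Y → ℕ) : Table X Y n := fun p => Fin.ofNat (n + 1) (K p)

theorem Table.toFun_ofFun {X Y : Type*} {n : ℕ} {K : X × Y → ℕ} (h : ∀ p, K p ≤ n) :
    (Table.ofFun K : Table X Y n).toFun = K := by
  ext p
  simp [Table.ofFun, Table.toFun, Nat.mod_eq_of_lt (Nat.lt_succ_of_le (h p))]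

/-- The sets of the random code are the conditional shells of all outputs y and tables. These are
exponentially many, but each fails with probability exp(-Λ/2). The pair counts, with failure
probability only 2/Λ, are summed over y, which leaves polynomially many. -/
theorem exists_goodCode {k : X → ℕ} (hk : ∑ x, k x = n) {L : ℕ} (hL : 0 < L) (hM : 0 < M)
    (h : M ≤ (typeClass n k).card * L) {Λ : ℝ} (hΛ : Real.exp 2 ≤ Λ)
    (hΛM : 4 * Real.log M ≤ Λ)
    (hcount : 2 * ((Fintype.card Y : ℝ) ^ n * (n + 1 : ℝ) ^ (Fintype.card X * Fintype.card Y)) *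
      Real.exp (-(Λ / 2)) + 2 * ((n + 1 : ℝ) ^ (Fintype.card X * Fintype.card Y) *
        (n + 1 : ℝ) ^ (Fintype.card X * Fintype.card Y)) / Λ < 1) :
    ∃ x : Fin M → Fin n → X, GoodCode Y k Λ x ∧ (L = 1 → Function.Injective x) := by
  let Ω := {x // x ∈ typeClass n k}
  have hΩc : Fintype.card Ω = (typeClass n k).card := by simp [Ω]
  have hne : Nonempty Ω := by
    rw [← Fintype.card_pos_iff, hΩc]; exact card_typeClass_pos k hk
  let S : (Fin n → Y) × Table X Y n → Finset Ω := fun i =>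
    Finset.univ.filter fun x => jointCnt (x : Fin n → X) i.1 = i.2.toFun
  let I : Table X Y n × Table X Y n → Finset (((Fin n → Y) × Table X Y n) ×
      ((Fin n → Y) × Table X Y n)) := fun c =>
    (typeClass n (colCnt c.1.toFun)).image fun y => ((y, c.1), (y, c.2))
  obtain ⟨e, h1, h2, h3⟩ := exists_good_code (Ω := Ω) hL hM (by rw [hΩc]; exact h) S I hΛ hΛM (by
    simpa [Fintype.card_prod, Fintype.card_pi, Table] using hcount)
  have hdens : ∀ (y : Fin n → Y) (K : Table X Y n), rowCnt K.toFun = k → colCnt K.toFun = cnt y →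
      dens (S (y, K)) = shellDens n K.toFun := by
    intro y K hr hc
    have hcard : (S (y, K)).card =
        (Finset.univ.filter fun x : Fin n → X => jointCnt x y = K.toFun).card := by
      refine Finset.card_bij (fun x _ => (x : Fin n → X)) ?_ (fun a _ b _ h => Subtype.ext h) ?_
      · intro x hx; simpa [S] using hx
      · intro x hx
        have hx' : jointCnt x y = K.toFun := by simpa using hx
        refine ⟨⟨x, ?_⟩, ?_, rfl⟩
        · simp only [typeClass, Finset.mem_filter, Finset.mem_univ, true_and]
          rw [← hr, ← hx', rowCnt_jointCnt]
        · simpa [S] using hx'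
    have hT := card_typeClass_mul_card_left K.toFun y hc.symm
    have hpos : (0 : ℝ) < (typeClass n (colCnt K.toFun)).card := by
      rw [hc]
      have : y ∈ typeClass n (cnt y) := by simp [typeClass]
      exact_mod_cast Finset.card_pos.2 ⟨y, this⟩
    have hpos' : (0 : ℝ) < (typeClass n k).card := by exact_mod_cast card_typeClass_pos k hk
    rw [dens, shellDens, hΩc, hr, hcard, ← hT]
    push_cast
    field_simp
  have hle : ∀ (y : Fin n → Y) (K : X × Y → ℕ), colCnt K = cnt y → ∀ p, K p ≤ n := by
    intro y K hc
    refine le_of_sum_eq ?_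
    rw [← sum_colCnt, hc, sum_cnt]
  have henum : ∀ (y : Fin n → Y) (K : Table X Y n),
      enumCnt (fun m => ((e m).1 : Fin n → X)) y K.toFun = hits (S (y, K)) e := by
    intro y K; simp [enumCnt, hits, S]
  refine ⟨fun m => (e m).1, ⟨fun m => ?_, ?_, ?_, ?_⟩, ?_⟩
  · have := (e m).1.2
    simpa [typeClass] using this
  · intro y K hr hc
    have hK := Table.toFun_ofFun (hle y K hc)
    rw [← hK] at hr hc ⊢
    rw [henum, ← hdens y _ hr hc]
    exact h1 _
  · intro y K hr hc
    have hK := Table.toFun_ofFun (hle y K hc)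
    rw [← hK] at hr hc ⊢
    rw [henum, ← hdens y _ hr hc]
    exact h2 _
  · intro K K' hr hr' hc
    by_cases hne : (typeClass n (colCnt K)).Nonempty
    swap
    · rw [Finset.not_nonempty_iff_eq_empty.1 hne]; simp
    obtain ⟨y₀, hy₀⟩ := hne
    have hy₀' : cnt y₀ = colCnt K := by simpa [typeClass] using hy₀
    have hK := Table.toFun_ofFun (hle y₀ K hy₀'.symm)
    have hK' := Table.toFun_ofFun (hle y₀ K' (hc.trans hy₀'.symm))
    rw [← hK] at hr hc ⊢
    rw [← hK'] at hr' hc ⊢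
    set K₁ : Table X Y n := Table.ofFun K
    set K₂ : Table X Y n := Table.ofFun K'
    have h4 := h3 (K₁, K₂)
    have hinj : ∀ f : ((Fin n → Y) × Table X Y n) × ((Fin n → Y) × Table X Y n) → ℝ,
        ∑ i ∈ I (K₁, K₂), f i = ∑ y ∈ typeClass n (colCnt K₁.toFun), f ((y, K₁), (y, K₂)) := by
      intro f
      exact Finset.sum_image fun y _ y' _ h => by
        simp only [Prod.mk.injEq] at h; exact h.1.1
    rw [hinj, hinj] at h4
    refine le_trans (le_of_eq ?_) (h4.trans (le_of_eq ?_))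
    · refine Finset.sum_congr rfl fun y _ => ?_
      simp [enumPairCnt, pairHits, S]
    · congr 1
      rw [← nsmul_eq_mul, ← Finset.sum_const]
      refine Finset.sum_congr rfl fun y hy => ?_
      have hy' : cnt y = colCnt K₁.toFun := by simpa [typeClass] using hy
      rw [hdens y K₁ hr hy'.symm, hdens y K₂ hr' (hc.trans hy'.symm)]
  · rintro rfl m m' hmm
    apply e.injective
    refine Prod.ext (Subtype.ext hmm) (Subsingleton.elim _ _)

end GoodCodes

/-! ### The sequence of codes and the choice of the factor Λ. -/

section CodeSequence

variable {X Y : Type*} [Fintype X] [Fintype Y]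

theorem numCodewords_pos (R : ℝ) (n : ℕ) : 0 < numCodewords R n :=
  Nat.ceil_pos.2 (Real.exp_pos _)

theorem numCodewords_le {R : ℝ} (hR : 0 ≤ R) (n : ℕ) :
    (numCodewords R n : ℝ) ≤ 2 * Real.exp (n * R) := by
  have h1 := (Nat.ceil_lt_add_one (Real.exp_pos (n * R)).le).le
  have h2 : 1 ≤ Real.exp (n * R) := Real.one_le_exp (by positivity)
  unfold numCodewords
  linarith

theorem tendsto_numCodewords_rpow {R : ℝ} (hR : 0 ≤ R) :
    Tendsto (fun n => (numCodewords R n : ℝ) ^ ((n : ℝ)⁻¹)) atTop (nhds (Real.exp R)) := by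
  have hroot : ∀ n : ℕ, 0 < n → Real.exp (n * R) ^ ((n : ℝ)⁻¹) = Real.exp R := fun n hn => by
    have : (n : ℝ) ≠ 0 := by exact_mod_cast hn.ne'
    rw [← Real.exp_mul]; congr 1; field_simp
  have h2 : Tendsto (fun n : ℕ => (2 : ℝ) ^ ((n : ℝ)⁻¹) * Real.exp R) atTop
      (nhds ((2 : ℝ) ^ (0 : ℝ) * Real.exp R)) :=
    ((tendsto_const_nhds (x := (2 : ℝ))).rpow tendsto_inv_atTop_nhds_zero_nat
      (Or.inl two_ne_zero)).mul_const _
  rw [Real.rpow_zero, one_mul] at h2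
  refine tendsto_of_tendsto_of_tendsto_of_le_of_le' tendsto_const_nhds h2 ?_ ?_
  · filter_upwards [eventually_gt_atTop 0] with n hn
    rw [← hroot n hn]
    exact Real.rpow_le_rpow (Real.exp_pos _).le (Nat.le_ceil _) (by positivity)
  · filter_upwards [eventually_gt_atTop 0] with n hn
    rw [← hroot n hn, ← Real.mul_rpow (by norm_num) (Real.exp_pos _).le]
    exact Real.rpow_le_rpow (Nat.cast_nonneg _) (numCodewords_le hR n) (by positivity)

theorem tendsto_pow_rpow (D : ℕ) :
    Tendsto (fun n : ℕ => ((n + 1 : ℝ) ^ D) ^ ((n : ℝ)⁻¹)) atTop (nhds 1) := by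
  have h := (tendsto_log_add_one_div 0).const_mul (D : ℝ)
  rw [mul_zero] at h
  have h2 := (Real.continuous_exp.tendsto 0).comp h
  rw [Real.exp_zero] at h2
  refine h2.congr fun n => ?_
  have : (0 : ℝ) < n + 1 := by positivity
  rw [Real.rpow_def_of_pos (by positivity), Real.log_pow, Function.comp]
  congr 1
  rw [add_zero]; ring

theorem entropy_le_log_card {P : X → ℝ} (hP : P ∈ stdSimplex ℝ X) :
    Real.exp (entropy P) ≤ Fintype.card X := by
  obtain ⟨k, hk, _, hkP⟩ := exists_tendsto_type hP
  refine le_of_tendsto (tendsto_card_typeClass_rpow le_rfl (Eventually.of_forall hk) hkP) ?_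
  filter_upwards [eventually_gt_atTop 0] with n hn
  have hn' : (n : ℝ) ≠ 0 := by exact_mod_cast hn.ne'
  have h1 : ((typeClass n (k n)).card : ℝ) ≤ (Fintype.card X : ℝ) ^ n := by
    have := Finset.card_le_univ (typeClass n (k n))
    rw [Fintype.card_pi] at this
    simp only [Finset.prod_const, Finset.card_univ, Fintype.card_fin] at this
    exact_mod_cast this
  calc _ ≤ ((Fintype.card X : ℝ) ^ n) ^ ((n : ℝ)⁻¹) :=
        Real.rpow_le_rpow (Nat.cast_nonneg _) h1 (by positivity)
    _ = _ := by rw [← Real.rpow_natCast, ← Real.rpow_mul (Nat.cast_nonneg _), mul_inv_cancel₀ hn',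
          Real.rpow_one]

/-- A substitute for small n: distinctness is required at every blocklength, goodness only
eventually. It fits because M ≤ |X|^n follows from R < H(P) ≤ log |X|. -/
theorem exists_injective_code {P : X → ℝ} (hP : P ∈ stdSimplex ℝ X) {R : ℝ} (hR : R < entropy P)
    (n : ℕ) : ∃ x : Fin (numCodewords R n) → Fin n → X, Function.Injective x := by
  classical
  have h1 : numCodewords R n ≤ Fintype.card (Fin n → X) := by
    refine Nat.ceil_le.2 ?_
    rw [Real.exp_nat_mul, Fintype.card_pi]
    simp only [Finset.prod_const, Finset.card_univ, Fintype.card_fin, Nat.cast_pow]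
    refine pow_le_pow_left₀ (Real.exp_pos _).le ?_ _
    exact (Real.exp_le_exp.2 hR.le).trans (entropy_le_log_card hP)
  obtain ⟨f⟩ := Function.Embedding.nonempty_of_card_le
    (α := Fin (numCodewords R n)) (β := Fin n → X) (by simpa using h1)
  exact ⟨f, f.injective⟩

/-- Here Λ = (n+1)^(2d+2): it beats the (n+1)^(2d) pairs of tables by a factor (n+1)², and exp(-Λ/2)
beats the exponential number of outputs. -/
theorem eventually_counting_bound (a d : ℕ) :
    ∀ᶠ n : ℕ in atTop, 2 * ((a : ℝ) ^ n * (n + 1 : ℝ) ^ d) *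
      Real.exp (-((n + 1 : ℝ) ^ (2 * d + 2) / 2)) +
      2 * ((n + 1 : ℝ) ^ d * (n + 1 : ℝ) ^ d) / (n + 1 : ℝ) ^ (2 * d + 2) < 1 := by
  filter_upwards [eventually_ge_atTop (2 * (a + d + 1) + 4)] with n hn
  have hn' : (2 * (a + d + 1) + 4 : ℝ) ≤ n := by exact_mod_cast hn
  have ha0 : (0 : ℝ) ≤ a := Nat.cast_nonneg _
  have hd0 : (0 : ℝ) ≤ d := Nat.cast_nonneg _
  have hn1 : (1 : ℝ) ≤ n + 1 := by linarith
  have h1 : (a : ℝ) ^ n ≤ Real.exp (n * a) := by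
    rw [Real.exp_nat_mul]
    exact pow_le_pow_left₀ ha0 (by have := Real.add_one_le_exp (a : ℝ); linarith) _
  have h2 : (n + 1 : ℝ) ^ d ≤ Real.exp (d * n) := by
    rw [Real.exp_nat_mul]
    exact pow_le_pow_left₀ (by linarith) (Real.add_one_le_exp _) _
  have h3 : (n + 1 : ℝ) ^ 2 ≤ (n + 1 : ℝ) ^ (2 * d + 2) := pow_le_pow_right₀ hn1 (by omega)
  have h4 : 2 * ((a : ℝ) ^ n * (n + 1 : ℝ) ^ d) * Real.exp (-((n + 1 : ℝ) ^ (2 * d + 2) / 2)) ≤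
      2 * Real.exp (-n) := by
    calc _ ≤ 2 * (Real.exp (n * a) * Real.exp (d * n)) * Real.exp (-((n + 1 : ℝ) ^ 2 / 2)) := by
          gcongr
      _ = 2 * Real.exp (n * a + d * n - (n + 1 : ℝ) ^ 2 / 2) := by
          rw [mul_assoc, ← Real.exp_add, ← Real.exp_add]; rfl
      _ ≤ _ := by
          have : n * a + d * n - (n + 1 : ℝ) ^ 2 / 2 ≤ -(n : ℝ) := by nlinarith
          gcongr
  have h5 : Real.exp (-(n : ℝ)) ≤ 1 / (n + 1) := by
    rw [Real.exp_neg, ← one_div]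
    exact one_div_le_one_div_of_le (by linarith) (Real.add_one_le_exp _)
  have h6 : (1 : ℝ) / (n + 1) ≤ 1 / 5 := one_div_le_one_div_of_le (by norm_num) (by linarith)
  have h7 : 2 * ((n + 1 : ℝ) ^ d * (n + 1 : ℝ) ^ d) / (n + 1 : ℝ) ^ (2 * d + 2) =
      2 * (1 / (n + 1)) * (1 / (n + 1)) := by
    have : (n + 1 : ℝ) ≠ 0 := by positivity
    rw [pow_add, pow_mul', pow_two]
    field_simp
  have h8 : (0 : ℝ) ≤ 1 / (n + 1) := by positivity
  rw [h7]
  nlinarith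

/-- A sequence of codes with distinct codewords if `R < H(P)` that are eventually good. -/
theorem exists_goodCode_seq (Y : Type*) [Fintype Y] {P : X → ℝ} (hP : P ∈ stdSimplex ℝ X) {R : ℝ}
    (hR : 0 ≤ R) {k : ℕ → X → ℕ} (hk : ∀ n, ∑ x, k n x = n)
    (hkP : Tendsto (fun n x => (k n x / n : ℝ)) atTop (nhds P)) :
    ∃ (C : CodeSeq X R) (D : ℕ), (R < entropy P → ∀ n, Function.Injective (C n)) ∧
      ∀ᶠ n in atTop, GoodCode Y (k n) ((n + 1 : ℝ) ^ D) (C n) := by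
  classical
  obtain ⟨x₀⟩ : Nonempty X := by
    by_contra h
    rw [not_nonempty_iff] at h
    have := hP.2
    simp at this
  set d := Fintype.card X * Fintype.card Y
  set D := 2 * d + 2
  have hbase : ∀ n, ∃ x : Fin (numCodewords R n) → Fin n → X,
      R < entropy P → Function.Injective x := fun n => by
    by_cases h : R < entropy P
    · obtain ⟨x, hx⟩ := exists_injective_code hP h n
      exact ⟨x, fun _ => hx⟩
    · exact ⟨fun _ _ => x₀, fun h' => absurd h' h⟩
  have hchoice : ∀ n, ∃ x : Fin (numCodewords R n) → Fin n → X,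
      (R < entropy P → Function.Injective x) ∧
      ((∃ x' : Fin (numCodewords R n) → Fin n → X, GoodCode Y (k n) ((n + 1 : ℝ) ^ D) x' ∧
        (R < entropy P → Function.Injective x')) → GoodCode Y (k n) ((n + 1 : ℝ) ^ D) x) := by
    intro n
    by_cases h : ∃ x' : Fin (numCodewords R n) → Fin n → X,
        GoodCode Y (k n) ((n + 1 : ℝ) ^ D) x' ∧ (R < entropy P → Function.Injective x')
    · obtain ⟨x, hx, hx'⟩ := h
      exact ⟨x, hx', fun _ => hx⟩
    · obtain ⟨x, hx⟩ := hbase n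
      exact ⟨x, hx, fun h' => absurd h' h⟩
  choose C hC1 hC2 using hchoice
  refine ⟨C, D, fun h n => hC1 n h, ?_⟩
  have hcard : ∀ᶠ n in atTop, R < entropy P → numCodewords R n ≤ (typeClass n (k n)).card := by
    by_cases h : R < entropy P
    · have h1 := (tendsto_numCodewords_rpow hR).eventually_lt
        (tendsto_card_typeClass_rpow le_rfl (Eventually.of_forall hk) hkP) (Real.exp_lt_exp.2 h)
      filter_upwards [h1] with n hn _
      by_contra hlt
      have h2 : ((typeClass n (k n)).card : ℝ) ≤ numCodewords R n := by
        exact_mod_cast (not_le.1 hlt).le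
      exact absurd (Real.rpow_le_rpow (Nat.cast_nonneg _) h2 (inv_nonneg.2 (Nat.cast_nonneg n)))
        (not_le.2 hn)
    · exact Eventually.of_forall fun n h' => absurd h' h
  have hexp : ∀ᶠ n : ℕ in atTop, Real.exp 2 ≤ (n + 1 : ℝ) ^ D := by
    filter_upwards [eventually_ge_atTop ⌈Real.exp 2⌉₊] with n hn
    have h1 : Real.exp 2 ≤ n := Nat.ceil_le.1 hn
    calc Real.exp 2 ≤ (n + 1 : ℝ) := by linarith
      _ ≤ _ := le_self_pow₀ (by linarith [Real.exp_pos 2]) (by omega)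
  have hlog : ∀ᶠ n : ℕ in atTop, 4 * Real.log (numCodewords R n) ≤ (n + 1 : ℝ) ^ D := by
    filter_upwards [eventually_ge_atTop ⌈4 + 4 * R⌉₊] with n hn
    have h1 : 4 + 4 * R ≤ n := Nat.ceil_le.1 hn
    have h2 : Real.log (numCodewords R n) ≤ Real.log 2 + n * R := by
      rw [← Real.log_exp (n * R), ← Real.log_mul two_ne_zero (Real.exp_pos _).ne']
      exact Real.log_le_log (by exact_mod_cast numCodewords_pos R n) (numCodewords_le hR n)
    have h3 : Real.log 2 ≤ 1 := by
      have := Real.log_le_sub_one_of_pos (zero_lt_two (α := ℝ)); linarith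
    have h4 : (n + 1 : ℝ) ^ 2 ≤ (n + 1 : ℝ) ^ D :=
      pow_le_pow_right₀ (by linarith [(Nat.cast_nonneg n : (0 : ℝ) ≤ n)]) (by omega)
    nlinarith
  filter_upwards [hcard, hexp, hlog, eventually_counting_bound (Fintype.card Y) d]
    with n h1 h2 h3 h4
  refine hC2 n ?_
  -- Below the entropy the type class eventually holds M distinct words, so L = 1; otherwise L = M
  -- always leaves enough room.
  by_cases h : R < entropy P
  · obtain ⟨x, hx, hx'⟩ := exists_goodCode (Y := Y) (hk n) one_pos (numCodewords_pos R n)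
      (by rw [mul_one]; exact h1 h) h2 h3 h4
    exact ⟨x, hx, fun _ => hx' rfl⟩
  · obtain ⟨x, hx, _⟩ := exists_goodCode (Y := Y) (hk n) (numCodewords_pos R n)
      (numCodewords_pos R n) (Nat.le_mul_of_pos_left _ (card_typeClass_pos _ (hk n))) h2 h3 h4
    exact ⟨x, hx, fun h' => absurd h' h⟩

end CodeSequence

/-! ### From a false alarm to a pair of joint types. -/

section FalseAlarm

open Classical

variable {X Y : Type*} [Fintype X] [Fintype Y] {n M : ℕ}

/-- The generalised likelihood of a pair of sequences of joint type `K`. -/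
def tableLik (𝒰 : Set (DMC X Y)) (K : X × Y → ℕ) : ℝ := supLik 𝒰 fun p => (K p : ℝ)

theorem tableLik_nonneg (𝒰 : Set (DMC X Y)) (K : X × Y → ℕ) : 0 ≤ tableLik 𝒰 K :=
  supLik_nonneg _ _

/-- The number of tables of counts. -/
def numTables (X Y : Type*) [Fintype X] [Fintype Y] (n : ℕ) : ℝ :=
  (n + 1 : ℝ) ^ (Fintype.card X * Fintype.card Y)

/-- The set of the tables of counts with entries at most `n`. -/
def tables (X Y : Type*) [Fintype X] [Fintype Y] (n : ℕ) : Finset (X × Y → ℕ) :=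
  (Finset.univ : Finset (Table X Y n)).image Table.toFun

theorem card_tables_le : ((tables X Y n).card : ℝ) ≤ numTables X Y n := by
  have h1 : (tables X Y n).card ≤ (Finset.univ : Finset (Table X Y n)).card :=
    Finset.card_image_le
  have h2 : (Finset.univ : Finset (Table X Y n)).card = (n + 1) ^ (Fintype.card X * Fintype.card Y) := by
    simp [Table, Fintype.card_pi]
  rw [h2] at h1
  unfold numTables
  exact_mod_cast h1

theorem jointCnt_mem_tables (x : Fin n → X) (y : Fin n → Y) : jointCnt x y ∈ tables X Y n := by
  refine Finset.mem_image.2 ⟨Table.ofFun (jointCnt x y), Finset.mem_univ _, Table.toFun_ofFun ?_⟩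
  exact le_of_sum_eq (sum_cnt _)

/-- The codewords of joint type `K` with `y` dominate the sum of the likelihoods over `𝒱`, and the
detector rejects. -/
def Dominates (α : ℝ) (𝒲 𝒱 : Set (DMC X Y)) (x : Fin M → Fin n → X) (y : Fin n → Y)
    (K : X × Y → ℕ) : Prop :=
  0 < enumCnt x y K ∧ ∀ K' : X × Y → ℕ, Real.exp (n * α) * (enumCnt x y K' * tableLik 𝒲 K') ≤
    numTables X Y n * (enumCnt x y K * tableLik 𝒱 K)

/-- The joint type maximising multiplicity times likelihood accounts for the sum over 𝒱 up to the
number of tables, while each class is only a part of the sum over 𝒲. -/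
theorem exists_dominates {α : ℝ} {𝒲 𝒱 : Set (DMC X Y)} {x : Fin M → Fin n → X} {y : Fin n → Y}
    (hM : 0 < M) (hy : y ∈ rejU α 𝒲 𝒱 x) : ∃ K ∈ tables X Y n, Dominates α 𝒲 𝒱 x y K := by
  have hne : (Finset.univ.image fun m => jointCnt (x m) y).Nonempty :=
    ⟨_, Finset.mem_image_of_mem _ (Finset.mem_univ (⟨0, hM⟩ : Fin M))⟩
  obtain ⟨K, hK, hmax⟩ := Finset.exists_max_image _
    (fun K => (enumCnt x y K : ℝ) * tableLik 𝒱 K) hne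
  obtain ⟨m, _, rfl⟩ := Finset.mem_image.1 hK
  refine ⟨jointCnt (x m) y, jointCnt_mem_tables (x m) y, Finset.card_pos.2 ⟨m, by simp⟩, fun K' => ?_⟩
  have h1 : (enumCnt x y K' : ℝ) * tableLik 𝒲 K' ≤ ∑ m, maxLik 𝒲 (x m) y := by
    simp only [maxLik_eq_supLik]
    rw [enumCnt, ← nsmul_eq_mul, ← Finset.sum_const]
    calc _ = ∑ m ∈ Finset.univ.filter (fun m => jointCnt (x m) y = K'),
          supLik 𝒲 (fun p => (jointCnt (x m) y p : ℝ)) := by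
          refine Finset.sum_congr rfl fun m hm => ?_
          rw [(Finset.mem_filter.1 hm).2]; rfl
      _ ≤ _ := Finset.sum_le_sum_of_subset_of_nonneg (Finset.filter_subset _ _)
          fun m _ _ => supLik_nonneg _ _
  have h2 : ∑ m, maxLik 𝒱 (x m) y ≤
      numTables X Y n * (enumCnt x y (jointCnt (x m) y) * tableLik 𝒱 (jointCnt (x m) y)) := by
    simp only [maxLik_eq_supLik]
    rw [← Finset.sum_fiberwise_of_maps_to (s := Finset.univ)
      (t := Finset.univ.image fun m => jointCnt (x m) y) (g := fun m => jointCnt (x m) y)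
      (fun m hm => Finset.mem_image_of_mem _ hm)]
    calc _ ≤ ∑ K ∈ Finset.univ.image fun m => jointCnt (x m) y,
          (enumCnt x y (jointCnt (x m) y) : ℝ) * tableLik 𝒱 (jointCnt (x m) y) := by
          refine Finset.sum_le_sum fun K hK => le_trans (le_of_eq ?_) (hmax K hK)
          rw [enumCnt, ← nsmul_eq_mul, ← Finset.sum_const]
          refine Finset.sum_congr rfl fun m hm => ?_
          rw [(Finset.mem_filter.1 hm).2]; rfl
      _ = ((Finset.univ.image fun m => jointCnt (x m) y).card : ℝ) *
          ((enumCnt x y (jointCnt (x m) y) : ℝ) * tableLik 𝒱 (jointCnt (x m) y)) := by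
          rw [Finset.sum_const, nsmul_eq_mul]
      _ ≤ _ := by
          refine mul_le_mul_of_nonneg_right (le_trans ?_ card_tables_le)
            (mul_nonneg (Nat.cast_nonneg _) (tableLik_nonneg _ _))
          have : (Finset.univ.image fun m => jointCnt (x m) y) ⊆ tables X Y n := by
            intro K hK
            obtain ⟨m, _, rfl⟩ := Finset.mem_image.1 hK
            exact jointCnt_mem_tables _ _
          exact_mod_cast Finset.card_le_card this
  have hy' : Real.exp (n * α) * ∑ m, maxLik 𝒲 (x m) y ≤ ∑ m, maxLik 𝒱 (x m) y := hy
  exact (mul_le_mul_of_nonneg_left h1 (Real.exp_pos _).le).trans (hy'.trans h2)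

/-- The number of pairs of a sent codeword and an output of joint type `K` such that the codewords
of joint type `K'` dominate. -/
def domCnt (α : ℝ) (𝒲 𝒱 : Set (DMC X Y)) (x : Fin M → Fin n → X) (K K' : X × Y → ℕ) : ℕ :=
  (Finset.univ.filter fun i : Fin M × (Fin n → Y) =>
    jointCnt (x i.1) i.2 = K ∧ Dominates α 𝒲 𝒱 x i.2 K').card

theorem faProb_le {α : ℝ} {𝒰 𝒲 𝒱 : Set (DMC X Y)} {x : Fin M → Fin n → X} (hM : 0 < M)
    {U : DMC X Y} (hU : U ∈ 𝒰) {B : ℝ} (hB0 : 0 ≤ B)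
    (hB : ∀ K K' : X × Y → ℕ, tableLik 𝒰 K * domCnt α 𝒲 𝒱 x K K' ≤ M * B) :
    faProb α U 𝒲 𝒱 x ≤ numTables X Y n ^ 2 * B := by
  have hM0 : (0 : ℝ) < M := by exact_mod_cast hM
  have h1 : ∑ m, ∑ y, (rejU α 𝒲 𝒱 x).indicator (fun y => U.lik (x m) y) y ≤
      ∑ K ∈ tables X Y n, ∑ K' ∈ tables X Y n, tableLik 𝒰 K * domCnt α 𝒲 𝒱 x K K' := by
    rw [← Fintype.sum_prod_type']
    calc _ ≤ ∑ i : Fin M × (Fin n → Y), ∑ K ∈ tables X Y n, ∑ K' ∈ tables X Y n,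
          if jointCnt (x i.1) i.2 = K ∧ Dominates α 𝒲 𝒱 x i.2 K' then tableLik 𝒰 K else 0 := by
          refine Finset.sum_le_sum fun i _ => ?_
          have hnn : ∀ K K' : X × Y → ℕ, 0 ≤
              if jointCnt (x i.1) i.2 = K ∧ Dominates α 𝒲 𝒱 x i.2 K' then tableLik 𝒰 K else 0 :=
            fun K K' => by split_ifs; exacts [tableLik_nonneg _ _, le_rfl]
          by_cases hy : i.2 ∈ rejU α 𝒲 𝒱 x
          · rw [Set.indicator_of_mem hy, lik_eq_likR]
            obtain ⟨K', hK', hdom⟩ := exists_dominates hM hy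
            refine le_trans ?_ (Finset.single_le_sum
              (f := fun K => ∑ K' ∈ tables X Y n, if jointCnt (x i.1) i.2 = K ∧
                Dominates α 𝒲 𝒱 x i.2 K' then tableLik 𝒰 K else 0)
              (fun K _ => Finset.sum_nonneg fun K' _ => hnn K K')
              (jointCnt_mem_tables (x i.1) i.2))
            refine le_trans ?_ (Finset.single_le_sum
              (f := fun K' => if jointCnt (x i.1) i.2 = jointCnt (x i.1) i.2 ∧
                Dominates α 𝒲 𝒱 x i.2 K' then tableLik 𝒰 (jointCnt (x i.1) i.2) else 0)
              (fun K' _ => hnn _ K') hK')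
            rw [if_pos ⟨rfl, hdom⟩]
            exact likR_le_supLik hU fun p => Nat.cast_nonneg _
          · rw [Set.indicator_of_notMem hy]
            exact Finset.sum_nonneg fun K _ => Finset.sum_nonneg fun K' _ => hnn K K'
      _ = _ := by
          rw [Finset.sum_comm]
          refine Finset.sum_congr rfl fun K _ => ?_
          rw [Finset.sum_comm]
          refine Finset.sum_congr rfl fun K' _ => ?_
          rw [← Finset.sum_filter, Finset.sum_const, nsmul_eq_mul, mul_comm]
          rfl
  have h2 : ∑ K ∈ tables X Y n, ∑ K' ∈ tables X Y n, tableLik 𝒰 K * domCnt α 𝒲 𝒱 x K K' ≤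
      numTables X Y n ^ 2 * (M * B) := by
    calc _ ≤ ∑ K ∈ tables X Y n, ∑ K' ∈ tables X Y n, M * B :=
          Finset.sum_le_sum fun K _ => Finset.sum_le_sum fun K' _ => hB K K'
      _ = ((tables X Y n).card : ℝ) ^ 2 * (M * B) := by
          simp only [Finset.sum_const, nsmul_eq_mul]; ring
      _ ≤ _ := by
          have := card_tables_le (X := X) (Y := Y) (n := n)
          gcongr
  have h3 := h1.trans h2
  rw [faProb, outProb]
  calc _ ≤ 1 / (M : ℝ) * (numTables X Y n ^ 2 * (M * B)) := by gcongr
    _ = _ := by field_simp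

theorem domCnt_le_left {α : ℝ} {𝒲 𝒱 : Set (DMC X Y)} {k : X → ℕ} {Λ : ℝ}
    {x : Fin M → Fin n → X} (hx : GoodCode Y k Λ x) (hM : 0 < M) {K K' : X × Y → ℕ}
    (hK : rowCnt K = k) :
    (domCnt α 𝒲 𝒱 x K K' : ℝ) ≤ M * ((typeClass n K).card / (typeClass n k).card) := by
  have hpos : (0 : ℝ) < (typeClass n k).card := by
    have : x ⟨0, hM⟩ ∈ typeClass n k := by simp [typeClass, hx.cnt_eq]
    exact_mod_cast Finset.card_pos.2 ⟨_, this⟩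
  have h1 : ∀ m, ((Finset.univ.filter fun y : Fin n → Y => jointCnt (x m) y = K).card : ℝ) =
      (typeClass n K).card / (typeClass n k).card := by
    intro m
    have := card_typeClass_mul_card_right K (x m) (by rw [hx.cnt_eq, hK])
    rw [hK] at this
    rw [← this]; push_cast; field_simp
  have h2 : (domCnt α 𝒲 𝒱 x K K' : ℝ) ≤
      ∑ m, ((Finset.univ.filter fun y : Fin n → Y => jointCnt (x m) y = K).card : ℝ) := by
    have : domCnt α 𝒲 𝒱 x K K' ≤ (Finset.univ.sigma fun m : Fin M =>
        Finset.univ.filter fun y : Fin n → Y => jointCnt (x m) y = K).card := by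
      refine Finset.card_le_card_of_injOn (fun i => ⟨i.1, i.2⟩) ?_ ?_
      · intro i hi
        have := (Finset.mem_filter.1 hi).2.1
        simpa using this
      · rintro ⟨m, y⟩ _ ⟨m', y'⟩ _ h
        simp only [Sigma.mk.injEq, heq_eq_eq] at h
        rw [h.1, h.2]
    rw [Finset.card_sigma] at this
    exact_mod_cast this
  refine h2.trans (le_of_eq ?_)
  simp only [h1, Finset.sum_const, Finset.card_univ, Fintype.card_fin, nsmul_eq_mul]

/-- If K ≠ K', a dominating codeword differs from the sent one. Choosing one maps the sent messages
and outputs injectively to ordered pairs of messages and outputs, whose number the code controls. -/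
theorem domCnt_le_right {α : ℝ} {𝒲 𝒱 : Set (DMC X Y)} {k : X → ℕ} {Λ : ℝ}
    {x : Fin M → Fin n → X} (hx : GoodCode Y k Λ x) {K K' : X × Y → ℕ}
    (hK : rowCnt K = k) (hK' : rowCnt K' = k) (hc : colCnt K' = colCnt K) (hne : K ≠ K') :
    (domCnt α 𝒲 𝒱 x K K' : ℝ) ≤
      Λ * M ^ 2 * ((typeClass n (colCnt K)).card * (shellDens n K * shellDens n K')) := by
  refine le_trans ?_ (hx.pair_le K K' hK hK' hc)
  have : domCnt α 𝒲 𝒱 x K K' ≤ ((typeClass n (colCnt K)).sigma fun y =>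
      Finset.univ.filter fun m : Fin M × Fin M =>
        m.1 ≠ m.2 ∧ jointCnt (x m.1) y = K ∧ jointCnt (x m.2) y = K').card := by
    have hex : ∀ i : Fin M × (Fin n → Y), Dominates α 𝒲 𝒱 x i.2 K' →
        ∃ m', jointCnt (x m') i.2 = K' := by
      intro i hi
      obtain ⟨m', hm'⟩ := Finset.card_pos.1 hi.1
      exact ⟨m', (Finset.mem_filter.1 hm').2⟩
    refine Finset.card_le_card_of_injOn (fun i => ⟨i.2,
      (i.1, if h : Dominates α 𝒲 𝒱 x i.2 K' then (hex i h).choose else i.1)⟩) ?_ ?_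
    · intro i hi
      obtain ⟨h1, h2⟩ := (Finset.mem_filter.1 hi).2
      have h3 := (hex i h2).choose_spec
      simp only [Finset.coe_sigma, Set.mem_sigma_iff, Finset.mem_coe, typeClass,
        Finset.mem_filter, Finset.mem_univ, true_and, dif_pos h2]
      refine ⟨by rw [← h1, colCnt_jointCnt], fun heq => hne ?_, h1, h3⟩
      rw [← h1, ← h3, ← heq]
    · rintro ⟨m, y⟩ _ ⟨m', y'⟩ _ h
      simp only [Sigma.mk.injEq] at h
      obtain ⟨rfl, h⟩ := h
      have := (Prod.mk.inj (eq_of_heq h)).1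
      rw [this]
  rw [Finset.card_sigma] at this
  calc (domCnt α 𝒲 𝒱 x K K' : ℝ) ≤ _ := Nat.cast_le.2 this
    _ = _ := by push_cast; rfl

/-- If the false-alarm probability of a good code is large, then there are joint types of the output
with the sent codeword and with the dominating codewords that account for it. -/
structure Witness (α : ℝ) (𝒰 𝒲 𝒱 : Set (DMC X Y)) (k : X → ℕ) (Λ : ℝ) (n M : ℕ) (B : ℝ)
    (K K' : X × Y → ℕ) : Prop where
  col_eq : colCnt K' = colCnt K
  lik_self : Real.exp (n * α) * tableLik 𝒲 K' ≤ numTables X Y n * tableLik 𝒱 K'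
  lik_sent : Real.exp (n * α) * tableLik 𝒲 K ≤
    numTables X Y n * (2 * Λ * max 1 (M * shellDens n K') * tableLik 𝒱 K')
  lik_other : ∀ J : X × Y → ℕ, rowCnt J = k → colCnt J = colCnt K → Λ ≤ M * shellDens n J →
    Real.exp (n * α) * (M * shellDens n J / Λ * tableLik 𝒲 J) ≤
      numTables X Y n * (2 * Λ * max 1 (M * shellDens n K') * tableLik 𝒱 K')
  cost_sent : B ≤ tableLik 𝒰 K * ((typeClass n K).card / (typeClass n k).card)
  cost_pair : K ≠ K' → B ≤ tableLik 𝒰 K *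
    (Λ * M * ((typeClass n (colCnt K)).card * (shellDens n K * shellDens n K')))

/-- Pigeonhole over the pairs of tables gives one with a large share. Its count is positive, so an
actual message and output realise it, and goodness replaces the enumerators in the dominance
inequalities by their means. -/
theorem exists_witness {α : ℝ} {𝒰 𝒲 𝒱 : Set (DMC X Y)} {k : X → ℕ} {Λ : ℝ}
    {x : Fin M → Fin n → X} (hx : GoodCode Y k Λ x) (hM : 0 < M) {U : DMC X Y} (hU : U ∈ 𝒰)
    {B : ℝ} (hB0 : 0 ≤ B) (hB : numTables X Y n ^ 2 * B < faProb α U 𝒲 𝒱 x) :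
    ∃ K K' : X × Y → ℕ, rowCnt K = k ∧ rowCnt K' = k ∧ Witness α 𝒰 𝒲 𝒱 k Λ n M B K K' := by
  obtain ⟨K, K', hKK'⟩ : ∃ K K' : X × Y → ℕ, M * B < tableLik 𝒰 K * domCnt α 𝒲 𝒱 x K K' := by
    by_contra hcon
    push Not at hcon
    exact absurd (faProb_le hM hU hB0 hcon) (not_le.2 hB)
  have hM0 : (0 : ℝ) < M := by exact_mod_cast hM
  have hpos : 0 < domCnt α 𝒲 𝒱 x K K' := by
    rw [Nat.pos_iff_ne_zero]
    intro h0
    rw [h0, Nat.cast_zero, mul_zero] at hKK'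
    exact absurd hKK' (not_lt.2 (mul_nonneg hM0.le hB0))
  obtain ⟨⟨m, y⟩, hmy⟩ := Finset.card_pos.1 hpos
  obtain ⟨hK, hdom⟩ := (Finset.mem_filter.1 hmy).2
  simp only at hK hdom
  obtain ⟨m', hm'⟩ := Finset.card_pos.1 hdom.1
  have hm'' : jointCnt (x m') y = K' := (Finset.mem_filter.1 hm').2
  have hrK : rowCnt K = k := by rw [← hK, rowCnt_jointCnt, hx.cnt_eq]
  have hrK' : rowCnt K' = k := by rw [← hm'', rowCnt_jointCnt, hx.cnt_eq]
  have hcK : colCnt K = cnt y := by rw [← hK, colCnt_jointCnt]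
  have hcK' : colCnt K' = cnt y := by rw [← hm'', colCnt_jointCnt]
  have hN' : (0 : ℝ) < enumCnt x y K' := by exact_mod_cast hdom.1
  have hN : (1 : ℝ) ≤ enumCnt x y K := by
    have : 0 < enumCnt x y K := Finset.card_pos.2 ⟨m, by simp [hK]⟩
    exact_mod_cast this
  have hT : 0 ≤ numTables X Y n := by unfold numTables; positivity
  have hup : numTables X Y n * (enumCnt x y K' * tableLik 𝒱 K') ≤
      numTables X Y n * (2 * Λ * max 1 (M * shellDens n K') * tableLik 𝒱 K') :=
    mul_le_mul_of_nonneg_left (mul_le_mul_of_nonneg_right (hx.enum_le y K' hrK' hcK')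
      (tableLik_nonneg _ _)) hT
  have hcost : ∀ D : ℝ, (domCnt α 𝒲 𝒱 x K K' : ℝ) ≤ M * D → B ≤ tableLik 𝒰 K * D := by
    intro D hD
    have h1 := hKK'.le.trans (mul_le_mul_of_nonneg_left hD (tableLik_nonneg 𝒰 K))
    refine le_of_mul_le_mul_left ?_ hM0
    linarith
  refine ⟨K, K', hrK, hrK', hcK'.trans hcK.symm, ?_, ?_, ?_, ?_, ?_⟩
  · refine le_of_mul_le_mul_left ?_ hN'
    have := hdom.2 K'
    linarith
  · refine le_trans ?_ ((hdom.2 K).trans hup)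
    exact mul_le_mul_of_nonneg_left (le_mul_of_one_le_left (tableLik_nonneg _ _) hN)
      (Real.exp_pos _).le
  · intro J hJ hcJ hΛ
    refine le_trans ?_ ((hdom.2 J).trans hup)
    exact mul_le_mul_of_nonneg_left (mul_le_mul_of_nonneg_right
      (hx.le_enum y J hJ (hcJ.trans hcK) hΛ) (tableLik_nonneg _ _)) (Real.exp_pos _).le
  · exact hcost _ (domCnt_le_left hx hM hrK)
  · intro hne
    refine hcost _ ((domCnt_le_right hx hrK hrK' (hcK'.trans hcK.symm) hne).trans (le_of_eq ?_))
    ring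

end FalseAlarm

/-! ### Limits of n-th roots, in which zero is an admissible value. -/

section RootLimits

/-- The sequence `u` is nonnegative and its `n`-th roots tend to `a`. -/
def RootTendsto (𝒢 : Filter ℕ) (u : ℕ → ℝ) (a : ℝ) : Prop :=
  (∀ n, 0 ≤ u n) ∧ Tendsto (fun n => u n ^ ((n : ℝ)⁻¹)) 𝒢 (nhds a)

variable {𝒢 : Filter ℕ} {u v : ℕ → ℝ} {a b : ℝ}

theorem RootTendsto.mul (hu : RootTendsto 𝒢 u a) (hv : RootTendsto 𝒢 v b) :
    RootTendsto 𝒢 (fun n => u n * v n) (a * b) :=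
  ⟨fun n => mul_nonneg (hu.1 n) (hv.1 n),
    (hu.2.mul hv.2).congr fun n => (Real.mul_rpow (hu.1 n) (hv.1 n)).symm⟩

theorem RootTendsto.div (hu : RootTendsto 𝒢 u a) (hv : RootTendsto 𝒢 v b) (hb : b ≠ 0) :
    RootTendsto 𝒢 (fun n => u n / v n) (a / b) :=
  ⟨fun n => div_nonneg (hu.1 n) (hv.1 n),
    (hu.2.div hv.2 hb).congr fun n => (Real.div_rpow (hu.1 n) (hv.1 n) _).symm⟩

theorem RootTendsto.max (hu : RootTendsto 𝒢 u a) (hv : RootTendsto 𝒢 v b) :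
    RootTendsto 𝒢 (fun n => max (u n) (v n)) (max a b) := by
  refine ⟨fun n => le_max_of_le_left (hu.1 n), (hu.2.max hv.2).congr fun n => ?_⟩
  have hn : (0 : ℝ) ≤ (n : ℝ)⁻¹ := by positivity
  show _ = (Max.max (u n) (v n)) ^ ((n : ℝ)⁻¹)
  rcases le_total (u n) (v n) with h | h
  · rw [max_eq_right h, max_eq_right (Real.rpow_le_rpow (hu.1 n) h hn)]
  · rw [max_eq_left h, max_eq_left (Real.rpow_le_rpow (hv.1 n) h hn)]

theorem RootTendsto.le [𝒢.NeBot] (hu : RootTendsto 𝒢 u a) (hv : RootTendsto 𝒢 v b)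
    (h : ∀ᶠ n in 𝒢, u n ≤ v n) : a ≤ b :=
  le_of_tendsto_of_tendsto hu.2 hv.2 (h.mono fun n hn =>
    Real.rpow_le_rpow (hu.1 n) hn (by positivity))

theorem RootTendsto.eventually_le (hu : RootTendsto 𝒢 u a) (hv : RootTendsto 𝒢 v b)
    (h𝒢 : 𝒢 ≤ atTop) (h : a < b) : ∀ᶠ n in 𝒢, u n ≤ v n := by
  filter_upwards [hu.2.eventually_lt hv.2 h, h𝒢 (eventually_gt_atTop 0)] with n hn hn0
  have hn0' : (0 : ℝ) < (n : ℝ)⁻¹ := by positivity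
  exact ((Real.rpow_lt_rpow_iff (hu.1 n) (hv.1 n) hn0').1 hn).le

theorem rootTendsto_exp (h𝒢 : 𝒢 ≤ atTop) (c : ℝ) :
    RootTendsto 𝒢 (fun n => Real.exp (n * c)) (Real.exp c) := by
  refine ⟨fun n => (Real.exp_pos _).le, tendsto_nhds_of_eventually_eq ?_⟩
  filter_upwards [h𝒢 (eventually_gt_atTop 0)] with n hn
  have hn' : (n : ℝ) ≠ 0 := by exact_mod_cast hn.ne'
  rw [← Real.exp_mul, mul_comm (n : ℝ), mul_assoc, mul_inv_cancel₀ hn', mul_one]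

theorem rootTendsto_const (h𝒢 : 𝒢 ≤ atTop) {c : ℝ} (hc : 0 < c) :
    RootTendsto 𝒢 (fun _ => c) 1 := by
  refine ⟨fun _ => hc.le, ?_⟩
  have h := (Real.continuousAt_const_rpow (b := 0) hc.ne').tendsto.comp
    (tendsto_inv_atTop_nhds_zero_nat (𝕜 := ℝ))
  rw [Real.rpow_zero] at h
  exact h.mono_left h𝒢

theorem rootTendsto_pow (h𝒢 : 𝒢 ≤ atTop) (D : ℕ) :
    RootTendsto 𝒢 (fun n => (n + 1 : ℝ) ^ D) 1 :=
  ⟨fun n => by positivity, (tendsto_pow_rpow D).mono_left h𝒢⟩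

end RootLimits

/-! ### Exponential rates along convergent joint types. -/

section TableLimits

variable {X Y : Type*} [Fintype X] [Fintype Y] {𝒢 : Filter ℕ} {k : ℕ → X → ℕ} {P : X → ℝ}

/-- The tables `K n` have row sums `k n`, and `K n / n` tends to `Q`. -/
structure TableTendsto (𝒢 : Filter ℕ) (k : ℕ → X → ℕ) (P : X → ℝ) (K : ℕ → X × Y → ℕ)
    (Q : X × Y → ℝ) : Prop where
  row_eq : ∀ n, rowCnt (K n) = k n
  tendsto : Tendsto (fun n p => (K n p / n : ℝ)) 𝒢 (nhds Q)
  mem : Q ∈ jointLaws Y P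

theorem TableTendsto.tendsto_colCnt {K : ℕ → X × Y → ℕ} {Q : X × Y → ℝ}
    (hK : TableTendsto 𝒢 k P K Q) :
    Tendsto (fun n y => (colCnt (K n) y / n : ℝ)) 𝒢 (nhds (margY Q)) := by
  refine (continuous_margY.tendsto Q).comp hK.tendsto |>.congr fun n => ?_
  ext y
  simp only [Function.comp, margY, colCnt, Nat.cast_sum, Finset.sum_div]

theorem TableTendsto.sum_eq (hk : ∀ n, ∑ x, k n x = n) {K : ℕ → X × Y → ℕ} {Q : X × Y → ℝ}
    (hK : TableTendsto 𝒢 k P K Q) (n : ℕ) : ∑ p, K n p = n := by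
  rw [← sum_rowCnt, hK.row_eq, hk]

theorem TableTendsto.card (h𝒢 : 𝒢 ≤ atTop) (hk : ∀ n, ∑ x, k n x = n) {K : ℕ → X × Y → ℕ}
    {Q : X × Y → ℝ} (hK : TableTendsto 𝒢 k P K Q) :
    RootTendsto 𝒢 (fun n => (typeClass n (K n)).card) (Real.exp (entropy Q)) :=
  ⟨fun _ => Nat.cast_nonneg _,
    tendsto_card_typeClass_rpow h𝒢 (Eventually.of_forall (hK.sum_eq hk)) hK.tendsto⟩

theorem TableTendsto.card_col (h𝒢 : 𝒢 ≤ atTop) (hk : ∀ n, ∑ x, k n x = n)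
    {K : ℕ → X × Y → ℕ} {Q : X × Y → ℝ} (hK : TableTendsto 𝒢 k P K Q) :
    RootTendsto 𝒢 (fun n => (typeClass n (colCnt (K n))).card) (Real.exp (entropy (margY Q))) :=
  ⟨fun _ => Nat.cast_nonneg _,
    tendsto_card_typeClass_rpow h𝒢
      (Eventually.of_forall fun _ => by rw [sum_colCnt, hK.sum_eq hk]) hK.tendsto_colCnt⟩

theorem rootTendsto_card (h𝒢 : 𝒢 ≤ atTop) (hk : ∀ n, ∑ x, k n x = n)
    (hkP : Tendsto (fun n x => (k n x / n : ℝ)) atTop (nhds P)) :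
    RootTendsto 𝒢 (fun n => (typeClass n (k n)).card) (Real.exp (entropy P)) :=
  ⟨fun _ => Nat.cast_nonneg _,
    tendsto_card_typeClass_rpow h𝒢 (Eventually.of_forall hk) (hkP.mono_left h𝒢)⟩

theorem TableTendsto.shellDens (h𝒢 : 𝒢 ≤ atTop) (hk : ∀ n, ∑ x, k n x = n)
    (hkP : Tendsto (fun n x => (k n x / n : ℝ)) atTop (nhds P)) {K : ℕ → X × Y → ℕ}
    {Q : X × Y → ℝ} (hK : TableTendsto 𝒢 k P K Q) :
    RootTendsto 𝒢 (fun n => shellDens n (K n)) (Real.exp (-mutInfo P Q)) := by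
  have h := (hK.card h𝒢 hk).div ((rootTendsto_card h𝒢 hk hkP).mul (hK.card_col h𝒢 hk))
    (by positivity)
  rw [← Real.exp_add, ← Real.exp_sub] at h
  have he : -mutInfo P Q = entropy Q - (entropy P + entropy (margY Q)) := by
    rw [mutInfo_eq hK.mem]; ring
  rw [he]
  simp only [_root_.shellDens, hK.row_eq]
  exact h

theorem tableLik_rpow {𝒰 : Set (DMC X Y)} (h𝒰 : 𝒰.Nonempty) (K : X × Y → ℕ) {n : ℕ}
    (hn : 0 < n) : tableLik 𝒰 K ^ ((n : ℝ)⁻¹) = supLik 𝒰 fun p => (K p / n : ℝ) := by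
  have hn' : (0 : ℝ) < (n : ℝ)⁻¹ := by positivity
  rw [tableLik, ← supLik_smul h𝒰 (fun p => Nat.cast_nonneg _) hn']
  simp only [div_eq_inv_mul]

theorem TableTendsto.entry_eq_zero {X Y : Type*} [Fintype Y] {k : ℕ → X → ℕ} {P : X → ℝ}
    (hk0 : ∀ n x, P x = 0 → k n x = 0) {K : ℕ → X × Y → ℕ}
    {Q : X × Y → ℝ} (hK : TableTendsto 𝒢 k P K Q) (n : ℕ) (x : X) (y : Y) (hx : P x = 0) :
    (K n (x, y) / n : ℝ) = 0 := by
  have h : rowCnt (K n) x = 0 := by rw [hK.row_eq, hk0 n x hx]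
  have h' := (Finset.sum_eq_zero_iff.1 h) y (Finset.mem_univ y)
  rw [h', Nat.cast_zero, zero_div]

theorem TableTendsto.tableLik (h𝒢 : 𝒢 ≤ atTop) (hP : P ∈ stdSimplex ℝ X)
    (hk0 : ∀ n x, P x = 0 → k n x = 0) {𝒰 : Set (DMC X Y)} (h𝒰 : 𝒰.Nonempty)
    (hc : ContinuousOn (supLik 𝒰) (jointLaws Y P)) {K : ℕ → X × Y → ℕ}
    {Q : X × Y → ℝ} (hK : TableTendsto 𝒢 k P K Q) :
    RootTendsto 𝒢 (fun n => tableLik 𝒰 (K n)) (supLik 𝒰 Q) := by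
  refine ⟨fun _ => tableLik_nonneg _ _, ?_⟩
  refine (tendsto_supLik h𝒰 hP.1 hc (Qn := fun n p => (K n p / n : ℝ)) (fun n p => by positivity)
    (hK.entry_eq_zero hk0) hK.mem hK.tendsto).congr' ?_
  filter_upwards [h𝒢 (eventually_gt_atTop 0)] with n hn
  exact (tableLik_rpow h𝒰 _ hn).symm

/-- Normalised tables live in a compact cube, so an ultrafilter provides the limit without passing
to subsequences. -/
theorem exists_tableTendsto {𝒢 : Ultrafilter ℕ} (h𝒢 : (𝒢 : Filter ℕ) ≤ atTop)
    (hk : ∀ n, ∑ x, k n x = n) (hkP : Tendsto (fun n x => (k n x / n : ℝ)) atTop (nhds P))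
    {K : ℕ → X × Y → ℕ} (hK : ∀ n, rowCnt (K n) = k n) :
    ∃ Q, TableTendsto 𝒢 k P K Q := by
  have hcpt : IsCompact (Set.Icc (0 : X × Y → ℝ) 1) := isCompact_Icc
  have hmem : ∀ n, (fun p => (K n p / n : ℝ)) ∈ Set.Icc (0 : X × Y → ℝ) 1 := by
    refine fun n => ⟨fun p => by simp only [Pi.zero_apply]; positivity, fun p => ?_⟩
    have : K n p ≤ n := le_of_sum_eq (by rw [← sum_rowCnt, hK, hk]) p
    exact div_le_one_of_le₀ (Nat.cast_le.2 this) (Nat.cast_nonneg _)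
  obtain ⟨Q, hQ, hlim⟩ := hcpt.ultrafilter_le_nhds (𝒢.map fun n p => (K n p / n : ℝ))
    (le_principal_iff.2 (mem_map.2 (univ_mem' hmem)))
  have hlim' : Tendsto (fun n p => (K n p / n : ℝ)) 𝒢 (nhds Q) := hlim
  refine ⟨Q, hK, hlim', fun p => hQ.1 p, fun x => ?_⟩
  have h1 : Tendsto (fun n => ∑ y, (K n (x, y) / n : ℝ)) 𝒢 (nhds (∑ y, Q (x, y))) :=
    tendsto_finsetSum _ fun y _ => tendsto_pi_nhds.1 hlim' (x, y)
  refine tendsto_nhds_unique h1 ?_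
  refine ((tendsto_pi_nhds.1 hkP x).mono_left h𝒢).congr fun n => ?_
  rw [← hK n, rowCnt, Nat.cast_sum, Finset.sum_div]

end TableLimits

/-! ### The constraints of the exponent as limits of the witness inequalities. -/

section LimitPoint

variable {X Y : Type*} [Fintype X] [Fintype Y] {𝒢 : Filter ℕ} {k : ℕ → X → ℕ}
  {P : X → ℝ} {𝒰 𝒲 𝒱 : Set (DMC X Y)} {R α c : ℝ} {D : ℕ} {K K' : ℕ → X × Y → ℕ}
  {Q Q' : X × Y → ℝ}

/-- The threshold for the false-alarm probability divided among the pairs of joint types. -/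
def costBound (X Y : Type*) [Fintype X] [Fintype Y] (c : ℝ) (n : ℕ) : ℝ :=
  Real.exp (n * -c) / numTables X Y n ^ 2

theorem rootTendsto_costBound (h𝒢 : 𝒢 ≤ atTop) (c : ℝ) :
    RootTendsto 𝒢 (costBound X Y c) (Real.exp (-c)) := by
  have h := (rootTendsto_exp h𝒢 (-c)).div
    ((rootTendsto_pow h𝒢 (Fintype.card X * Fintype.card Y)).mul
      (rootTendsto_pow h𝒢 (Fintype.card X * Fintype.card Y))) (by norm_num)
  rw [mul_one, div_one] at h
  simp only [← sq] at h
  exact h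

/-- The limits of the joint types that account for a large false-alarm probability. -/
theorem Witness.limit [𝒢.NeBot] (h𝒢 : 𝒢 ≤ atTop) (hP : P ∈ stdSimplex ℝ X) (hR : 0 ≤ R)
    (hk : ∀ n, ∑ x, k n x = n) (hk0 : ∀ n x, P x = 0 → k n x = 0)
    (hkP : Tendsto (fun n x => (k n x / n : ℝ)) atTop (nhds P))
    (h𝒰 : 𝒰.Nonempty) (h𝒲 : 𝒲.Nonempty) (h𝒱 : 𝒱.Nonempty) (hc𝒰 : SupLikUsc P 𝒰)
    (hc𝒲 : ContinuousOn (supLik 𝒲) (jointLaws Y P))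
    (hc𝒱 : ContinuousOn (supLik 𝒱) (jointLaws Y P))
    (hK : TableTendsto 𝒢 k P K Q) (hK' : TableTendsto 𝒢 k P K' Q')
    (hw : ∀ᶠ n in 𝒢, Witness α 𝒰 𝒲 𝒱 (k n) ((n + 1 : ℝ) ^ D) n (numCodewords R n)
      (costBound X Y c n) (K n) (K' n)) :
    margY Q' = margY Q ∧ Real.exp α * supLik 𝒲 Q' ≤ supLik 𝒱 Q' ∧
      Real.exp α * supLik 𝒲 Q ≤ supLik 𝒱 Q' * Real.exp (rateGap R P Q') ∧
      BackgroundLe R α P 𝒲 (margY Q) (supLik 𝒱 Q' * Real.exp (rateGap R P Q')) ∧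
      Real.exp (-c) ≤ supLik 𝒰 Q * Real.exp (entropy Q - entropy P) ∧
      ((∀ᶠ n in 𝒢, K n ≠ K' n) → Real.exp (-c) ≤ supLik 𝒰 Q * Real.exp (entropy Q - entropy P) *
        Real.exp (R - mutInfo P Q')) := by
  have hα := rootTendsto_exp h𝒢 α
  have hT : RootTendsto 𝒢 (numTables X Y) 1 := rootTendsto_pow h𝒢 _
  have hΛ := rootTendsto_pow h𝒢 D
  have hM : RootTendsto 𝒢 (fun n => (numCodewords R n : ℝ)) (Real.exp R) :=
    ⟨fun _ => Nat.cast_nonneg _, (tendsto_numCodewords_rpow hR).mono_left h𝒢⟩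
  have h2 := rootTendsto_const h𝒢 (c := 2) two_pos
  have h1 := rootTendsto_const h𝒢 (c := 1) one_pos
  have hmarg : margY Q' = margY Q := by
    refine tendsto_nhds_unique hK'.tendsto_colCnt (hK.tendsto_colCnt.congr' ?_)
    filter_upwards [hw] with n hn
    rw [hn.col_eq]
  have hgap : max 1 (Real.exp R * Real.exp (-mutInfo P Q')) = Real.exp (rateGap R P Q') := by
    rw [← Real.exp_add, rateGap, max_comm, ← sub_eq_add_neg, ← Real.exp_zero]
    exact (Real.exp_monotone.map_max).symm
  have hup : RootTendsto 𝒢 (fun n => numTables X Y n * (2 * (n + 1 : ℝ) ^ D *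
      max 1 (numCodewords R n * shellDens n (K' n)) * tableLik 𝒱 (K' n)))
      (supLik 𝒱 Q' * Real.exp (rateGap R P Q')) := by
    have := hT.mul (((h2.mul hΛ).mul (h1.max (hM.mul (hK'.shellDens h𝒢 hk hkP)))).mul
      (hK'.tableLik h𝒢 hP hk0 h𝒱 hc𝒱))
    rw [hgap, one_mul, one_mul, one_mul, mul_comm] at this
    exact this
  -- The class 𝒰 enters only on the larger side of the cost inequalities, so upper semicontinuity
  -- suffices.
  have husc : ∀ (S : ℕ → ℝ) (s : ℝ), RootTendsto 𝒢 S s →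
      (∀ᶠ n in 𝒢, costBound X Y c n ≤ tableLik 𝒰 (K n) * S n) →
      Real.exp (-c) ≤ supLik 𝒰 Q * s := by
    intro S s hS hle
    obtain ⟨g, hg, hgl⟩ := hc𝒰 𝒢 (fun n p => (K n p / n : ℝ)) Q (fun n p => by positivity)
      (hK.entry_eq_zero hk0) hK.mem hK.tendsto
    refine le_of_tendsto_of_tendsto (rootTendsto_costBound (X := X) (Y := Y) h𝒢 c).2 (hgl.mul hS.2) ?_
    filter_upwards [hle, hg, h𝒢 (eventually_gt_atTop 0)] with n hn hgn hn0
    calc costBound X Y c n ^ ((n : ℝ)⁻¹) ≤ (tableLik 𝒰 (K n) * S n) ^ ((n : ℝ)⁻¹) :=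
          Real.rpow_le_rpow ((rootTendsto_costBound (X := X) (Y := Y) h𝒢 c).1 n) hn (by positivity)
      _ = (supLik 𝒰 fun p => (K n p / n : ℝ)) * S n ^ ((n : ℝ)⁻¹) := by
          rw [Real.mul_rpow (tableLik_nonneg _ _) (hS.1 n), tableLik_rpow h𝒰 _ hn0]
      _ ≤ _ := mul_le_mul_of_nonneg_right hgn (Real.rpow_nonneg (hS.1 n) _)
  refine ⟨hmarg, ?_, ?_, ?_, ?_, ?_⟩
  · have := (hα.mul (hK'.tableLik h𝒢 hP hk0 h𝒲 hc𝒲)).le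
      (hT.mul (hK'.tableLik h𝒢 hP hk0 h𝒱 hc𝒱)) (hw.mono fun n hn => hn.lik_self)
    rwa [one_mul] at this
  · exact (hα.mul (hK.tableLik h𝒢 hP hk0 h𝒲 hc𝒲)).le hup (hw.mono fun n hn => hn.lik_sent)
  -- A law with I < R and the right output marginal is a limit of tables with exactly the margins of
  -- K n. Their expected enumerators eventually exceed Λ, so `lik_other` applies to them.
  · intro Q₀ hQ₀ hmQ₀ hI
    obtain ⟨J, hJr, hJc, hJ⟩ := exists_tendsto_table h𝒢 (l := fun n => colCnt (K n)) hQ₀.1 hk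
      (fun n => by rw [sum_colCnt, hK.sum_eq hk])
      (fun x => by rw [hQ₀.2 x]; exact (tendsto_pi_nhds.1 hkP x).mono_left h𝒢)
      (fun y => by
        have := tendsto_pi_nhds.1 hK.tendsto_colCnt y
        rwa [← hmQ₀] at this)
    have hJ' : TableTendsto 𝒢 k P J Q₀ := ⟨hJr, hJ, hQ₀⟩
    have hMs := hM.mul (hJ'.shellDens h𝒢 hk hkP)
    rw [← Real.exp_add, ← sub_eq_add_neg] at hMs
    have hlt : 1 < Real.exp (R - mutInfo P Q₀) := Real.one_lt_exp_iff.2 (by linarith)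
    have := (hα.mul ((hMs.div hΛ one_ne_zero).mul (hJ'.tableLik h𝒢 hP hk0 h𝒲 hc𝒲))).le hup (by
      filter_upwards [hw, hΛ.eventually_le hMs h𝒢 hlt] with n hn hle
      exact hn.lik_other (J n) (hJr n) (hJc n) hle)
    rw [div_one] at this
    linarith
  · have := husc _ _ ((hK.card h𝒢 hk).div (rootTendsto_card h𝒢 hk hkP) (Real.exp_pos _).ne')
      (hw.mono fun n hn => hn.cost_sent)
    rwa [← Real.exp_sub] at this
  · intro hne
    have := husc _ _ ((hΛ.mul hM).mul ((hK.card_col h𝒢 hk).mul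
      ((hK.shellDens h𝒢 hk hkP).mul (hK'.shellDens h𝒢 hk hkP)))) (by
        filter_upwards [hw, hne] with n hn hnen
        exact hn.cost_pair hnen)
    rw [one_mul, ← Real.exp_add, ← Real.exp_add, ← Real.exp_add] at this
    rw [mul_assoc, ← Real.exp_add]
    convert this using 3
    rw [mutInfo_eq hK.mem]
    ring

end LimitPoint

/-! ### The false-alarm exponent of good codes. -/

section Exponent

variable {X Y : Type*} [Fintype X] [Fintype Y] {k : ℕ → X → ℕ}
  {P : X → ℝ} {𝒰 𝒲 𝒱 : Set (DMC X Y)} {R α c : ℝ} {D : ℕ} {Q Q' : X × Y → ℝ}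

/-- A feasible point of small cost bounds the exponent for some channel of the class. -/
theorem exists_teExponent_le (h𝒰 : 𝒰.Nonempty) (h𝒲 : 𝒲.Nonempty) (h𝒱 : 𝒱.Nonempty)
    (hQ : Q ∈ jointLaws Y P) (hQ' : Q' ∈ jointLaws Y P) (hmarg : margY Q' = margY Q)
    (hself : Real.exp α * supLik 𝒲 Q' ≤ supLik 𝒱 Q')
    (hsent : Real.exp α * supLik 𝒲 Q ≤ supLik 𝒱 Q' * Real.exp (rateGap R P Q'))
    (hbg : BackgroundLe R α P 𝒲 (margY Q) (supLik 𝒱 Q' * Real.exp (rateGap R P Q')))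
    (hcost : Real.exp (-c) ≤ supLik 𝒰 Q * Real.exp (entropy Q - entropy P))
    (hcost' : Q = Q' ∨ Real.exp (-c) ≤ supLik 𝒰 Q * Real.exp (entropy Q - entropy P) *
      Real.exp (R - mutInfo P Q')) {d : ℝ} (hd : c < d) :
    ∃ U ∈ 𝒰, teExponent R α P U 𝒲 𝒱 ≤ d := by
  -- Only an identical law at or above the rate escapes the pair bound without having zero gap to
  -- spare; it is exactly a point of E_A. Elsewhere the penalty either vanishes or is paid through
  -- `hcost'`.
  by_cases hA : Q = Q' ∧ R ≤ mutInfo P Q'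
  · obtain ⟨rfl, hI⟩ := hA
    have hgap : rateGap R P Q = 0 := max_eq_right (by linarith)
    rw [hgap, Real.exp_zero, mul_one] at hbg
    obtain ⟨U, hU, hlt⟩ := exists_condDiv_lt h𝒰 hQ
      ((Real.exp_lt_exp.2 (neg_lt_neg hd)).trans_le hcost)
    exact ⟨U, hU, (min_le_left _ _).trans
      ((iInf₂_le Q ((mem_setJ_iff h𝒲 h𝒱).2 ⟨hQ, hself, hbg⟩)).trans hlt.le)⟩
  · have hr : Real.exp (-(c - max (mutInfo P Q' - R) 0)) ≤
        supLik 𝒰 Q * Real.exp (entropy Q - entropy P) := by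
      rcases le_total (mutInfo P Q' - R) 0 with h | h
      · rwa [max_eq_right h, sub_zero]
      · have hc' := hcost'.resolve_left fun he => hA ⟨he, by linarith⟩
        rw [max_eq_left h, show -(c - (mutInfo P Q' - R)) = -c - (R - mutInfo P Q') by ring,
          Real.exp_sub]
        exact (div_le_iff₀ (Real.exp_pos _)).2 hc'
    obtain ⟨U, hU, hlt⟩ := exists_condDiv_lt (d := d - max (mutInfo P Q' - R) 0) h𝒰 hQ
      ((Real.exp_lt_exp.2 (by linarith)).trans_le hr)
    refine ⟨U, hU, (min_le_right _ _).trans ((iInf₂_le (Q, Q')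
      ((mem_setK_iff h𝒲 h𝒱).2 ⟨hQ, hQ', hmarg, hself, hsent, hbg⟩)).trans ?_)⟩
    refine (add_le_add_left hlt.le _).trans (le_of_eq ?_)
    rw [← EReal.coe_add]
    simp only [sub_add_cancel]

/-- If the bound failed for infinitely many n, the witnesses at these n would have limits along an
ultrafilter, and these would give a channel in 𝒰 with an exponent below the infimum. The blocklength
threshold is common to all of 𝒰, which the worst-case statements need. -/
theorem eventually_faProb_le (hP : P ∈ stdSimplex ℝ X) (hR : 0 ≤ R)
    (hk : ∀ n, ∑ x, k n x = n) (hk0 : ∀ n x, P x = 0 → k n x = 0)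
    (hkP : Tendsto (fun n x => (k n x / n : ℝ)) atTop (nhds P))
    (h𝒰 : 𝒰.Nonempty) (h𝒲 : 𝒲.Nonempty) (h𝒱 : 𝒱.Nonempty) (hc𝒰 : SupLikUsc P 𝒰)
    (hc𝒲 : ContinuousOn (supLik 𝒲) (jointLaws Y P))
    (hc𝒱 : ContinuousOn (supLik 𝒱) (jointLaws Y P)) {C : CodeSeq X R}
    (hC : ∀ᶠ n in atTop, GoodCode Y (k n) ((n + 1 : ℝ) ^ D) (C n))
    (hc : (c : EReal) < ⨅ U ∈ 𝒰, teExponent R α P U 𝒲 𝒱) :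
    ∀ᶠ n in atTop, ∀ U ∈ 𝒰, faProb α U 𝒲 𝒱 (C n) ≤ Real.exp (n * -c) := by
  by_contra hcon
  let S : Set ℕ := {n | ∃ K K' : X × Y → ℕ, rowCnt K = k n ∧ rowCnt K' = k n ∧
    Witness α 𝒰 𝒲 𝒱 (k n) ((n + 1 : ℝ) ^ D) n (numCodewords R n) (costBound X Y c n) K K'}
  have hS : ∃ᶠ n in atTop, n ∈ S := by
    refine ((not_eventually.1 hcon).and_eventually hC).mono fun n hn => ?_
    obtain ⟨hn, hgood⟩ := hn
    push Not at hn
    obtain ⟨U, hU, hlt⟩ := hn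
    have hT : 0 < numTables X Y n := by unfold numTables; positivity
    refine exists_witness hgood (numCodewords_pos R n) hU
      (div_nonneg (Real.exp_pos _).le (sq_nonneg _)) ?_
    rwa [costBound, mul_div_cancel₀ _ (pow_pos hT 2).ne']
  have hne : (atTop ⊓ 𝓟 S).NeBot := frequently_iff_neBot.1 hS
  let 𝒢 : Ultrafilter ℕ := Ultrafilter.of (atTop ⊓ 𝓟 S)
  have h𝒢 : (𝒢 : Filter ℕ) ≤ atTop := (Ultrafilter.of_le _).trans inf_le_left
  have h𝒢S : ∀ᶠ n in 𝒢, n ∈ S := (Ultrafilter.of_le _).trans inf_le_right (mem_principal_self S)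
  obtain ⟨U₀, _⟩ := h𝒰
  obtain ⟨x₀⟩ : Nonempty X := by
    by_contra h
    rw [not_nonempty_iff] at h
    have := hP.2
    simp at this
  obtain ⟨y₀⟩ : Nonempty Y := by
    by_contra h
    rw [not_nonempty_iff] at h
    have := U₀.sum_eq_one x₀
    simp at this
  -- Outside S an arbitrary table with the right row sums fills the sequence; the ultrafilter does
  -- not see it.
  have hex : ∀ n, ∃ K K' : X × Y → ℕ, rowCnt K = k n ∧ rowCnt K' = k n ∧ (n ∈ S →
      Witness α 𝒰 𝒲 𝒱 (k n) ((n + 1 : ℝ) ^ D) n (numCodewords R n) (costBound X Y c n) K K') := by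
    classical
    intro n
    by_cases hn : n ∈ S
    · obtain ⟨K, K', h1, h2, h3⟩ := hn
      exact ⟨K, K', h1, h2, fun _ => h3⟩
    · obtain ⟨K, hK, _⟩ := exists_table (k n) (Pi.single y₀ n) (by simp [hk n])
      exact ⟨K, K, hK, hK, fun h => absurd h hn⟩
  choose K K' hK hK' hw using hex
  obtain ⟨Q, hQ⟩ := exists_tableTendsto h𝒢 hk hkP hK
  obtain ⟨Q', hQ'⟩ := exists_tableTendsto h𝒢 hk hkP hK'
  obtain ⟨hmarg, hself, hsent, hbg, hcost, hcost'⟩ := Witness.limit h𝒢 hP hR hk hk0 hkP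
    ⟨U₀, ‹_›⟩ h𝒲 h𝒱 hc𝒰 hc𝒲 hc𝒱 hQ hQ' (h𝒢S.mono hw)
  obtain ⟨d, hcd, hd⟩ := EReal.lt_iff_exists_real_btwn.1 hc
  obtain ⟨U, hU, hle⟩ := exists_teExponent_le ⟨U₀, ‹_›⟩ h𝒲 h𝒱 hQ.mem hQ'.mem hmarg hself hsent
    hbg hcost (by
      -- The ultrafilter decides whether the sent and the dominating type agree: if so their limits
      -- agree, otherwise the pair bound is available.
      rcases Ultrafilter.em 𝒢 fun n => K n = K' n with h | h
      · left
        refine tendsto_nhds_unique hQ.tendsto (hQ'.tendsto.congr' ?_)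
        filter_upwards [h] with n hn
        rw [hn]
      · exact Or.inr (hcost' h)) (EReal.coe_lt_coe_iff.1 hcd)
  exact absurd (hd.trans_le (iInf₂_le U hU)) (not_lt.2 hle)

end Exponent

/-! ### Passage to error exponents. -/

section Final

variable {X Y : Type*} [Fintype X] [Fintype Y]

theorem le_errExponent {p : ℕ → ℝ} {E : EReal}
    (h : ∀ c : ℝ, (c : EReal) < E → ∀ᶠ n : ℕ in atTop, p n ≤ Real.exp (n * -c)) :
    E ≤ errExponent p := by
  refine EReal.ge_of_forall_gt_iff_ge.1 fun c hc => ?_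
  refine le_liminf_of_le (by isBoundedDefault) ?_
  filter_upwards [h c hc, eventually_gt_atTop 0] with n hn hn0
  rw [EReal.le_div_iff_mul_le (by exact_mod_cast hn0) (EReal.natCast_ne_top n), EReal.le_neg]
  calc ENNReal.log (ENNReal.ofReal (p n))
      ≤ ENNReal.log (ENNReal.ofReal (Real.exp (n * -c))) :=
        ENNReal.log_le_log_iff.2 (ENNReal.ofReal_le_ofReal hn)
    _ = -((c : EReal) * n) := by
        rw [log_ofReal_exp, mul_neg, mul_comm, EReal.coe_neg, EReal.coe_mul, EReal.coe_natCast]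

theorem outProb_mono {X Y : Type*} [Fintype Y] (W : DMC X Y) {n M : ℕ} (x : Fin M → Fin n → X) {A B : Set (Fin n → Y)}
    (h : A ⊆ B) : outProb W x A ≤ outProb W x B := by
  unfold outProb
  refine mul_le_mul_of_nonneg_left (Finset.sum_le_sum fun m _ => Finset.sum_le_sum fun y _ => ?_)
    (by positivity)
  exact Set.indicator_le_indicator_of_subset h
    (fun y => Finset.prod_nonneg fun i _ => W.nonneg _ _) y

/-- This makes misdetection a false alarm of the exchanged problem. Ties belong to both rejection
regions, hence an inclusion only. -/
theorem compl_rejU_subset {X Y : Type*} [Fintype Y] (α : ℝ) (𝒲 𝒱 : Set (DMC X Y)) {n M : ℕ} (x : Fin M → Fin n → X) :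
    (rejU α 𝒲 𝒱 x)ᶜ ⊆ rejU (-α) 𝒱 𝒲 x := by
  intro y hy
  have hy' : ∑ m, maxLik 𝒱 (x m) y < Real.exp (n * α) * ∑ m, maxLik 𝒲 (x m) y := not_le.1 hy
  change Real.exp (n * -α) * ∑ m, maxLik 𝒱 (x m) y ≤ ∑ m, maxLik 𝒲 (x m) y
  rw [mul_neg, Real.exp_neg]
  exact (inv_mul_le_iff₀ (Real.exp_pos _)).2 hy'.le

theorem sub_coe_le_self (E : EReal) {δ : ℝ} (hδ : 0 < δ) : E - (δ : EReal) ≤ E := by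
  rw [EReal.sub_le_iff_le_add (Or.inl (EReal.coe_ne_bot _)) (Or.inl (EReal.coe_ne_top _))]
  exact le_add_of_nonneg_right (by exact_mod_cast hδ.le)

end Final

theorem corollary1 {X Y : Type*} [Fintype X] [Fintype Y]
    (𝒲 𝒱 : Set (DMC X Y)) (h𝒲 : 𝒲.Nonempty) (h𝒱 : 𝒱.Nonempty)
    (P : X → ℝ) (hP : P ∈ stdSimplex ℝ X)
    (hf𝒲 : ContinuousOn (genLogLik 𝒲) (jointLaws Y P))
    (hf𝒱 : ContinuousOn (genLogLik 𝒱) (jointLaws Y P))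
    (R : ℝ) (hR : 0 ≤ R) (α : ℝ) :
    ∃ C : CodeSeq X R,
      (R < entropy P → ∀ n, Function.Injective (C n)) ∧
      ∀ δ : ℝ, 0 < δ →
        (∀ W ∈ 𝒲, teExponent R α P W 𝒲 𝒱 - (δ : EReal) ≤
          errExponent (fun n => faProb α W 𝒲 𝒱 (C n))) ∧
        teExponentWorst R α P 𝒲 𝒱 - (δ : EReal) ≤
          errExponent (fun n => faProbWorst α 𝒲 𝒱 (C n)) ∧
        (0 < teExponentWorst R (-α) P 𝒱 𝒲 →
          teExponentWorst R α P 𝒲 𝒱 - (α : EReal) - (δ : EReal) ≤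
            errExponent (fun n => mdProbWorst α 𝒲 𝒱 (C n))) := by
  have hc𝒲 := continuousOn_supLik h𝒲 hf𝒲
  have hc𝒱 := continuousOn_supLik h𝒱 hf𝒱
  obtain ⟨k, hk, hk0, hkP⟩ := exists_tendsto_type hP
  obtain ⟨C, D, hinj, hC⟩ := exists_goodCode_seq Y hP hR hk hkP
  refine ⟨C, hinj, fun δ hδ => ⟨fun W _ => ?_, ?_, fun hpos => ?_⟩⟩
  · refine (sub_coe_le_self _ hδ).trans (le_errExponent fun c hc => ?_)
    have := eventually_faProb_le (𝒰 := {W}) hP hR hk hk0 hkP (Set.singleton_nonempty W) h𝒲 h𝒱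
      (supLikUsc_singleton W P) hc𝒲 hc𝒱 hC (by rwa [iInf_singleton])
    exact this.mono fun n hn => hn W rfl
  · refine (sub_coe_le_self _ hδ).trans (le_errExponent fun c hc => ?_)
    have : Nonempty 𝒲 := h𝒲.to_subtype
    have := eventually_faProb_le hP hR hk hk0 hkP h𝒲 h𝒲 h𝒱
      (supLikUsc_of_continuousOn h𝒲 hP.1 hc𝒲) hc𝒲 hc𝒱 hC hc
    exact this.mono fun n hn => ciSup_le fun W => hn W W.2
  -- The exchanged exponent is the intermediate quantity: it bounds the misdetection exponent of the
  -- same code from below and is itself at least the false-alarm exponent minus α.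
  · refine (sub_coe_le_self _ hδ).trans (le_trans ?_
      (le_errExponent (E := teExponentWorst R (-α) P 𝒱 𝒲) fun c hc => ?_))
    · refine EReal.le_of_forall_lt_iff_le.1 fun c hc => ?_
      rw [EReal.sub_le_iff_le_add (Or.inl (EReal.coe_ne_bot _)) (Or.inl (EReal.coe_ne_top _))]
      exact teExponentWorst_le_add_of_pos hP hR h𝒲 h𝒱 hc𝒲 hc𝒱 hpos hc
    · have : Nonempty 𝒱 := h𝒱.to_subtype
      have := eventually_faProb_le hP hR hk hk0 hkP h𝒱 h𝒱 h𝒲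
        (supLikUsc_of_continuousOn h𝒱 hP.1 hc𝒱) hc𝒱 hc𝒲 hC hc
      exact this.mono fun n hn => ciSup_le fun V =>
        (outProb_mono _ _ (compl_rejU_subset α 𝒲 𝒱 (C n))).trans (hn V V.2)

end
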